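/- All graphs are finite and simple. The degree sequence of a graph is the list of its vertex degrees in non-increasing order; a \emph{unigraph} is a graph that is isomorphic to every graph with the same degree sequence. Let $HCU$ be the class of all graphs that are isomorphic to an induced subgraph of some unigraph. A \emph{split graph} is a graph $G$ whose vertex set is a disjoint union $V(G)=K\cup S$ with $K$ a clique and $S$ a stable set ($K$ or $S$ may be empty); $K \cup S$ is then called a $KS$-partition of $G$. For a split graph $G$ with a fixed $KS$-partition $K\cup S$ and any graph $H$, the \emph{composition} $G\circ H=(G,K,S)\circ H$ is the graph on the disjoint union $V(G)\sqcup V(H)$ with edge set $E(G)\cup E(H)\cup\{uv : u\in K,\ v\in V(H)\}$. A graph is \emph{decomposable} if it is isomorphic to $G_1\circ G_0$ for some graphs $G_1,G_0$, each with at least one vertex, where $G_1$ is split with some $KS$-partition; otherwise it is \emph{indecomposable}. A \emph{Tyshkevich decomposition} of $G$ is an expression of $G$, up to isomorphism, as $$G = G_n\circ\cdots\circ G_1\circ G_0 \qquad (n\ge 0),$$ where $G_n,\dots,G_1$ are split graphs with fixed $KS$-partitions and all of the components $G_n,\dots,G_0$ are indecomposable and have at least one vertex (the graph without vertices is indecomposable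 and is regarded as its own decomposition, with $n=0$). Let $\mathcal I$ be the class of indecomposable graphs that are isomorphic to an induced subgraph of some unigraph. \textbf{Theorem.} Every graph $G$ has a Tyshkevich decomposition, and for every Tyshkevich decomposition $G=G_n\circ\cdots\circ G_0$ of $G$, $$G\in HCU \iff G_i\in\mathcal I \text{ for all } 0\le i\le n.$$ -/

import Mathlib

universe u v

/-- The degree sequence of a finite graph: the list of its vertex degrees in non-increasing order. -/
noncomputable def SimpleGraph.degreeSequence {V : Type u} [Fintype V] (G : SimpleGraph V) :
    List ℕ :=
  open scoped Classical in
  ((Finset.univ : Finset V).val.map fun v => G.degree v).sort (· ≥ ·)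

/-- A unigraph: a finite graph isomorphic to every finite graph with the same degree sequence. -/
def IsUnigraph {V : Type u} [Fintype V] (G : SimpleGraph V) : Prop :=
  ∀ (W : Type u) [Fintype W] (H : SimpleGraph W),
    H.degreeSequence = G.degreeSequence → Nonempty (G ≃g H)

/-- `HCU`, the hereditary closure of the unigraphs: graphs that are (isomorphic to) an induced
subgraph of some unigraph. -/
def InHCU {V : Type u} (G : SimpleGraph V) : Prop :=
  ∃ (W : Type u) (_ : Fintype W) (U : SimpleGraph W), IsUnigraph U ∧ G.IsIndContained U

/-- `K ∪ S` is a `KS`-partition of `G`: the vertex set is the disjoint union of the clique `K` and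
the stable set `S` (either may be empty). -/
structure IsKSPartition {V : Type u} (G : SimpleGraph V) (K S : Set V) : Prop where
  isCompl : IsCompl K S
  isClique : G.IsClique K
  isIndepSet : G.IsIndepSet S

/-- A finite simple graph bundled with its vertex type. -/
structure FinGraph : Type (u + 1) where
  V : Type u
  [fintypeV : Fintype V]
  graph : SimpleGraph V

attribute [instance] FinGraph.fintypeV

/-- A finite split graph with a fixed `KS`-partition. -/
structure KSGraph : Type (u + 1) extends FinGraph.{u} where
  K : Set V
  S : Set V
  isKSPartition : IsKSPartition graph K S

/-- The edge relation of the Tyshkevich composition `(G, K, S) ∘ H`: the edges of `G`, the edges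
of `H`, and all edges between `K` and `V(H)`. -/
def tyshkevichComp {V : Type u} {W : Type v} (G : SimpleGraph V) (K : Set V) (H : SimpleGraph W) :
    SimpleGraph (V ⊕ W) where
  Adj
    | .inl a, .inl b => G.Adj a b
    | .inl a, .inr _ => a ∈ K
    | .inr _, .inl b => b ∈ K
    | .inr a, .inr b => H.Adj a b
  symm := ⟨by
    rintro (a | a) (b | b) h
    · exact G.adj_symm h
    · exact h
    · exact h
    · exact H.adj_symm h⟩
  loopless := ⟨by
    rintro (a | a) h
    · exact G.loopless.irrefl a h
    · exact H.loopless.irrefl a h⟩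

/-- The Tyshkevich composition `G ∘ H` of a split graph with fixed `KS`-partition and a graph. -/
def KSGraph.comp (G : KSGraph.{u}) (H : FinGraph.{u}) : FinGraph.{u} where
  V := G.V ⊕ H.V
  graph := tyshkevichComp G.graph G.K H.graph

/-- For a list `[Gₙ, …, G₁]` of split graphs with fixed `KS`-partitions and a graph `G₀`, the
composition `Gₙ ∘ (⋯ ∘ (G₁ ∘ G₀))`. -/
def iteratedComp (L : List KSGraph.{u}) (G₀ : FinGraph.{u}) : FinGraph.{u} :=
  L.foldr KSGraph.comp G₀

/-- `G` is decomposable: `G = G₁ ∘ G₀` for some nonempty graphs `G₁`, `G₀` with `G₁` split. -/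
def Decomposable {V : Type u} (G : SimpleGraph V) : Prop :=
  ∃ (G₁ : KSGraph.{u}) (G₀ : FinGraph.{u}), Nonempty G₁.V ∧ Nonempty G₀.V ∧
    Nonempty (G ≃g (G₁.comp G₀).graph)

def Indecomposable {V : Type u} (G : SimpleGraph V) : Prop :=
  ¬ Decomposable G

/-- The class `𝓘` of indecomposable graphs induced in a unigraph. -/
def InI {V : Type u} (G : SimpleGraph V) : Prop :=
  Indecomposable G ∧ ∃ (W : Type u) (_ : Fintype W) (U : SimpleGraph W),
    IsUnigraph U ∧ G.IsIndContained U

/-- `G = Gₙ ∘ ⋯ ∘ G₁ ∘ G₀`, with `L = [Gₙ, …, G₁]`, is a Tyshkevich decomposition of `G`: all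
components are indecomposable and nonempty. The only exception to nonemptiness is the graph without
vertices, which is indecomposable and has itself as its only component. -/
structure IsTyshkevichDecomposition {V : Type u} (G : SimpleGraph V)
    (L : List KSGraph.{u}) (G₀ : FinGraph.{u}) : Prop where
  nonempty_left : ∀ C ∈ L, Nonempty C.V
  nonempty_right : L ≠ [] → Nonempty G₀.V
  indecomposable_left : ∀ C ∈ L, Indecomposable C.graph
  indecomposable_right : Indecomposable G₀.graph
  iso : Nonempty (G ≃g (iteratedComp L G₀).graph)

/-! Components of a composition are induced subgraphs and `InHCU` is hereditary; this is the easy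
direction. A decomposition exists because a left part with minimal vertex set is indecomposable, so
such parts can be split off one after another.

The substance is that an indecomposable split graph C with parts K and S, induced in some unigraph
U, can be put in front of any member of HCU (`InHCU.comp`). Since U need not be split, it cannot
itself be composed with anything. Only the bipartite graph between K and S matters: it suffices to
embed it in a relation on A × B determined by its row and column sums (`BiUni`). The split graph of
such a relation composed with a unigraph is again a unigraph (`IsUni.tyshkevichComp`). Indeed the
degree sum over A minus the degree sum over B is as large as possible exactly for graphs with the
shape of such a composition, so every graph with the same degrees has that shape.

The relation is found in `KSIrr.ksEmb`, by induction on the order of U. Unions of degree classes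
induce unigraphs (`IsUni.induce`), so every degree of U may be assumed to occur on C. If U is
decomposable, C must lie in its left part. There, and also when U is split, vertices of K have
larger degree in U than those of S, and the edges between disjoint unions of degree classes form a
determined relation (`IsUni.biUni`). If U is neither, `IsUni.exists_near_regular` says that all
vertices but at most one have the same degree, at most 2 or at least the order minus 3; then, up to
complementation, K has two vertices and the relation is explicit.

Near-regularity is obtained without the classification of unigraphs. Replacing edges xp, yq by xq,
yp preserves degrees, hence yields an isomorphic graph. Equating isomorphism invariants before and
after (degree-weighted edge sums, squares of neighbour weights, numbers of triangles) gives rigid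
identities: `IsUni.dg_eq_or`, `IsUni.wsum_sub`, `IsUni.triangles` and their consequence
`IsUni.four`. These show that a degree class which is neither a clique nor stable leaves room for at
most one further vertex (`IsUni.exists_exception`), that the common degree is extreme
(`IsUni.le_two_or`), and that without such a class the graph is split (`IsUni.exists_split`). -/

open scoped Classical in
/-- The finset of neighbours of a vertex of a finite graph. -/
noncomputable def SimpleGraph.nb {V : Type u} [Fintype V] (G : SimpleGraph V) (v : V) : Finset V :=
  Finset.univ.filter (G.Adj v)

/-- The degree of a vertex of a finite graph, with no decidability assumption. -/
noncomputable def SimpleGraph.dg {V : Type u} [Fintype V] (G : SimpleGraph V) (v : V) : ℕ :=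
  (G.nb v).card

open scoped Classical in
/-- The private neighbours of `x` with respect to `y`: the set `N(x) \ N[y]`. -/
noncomputable def SimpleGraph.priv {V : Type u} [Fintype V] (G : SimpleGraph V) (x y : V) :
    Finset V :=
  Finset.univ.filter fun w => G.Adj x w ∧ ¬ G.Adj y w ∧ w ≠ y

/-- Every graph on the same vertex set with the same degrees is isomorphic to `G`. -/
def SimpleGraph.IsUni {V : Type u} [Fintype V] (G : SimpleGraph V) : Prop :=
  ∀ G' : SimpleGraph V, (∀ v, G'.dg v = G.dg v) → Nonempty (G ≃g G')

/-- `x p` and `y q` are edges, `x q` and `y p` are distinct nonadjacent vertices. -/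
structure SimpleGraph.Alt {V : Type u} (G : SimpleGraph V) (x p y q : V) : Prop where
  xp : G.Adj x p
  yq : G.Adj y q
  xq : ¬ G.Adj x q
  yp : ¬ G.Adj y p
  nxq : x ≠ q
  nyp : y ≠ p

open scoped Classical in
/-- The `0`-`1` adjacency matrix over the integers. -/
noncomputable def SimpleGraph.amat {V : Type u} (G : SimpleGraph V) : Matrix V V ℤ :=
  fun u v => if G.Adj u v then 1 else 0

open scoped Classical in
/-- The vector with entry `1` at `x` and `-1` at `y`. -/
noncomputable def diffVec {V : Type u} (x y : V) : V → ℤ :=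
  Pi.single x 1 - Pi.single y 1

/-- The graph obtained by replacing the edges `x p`, `y q` by `x q`, `y p`. -/
def SimpleGraph.sw {V : Type u} (G : SimpleGraph V) (x p y q : V) : SimpleGraph V :=
  (G \ (SimpleGraph.edge x p ⊔ SimpleGraph.edge y q)) ⊔
    (SimpleGraph.edge x q ⊔ SimpleGraph.edge y p)

/-! ### Unigraphs on a fixed vertex set, private neighbours, and degree identities from switching.
-/

namespace SimpleGraph

section
open scoped Classical

variable {V : Type u} {W : Type u}

@[simp] theorem mem_nb [Fintype V] {G : SimpleGraph V} {v w : V} : w ∈ G.nb v ↔ G.Adj v w := by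
  simp [nb]

@[simp] theorem mem_priv [Fintype V] {G : SimpleGraph V} {x y w : V} :
    w ∈ G.priv x y ↔ G.Adj x w ∧ ¬ G.Adj y w ∧ w ≠ y := by
  simp [priv]

theorem dg_eq_degree [Fintype V] (G : SimpleGraph V) (v : V) : G.degree v = G.dg v := by
  rw [← card_neighborFinset_eq_degree]
  unfold dg
  congr 1
  ext w
  simp

theorem dg_iso [Fintype V] [Fintype W] {G : SimpleGraph V} {H : SimpleGraph W} (φ : G ≃g H)
    (v : V) : H.dg (φ v) = G.dg v := by
  rw [← dg_eq_degree, ← dg_eq_degree]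
  exact φ.degree_eq v

theorem degreeSequence_eq_iff [Fintype V] [Fintype W] {G : SimpleGraph V} {H : SimpleGraph W} :
    H.degreeSequence = G.degreeSequence ↔
      (Finset.univ : Finset W).val.map H.dg = (Finset.univ : Finset V).val.map G.dg := by
  unfold degreeSequence
  have h1 : (fun v => H.degree v) = H.dg := funext fun v => H.dg_eq_degree v
  have h2 : (fun v => G.degree v) = G.dg := funext fun v => G.dg_eq_degree v
  rw [h1, h2]
  constructor
  · intro h
    have := congrArg (fun l : List ℕ => (l : Multiset ℕ)) h
    simpa using this
  · intro h
    rw [h]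

/-- Two functions with equal multisets of values differ by a bijection. -/
theorem exists_equiv_of_map_eq [Fintype V] [Fintype W] {f : V → ℕ} {g : W → ℕ}
    (h : (Finset.univ : Finset W).val.map g = (Finset.univ : Finset V).val.map f) :
    ∃ e : V ≃ W, ∀ v, g (e v) = f v := by
  have hc : ∀ n, Fintype.card {v // f v = n} = Fintype.card {w // g w = n} := by
    intro n
    have := congrArg (Multiset.count n) h
    rw [Multiset.count_map, Multiset.count_map] at this
    rw [Fintype.card_subtype, Fintype.card_subtype]
    simp only [Finset.card, Finset.filter_val]
    convert this.symm using 3 <;> exact eq_comm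
  have e : ∀ n, {v // f v = n} ≃ {w // g w = n} := fun n => Fintype.equivOfCardEq (hc n)
  refine ⟨(Equiv.sigmaFiberEquiv f).symm.trans
    ((Equiv.sigmaCongrRight e).trans (Equiv.sigmaFiberEquiv g)), fun v => ?_⟩
  simp [Equiv.sigmaFiberEquiv, Equiv.sigmaCongrRight]
  exact (e (f v) ⟨v, rfl⟩).2

/-- A graph with the same degree sequence can be pulled back along a degree-preserving bijection, so
only graphs on the same vertex set need be considered. -/
theorem isUnigraph_iff [Fintype V] {G : SimpleGraph V} : IsUnigraph G ↔ G.IsUni := by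
  constructor
  · intro h G' hd
    refine h V G' (degreeSequence_eq_iff.2 ?_)
    rw [funext hd]
  · intro h W _ H hs
    obtain ⟨e, he⟩ := exists_equiv_of_map_eq (degreeSequence_eq_iff.1 hs)
    have ψ : H.comap e ≃g H := Iso.comap e H
    obtain ⟨φ⟩ := h (H.comap e) (fun v => by
      rw [← he v, ← dg_iso (Iso.comap e H) v]; rfl)
    exact ⟨φ.trans (Iso.comap e H)⟩

theorem IsUni.of_iso [Fintype V] [Fintype W] {G : SimpleGraph V} {H : SimpleGraph W}
    (hG : G.IsUni) (φ : G ≃g H) : H.IsUni := by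
  intro H' hd
  have : Nonempty (G ≃g H'.comap φ.toEquiv) := hG _ fun v => by
    rw [← dg_iso φ v, ← hd, ← dg_iso (Iso.comap φ.toEquiv H') v]; rfl
  obtain ⟨ψ⟩ := this
  exact ⟨φ.symm.trans (ψ.trans (Iso.comap φ.toEquiv H'))⟩

theorem dg_compl [Fintype V] (G : SimpleGraph V) (v : V) :
    Gᶜ.dg v + G.dg v + 1 = Fintype.card V := by
  have h : Gᶜ.nb v = (G.nb v ∪ {v})ᶜ := by
    ext w
    simp [eq_comm]
  have h2 : (G.nb v ∪ {v}).card = (G.nb v).card + 1 := by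
    rw [Finset.card_union_of_disjoint (by simp)]; simp
  have h3 := Finset.card_compl_add_card (G.nb v ∪ {v})
  unfold dg
  rw [h]
  omega

theorem IsUni.compl [Fintype V] {G : SimpleGraph V} (hG : G.IsUni) : Gᶜ.IsUni := by
  intro G' hd
  obtain ⟨φ⟩ := hG G'ᶜ fun v => by
    have h1 := dg_compl G' v
    have h2 := dg_compl G v
    have h3 := hd v
    omega
  refine ⟨⟨φ.toEquiv, ?_⟩⟩
  intro a b
  have h := φ.map_rel_iff (a := a) (b := b)
  have hn : φ a = φ b ↔ a = b := φ.injective.eq_iff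
  simp only [compl_adj] at h ⊢
  change G'.Adj (φ a) (φ b) ↔ _
  change (φ a ≠ φ b ∧ ¬ G'.Adj (φ a) (φ b)) ↔ _ at h
  by_cases hab : a = b
  · subst hab; simp
  · have : φ a ≠ φ b := fun h => hab (hn.1 h)
    tauto

/-- Common neighbours and a possible edge between `x` and `y` contribute equally to both degrees, so
the private neighbours carry the whole difference. -/
theorem card_priv [Fintype V] (G : SimpleGraph V) (x y : V) :
    G.dg x + (G.priv y x).card = G.dg y + (G.priv x y).card := by
  have key : ∀ x y : V, G.dg x = (G.priv x y).card +
      ((Finset.univ.filter fun w => G.Adj x w ∧ G.Adj y w).card + if G.Adj x y then 1 else 0) := by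
    intro x y
    have : G.nb x = G.priv x y ∪ ((Finset.univ.filter fun w => G.Adj x w ∧ G.Adj y w) ∪
        if G.Adj x y then {y} else ∅) := by
      ext w
      by_cases h : G.Adj x y <;> by_cases hw : w = y <;>
        simp [h, hw, ← and_or_left, em'] 
    unfold dg
    rw [this, Finset.card_union_of_disjoint, Finset.card_union_of_disjoint]
    · congr 2
      split_ifs <;> simp
    · rw [Finset.disjoint_left]
      intro w hw
      split_ifs with h
      · rintro h'
        simp at h' hw
        subst h'
        exact G.irrefl hw.2
      · simp
    · rw [Finset.disjoint_left]
      intro w hw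
      simp at hw
      split_ifs with h <;> simp [hw]
  have h1 := key x y
  have h2 := key y x
  have h3 : (Finset.univ.filter fun w => G.Adj x w ∧ G.Adj y w) =
      (Finset.univ.filter fun w => G.Adj y w ∧ G.Adj x w) := by
    ext; simp [and_comm]
  rw [h3] at h1
  simp only [G.adj_comm x y] at h1
  omega

theorem priv_compl [Fintype V] (G : SimpleGraph V) (x y : V) : Gᶜ.priv x y = G.priv y x := by
  ext w
  simp only [mem_priv, compl_adj]
  constructor
  · rintro ⟨⟨h1, h2⟩, h3, h4⟩
    exact ⟨by by_contra h; exact h3 ⟨fun e => h4 e.symm, h⟩, h2, fun e => h1 e.symm⟩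
  · rintro ⟨h1, h2, h3⟩
    exact ⟨⟨fun e => h3 e.symm, h2⟩, fun h => h.2 h1, fun e => by subst e; exact G.irrefl h1⟩

/-! ### Switching along an alternating 4-cycle -/

theorem Alt.nxy {G : SimpleGraph V} {x p y q : V} (h : G.Alt x p y q) : x ≠ y := by
  rintro rfl; exact h.xq h.yq

theorem Alt.npq {G : SimpleGraph V} {x p y q : V} (h : G.Alt x p y q) : p ≠ q := by
  rintro rfl; exact h.xq h.xp

theorem Alt.symm {G : SimpleGraph V} {x p y q : V} (h : G.Alt x p y q) : G.Alt p x q y :=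
  ⟨h.xp.symm, h.yq.symm, fun e => h.yp e.symm, fun e => h.xq e.symm, h.nyp.symm, h.nxq.symm⟩

theorem alt_of_priv [Fintype V] {G : SimpleGraph V} {x p y q : V} (hp : p ∈ G.priv x y)
    (hq : q ∈ G.priv y x) : G.Alt x p y q := by
  simp at hp hq
  exact ⟨hp.1, hq.1, hq.2.1, hp.2.1, Ne.symm hq.2.2, Ne.symm hp.2.2⟩

theorem amat_symm (G : SimpleGraph V) (u v : V) : G.amat u v = G.amat v u := by
  simp [amat, G.adj_comm]

theorem amat_self (G : SimpleGraph V) (u : V) : G.amat u u = 0 := by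
  simp [amat]

theorem amat_one {G : SimpleGraph V} {u v : V} (h : G.Adj u v) : G.amat u v = 1 := by
  simp [amat, h]

theorem amat_zero {G : SimpleGraph V} {u v : V} (h : ¬ G.Adj u v) : G.amat u v = 0 := by
  simp [amat, h]

/-- In matrix terms a switching subtracts `u vᵀ + v uᵀ` with `u = diffVec x y` and `v = diffVec p
q`. This turns the comparison of invariants before and after into algebra. -/
theorem amat_sw {G : SimpleGraph V} {x p y q : V} (h : G.Alt x p y q) :
    (G.sw x p y q).amat = G.amat - (Matrix.vecMulVec (diffVec x y) (diffVec p q) +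
      Matrix.vecMulVec (diffVec p q) (diffVec x y)) := by
  have h1 := h.xp
  have h2 := h.yq
  have h3 := h.xq
  have h4 := h.yp
  have n1 := h.nxq
  have n2 := h.nyp
  have n3 := h.nxy
  have n4 := h.npq
  have n5 := h.xp.ne
  have n6 := h.yq.ne
  have h1' := h1.symm
  have h2' := h2.symm
  have h3' : ¬ G.Adj q x := fun e => h3 e.symm
  have h4' : ¬ G.Adj p y := fun e => h4 e.symm
  ext u v
  have huv : G.Adj u v → u ≠ v := fun e => e.ne
  simp only [amat, sw, Matrix.sub_apply, Matrix.add_apply, Matrix.vecMulVec_apply, diffVec,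
    Pi.sub_apply, Pi.single_apply, sup_adj, sdiff_adj, edge_adj]
  by_cases hux : u = x
  · grind
  by_cases huy : u = y
  · grind
  by_cases hup : u = p
  · grind
  by_cases huq : u = q
  · grind
  grind

theorem dg_eq_sum [Fintype V] (G : SimpleGraph V) (v : V) : (G.dg v : ℤ) = ∑ w, G.amat v w := by
  simp [dg, nb, amat]

theorem sum_diffVec [Fintype V] (x y : V) (f : V → ℤ) : ∑ w, diffVec x y w * f w = f x - f y := by
  simp [diffVec, sub_mul, Pi.single_apply, Finset.sum_sub_distrib]

theorem sum_diffVec' [Fintype V] (x y : V) : ∑ w, diffVec x y w = 0 := by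
  simpa using sum_diffVec x y (fun _ => 1)

theorem dg_sw [Fintype V] {G : SimpleGraph V} {x p y q : V} (h : G.Alt x p y q) (v : V) :
    (G.sw x p y q).dg v = G.dg v := by
  have : ((G.sw x p y q).dg v : ℤ) = G.dg v := by
    rw [dg_eq_sum, dg_eq_sum, amat_sw h]
    simp [Matrix.vecMulVec_apply, Finset.sum_add_distrib, ← Finset.mul_sum, sum_diffVec']
  exact_mod_cast this

theorem amat_iso [Fintype V] [Fintype W] {G : SimpleGraph V} {H : SimpleGraph W} (φ : G ≃g H)
    (u v : V) : H.amat (φ u) (φ v) = G.amat u v := by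
  have h : H.Adj (φ u) (φ v) ↔ G.Adj u v := φ.map_rel_iff
  simp [amat, h]

theorem IsUni.sw [Fintype V] {G : SimpleGraph V} (hG : G.IsUni) {x p y q : V}
    (h : G.Alt x p y q) : (G.sw x p y q).IsUni := by
  obtain ⟨φ⟩ := hG _ (dg_sw h)
  exact hG.of_iso φ

/-- In a unigraph, an alternating 4-cycle has a pair of opposite vertices of equal degree. -/
theorem IsUni.dg_eq_or [Fintype V] {G : SimpleGraph V} (hG : G.IsUni) {x p y q : V}
    (h : G.Alt x p y q) : G.dg x = G.dg y ∨ G.dg p = G.dg q := by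
  obtain ⟨φ⟩ := hG _ (dg_sw h)
  set d : V → ℤ := fun v => G.dg v with hd
  -- The degree-weighted adjacency sum is an isomorphism invariant, and the switching lowers it by
  -- `2 (d x - d y) (d p - d q)`.
  have inv : ∑ u, ∑ v, (G.sw x p y q).amat u v * (d u * d v) =
      ∑ u, ∑ v, G.amat u v * (d u * d v) := by
    rw [← φ.toEquiv.sum_comp]
    refine Finset.sum_congr rfl fun u _ => ?_
    rw [← φ.toEquiv.sum_comp]
    refine Finset.sum_congr rfl fun v _ => ?_
    have hu : ∀ u, d (φ u) = d u := fun u => by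
      simp only [hd]; rw [← dg_sw h, dg_iso]
    change (G.sw x p y q).amat (φ u) (φ v) * (d (φ u) * d (φ v)) = _
    rw [amat_iso, hu, hu]
  rw [amat_sw h] at inv
  have e1 : ∀ (a b : V → ℤ), ∑ u, ∑ v, (a u * b v) * (d u * d v) =
      (∑ u, a u * d u) * ∑ v, b v * d v := by
    intro a b
    rw [Finset.sum_mul_sum]
    refine Finset.sum_congr rfl fun u _ => Finset.sum_congr rfl fun v _ => by ring
  simp only [Matrix.sub_apply, Matrix.add_apply, Matrix.vecMulVec_apply, sub_mul, add_mul,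
    Finset.sum_sub_distrib, Finset.sum_add_distrib, e1, sum_diffVec] at inv
  have : (d x - d y) * (d p - d q) = 0 := by linarith
  rcases mul_eq_zero.1 this with h | h
  · left; simp only [hd] at h; omega
  · right; simp only [hd] at h; omega

/-- The sum of a weight of the degree over the neighbours of `x`. -/
noncomputable def wsum [Fintype V] (G : SimpleGraph V) (ω : ℕ → ℤ) (x : V) : ℤ :=
  ∑ w ∈ G.nb x, ω (G.dg w)

theorem wsum_eq [Fintype V] (G : SimpleGraph V) (ω : ℕ → ℤ) (x : V) :
    G.wsum ω x = ∑ w, G.amat x w * ω (G.dg w) := by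
  simp [wsum, nb, amat, Finset.sum_filter]

/-- In a unigraph, switching between two vertices of equal degree exchanges their profiles of
neighbour degrees. -/
theorem IsUni.wsum_sub [Fintype V] {G : SimpleGraph V} (hG : G.IsUni) {x p y q : V}
    (h : G.Alt x p y q) (hxy : G.dg x = G.dg y) (ω : ℕ → ℤ) (hω : ω (G.dg p) ≠ ω (G.dg q)) :
    G.wsum ω x - G.wsum ω y = ω (G.dg p) - ω (G.dg q) := by
  obtain ⟨φ⟩ := hG _ (dg_sw h)
  set c : ℤ := ω (G.dg p) - ω (G.dg q) with hc
  have hF : ∀ u, (G.sw x p y q).wsum ω u = G.wsum ω u - diffVec x y u * c := by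
    intro u
    rw [wsum_eq, wsum_eq, amat_sw h]
    simp only [dg_sw h, Matrix.sub_apply, Matrix.add_apply, Matrix.vecMulVec_apply, sub_mul,
      add_mul, Finset.sum_sub_distrib, Finset.sum_add_distrib, mul_assoc, ← Finset.mul_sum,
      sum_diffVec, hxy, sub_self, mul_zero, add_zero, hc]
  -- As `x` and `y` have equal degree, the switching changes the neighbour weight only at `x` (by
  -- `-c`) and at `y` (by `+c`). Invariance of the sum of squares then determines the difference of
  -- the two weights.
  have inv : ∑ u, (G.sw x p y q).wsum ω u ^ 2 = ∑ u, G.wsum ω u ^ 2 := by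
    rw [← φ.toEquiv.sum_comp]
    refine Finset.sum_congr rfl fun u _ => ?_
    congr 1
    rw [wsum_eq, wsum_eq, ← φ.toEquiv.sum_comp]
    refine Finset.sum_congr rfl fun v _ => ?_
    change (G.sw x p y q).amat (φ u) (φ v) * ω ((G.sw x p y q).dg (φ v)) = _
    rw [amat_iso, dg_iso]
  have e2 : ∑ u, diffVec x y u * diffVec x y u = 2 := by
    rw [sum_diffVec]
    have := h.nxy
    simp [diffVec, this, this.symm]
  have e3 : ∑ u, (G.wsum ω u - diffVec x y u * c) ^ 2 = ∑ u, G.wsum ω u ^ 2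
      - 2 * c * (G.wsum ω x - G.wsum ω y) + 2 * c ^ 2 := by
    rw [← sum_diffVec x y (G.wsum ω)]
    have : 2 * c ^ 2 = ∑ u, (diffVec x y u * diffVec x y u) * c ^ 2 := by
      rw [← Finset.sum_mul, e2]
    rw [this, Finset.mul_sum, ← Finset.sum_sub_distrib, ← Finset.sum_add_distrib]
    refine Finset.sum_congr rfl fun u _ => by ring
  simp only [hF] at inv
  rw [e3] at inv
  have hc0 : c ≠ 0 := sub_ne_zero.2 hω
  have : c * (G.wsum ω x - G.wsum ω y - c) = 0 := by linarith
  rcases mul_eq_zero.1 this with h | h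
  · exact absurd h hc0
  · linarith

/-- If the three degrees were distinct, a weight with values 0, 1, 2 on them would give `wsum x -
wsum y` both the value -1 and the value -2. -/
theorem IsUni.dg_eq_of_priv [Fintype V] {G : SimpleGraph V} (hG : G.IsUni) {x p y q q' : V}
    (hxy : G.dg x = G.dg y) (hp : p ∈ G.priv x y) (hq : q ∈ G.priv y x) (hq' : q' ∈ G.priv y x)
    (h1 : G.dg p ≠ G.dg q) (h2 : G.dg p ≠ G.dg q') : G.dg q = G.dg q' := by
  by_contra h3
  set ω : ℕ → ℤ := fun n => if n = G.dg p then 0 else if n = G.dg q then 1 else 2 with hω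
  have e0 : ω (G.dg p) = 0 := by simp [hω]
  have e1 : ω (G.dg q) = 1 := by simp [hω, Ne.symm h1]
  have e2 : ω (G.dg q') = 2 := by simp [hω, Ne.symm h2, Ne.symm h3]
  have a1 := hG.wsum_sub (alt_of_priv hp hq) hxy ω (by rw [e0, e1]; norm_num)
  have a2 := hG.wsum_sub (alt_of_priv hp hq') hxy ω (by rw [e0, e2]; norm_num)
  rw [e0, e1] at a1
  rw [e0, e2] at a2
  omega

/-- The number of neighbours of `x` of degree `n`. -/
noncomputable def cnt [Fintype V] (G : SimpleGraph V) (n : ℕ) (x : V) : ℕ :=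
  ((G.nb x).filter fun w => G.dg w = n).card

/-- This is `wsum_sub` for the indicator of the degree of `p`. -/
theorem IsUni.cnt_eq [Fintype V] {G : SimpleGraph V} (hG : G.IsUni) {x p y q : V}
    (h : G.Alt x p y q) (hxy : G.dg x = G.dg y) (hd : G.dg p ≠ G.dg q) :
    G.cnt (G.dg p) x = G.cnt (G.dg p) y + 1 := by
  have key := hG.wsum_sub h hxy (fun n => if n = G.dg p then 1 else 0) (by simp [Ne.symm hd])
  have e : ∀ u, G.wsum (fun n => if n = G.dg p then 1 else 0) u = G.cnt (G.dg p) u := by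
    intro u; simp [wsum, cnt]
  rw [e, e] at key
  simp [Ne.symm hd] at key
  omega

end

end SimpleGraph

/-! ### Triangle counts under switching and the matching identities. -/

namespace SimpleGraph

section
open scoped Classical
open Matrix

variable {V : Type u}

theorem amat_transpose (G : SimpleGraph V) : G.amatᵀ = G.amat := by
  ext u v; exact G.amat_symm v u

theorem sw_adj_of_ne {G : SimpleGraph V} {x p y q u v : V} (h1 : u ≠ x) (h2 : u ≠ y)
    (h3 : v ≠ x) (h4 : v ≠ y) : (G.sw x p y q).Adj u v ↔ G.Adj u v := by
  have := fun e : G.Adj u v => e.ne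
  simp only [sw, sup_adj, sdiff_adj, edge_adj]
  grind

theorem amat_sw_of_ne {G : SimpleGraph V} {x p y q u v : V} (h1 : u ≠ x) (h2 : u ≠ y)
    (h3 : v ≠ x) (h4 : v ≠ y) : (G.sw x p y q).amat u v = G.amat u v := by
  simp [amat, sw_adj_of_ne h1 h2 h3 h4]

theorem sw_adj_iff {G : SimpleGraph V} {x p y q : V} (h : G.Alt x p y q) (u v : V) :
    (G.sw x p y q).Adj u v ↔ (u = x ∧ v = q) ∨ (u = q ∧ v = x) ∨ (u = y ∧ v = p) ∨
    (u = p ∧ v = y) ∨ (G.Adj u v ∧ ¬ (u = x ∧ v = p) ∧ ¬ (u = p ∧ v = x) ∧ ¬ (u = y ∧ v = q) ∧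
      ¬ (u = q ∧ v = y)) := by
  have := fun e : G.Adj u v => e.ne
  have := h.nxq
  have := h.nyp
  simp only [sw, sup_adj, sdiff_adj, edge_adj]
  grind

theorem sw_adj_left {G : SimpleGraph V} {x p y q w : V} (h : G.Alt x p y q) :
    (G.sw x p y q).Adj x w ↔ w = q ∨ (G.Adj x w ∧ w ≠ p) := by
  have := h.nxq; have := h.nyp; have := h.nxy; have := h.xp.ne
  rw [sw_adj_iff h]
  grind

theorem sw_adj_right {G : SimpleGraph V} {x p y q w : V} (h : G.Alt x p y q) :
    (G.sw x p y q).Adj y w ↔ w = p ∨ (G.Adj y w ∧ w ≠ q) := by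
  have := h.nxq; have := h.nyp; have := h.nxy; have := h.yq.ne
  rw [sw_adj_iff h]
  grind

variable [Fintype V]

theorem mulVec_diffVec (A : Matrix V V ℤ) (x y w : V) : (A *ᵥ diffVec x y) w = A w x - A w y := by
  simp only [mulVec, dotProduct]
  simp_rw [mul_comm (A w _)]
  exact sum_diffVec x y (A w)

theorem diffVec_dotProduct (x y : V) (f : V → ℤ) : diffVec x y ⬝ᵥ f = f x - f y :=
  sum_diffVec x y f

theorem trace_cube_iso {W : Type u} [Fintype W] {G : SimpleGraph V} {H : SimpleGraph W}
    (φ : G ≃g H) : (H.amat * H.amat * H.amat).trace = (G.amat * G.amat * G.amat).trace := by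
  have h : G.amat = H.amat.submatrix φ.toEquiv φ.toEquiv := by
    ext u v; exact (amat_iso φ u v).symm
  rw [h, submatrix_mul_equiv, submatrix_mul_equiv, trace, trace,
    ← φ.toEquiv.sum_comp]
  rfl

/-- In the expansion of the cube, cyclicity of the trace merges the terms of equal degree in `M`;
the cubic term vanishes because `u` and `v` are orthogonal. The trace of the cube of an adjacency
matrix is six times the number of triangles. -/
theorem trace_cube_sub (A : Matrix V V ℤ) (hA : Aᵀ = A) (u v : V → ℤ) (huv : u ⬝ᵥ v = 0) :
    let M := vecMulVec u v + vecMulVec v u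
    ((A - M) * (A - M) * (A - M)).trace = (A * A * A).trace - 6 * ((A *ᵥ u) ⬝ᵥ (A *ᵥ v))
      + 3 * ((v ⬝ᵥ v) * (u ⬝ᵥ (A *ᵥ u)) + (u ⬝ᵥ u) * (v ⬝ᵥ (A *ᵥ v))) := by
  intro M
  have hMt : ∀ B : Matrix V V ℤ, (B * M).trace = (B *ᵥ u) ⬝ᵥ v + (B *ᵥ v) ⬝ᵥ u := by
    intro B
    simp only [M, mul_add, mul_vecMulVec, trace_add, trace_vecMulVec]
  have hvu : v ⬝ᵥ u = 0 := by rw [dotProduct_comm]; exact huv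
  have hMM : M * M = (v ⬝ᵥ v) • vecMulVec u u + (u ⬝ᵥ u) • vecMulVec v v := by
    simp only [M, mul_add, add_mul, vecMulVec_mul_vecMulVec, huv, hvu]
    ext i j
    simp only [Matrix.add_apply, Matrix.smul_apply, vecMulVec_apply, Pi.smul_apply, smul_eq_mul, zero_smul,
      vecMulVec_zero, Matrix.zero_apply]
    ring
  have e : (A - M) * (A - M) * (A - M) = A * A * A - A * A * M - A * M * A - M * A * A
      + A * M * M + M * A * M + M * M * A - M * M * M := by noncomm_ring
  have c1 : (A * M * A).trace = (A * A * M).trace := by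
    rw [trace_mul_comm, ← mul_assoc]
  have c2 : (M * A * A).trace = (A * A * M).trace := by
    rw [mul_assoc, trace_mul_comm]
  have c3 : (M * A * M).trace = (A * M * M).trace := by
    rw [trace_mul_comm, ← mul_assoc, trace_mul_comm, ← mul_assoc]
  have c4 : (M * M * A).trace = (A * M * M).trace := by
    rw [trace_mul_comm, ← mul_assoc]
  have hs : ∀ a b : V → ℤ, (A *ᵥ a) ⬝ᵥ b = a ⬝ᵥ (A *ᵥ b) := by
    intro a b
    rw [dotProduct_mulVec, ← mulVec_transpose, hA]
  have t1 : (A * A * M).trace = 2 * ((A *ᵥ u) ⬝ᵥ (A *ᵥ v)) := by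
    rw [hMt, ← mulVec_mulVec, ← mulVec_mulVec, hs, hs (A *ᵥ v) u,
      dotProduct_comm (A *ᵥ v)]
    ring
  have t2 : (A * M * M).trace = (v ⬝ᵥ v) * (u ⬝ᵥ (A *ᵥ u)) + (u ⬝ᵥ u) * (v ⬝ᵥ (A *ᵥ v)) := by
    rw [mul_assoc, hMM, mul_add, trace_add, mul_smul_comm, mul_smul_comm, trace_smul, trace_smul,
      mul_vecMulVec, mul_vecMulVec, trace_vecMulVec, trace_vecMulVec, hs, hs]
    rfl
  have t3 : (M * M * M).trace = 0 := by
    rw [hMt, hMM]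
    simp only [add_mulVec, smul_mulVec, vecMulVec_mulVec, op_smul_eq_smul, add_dotProduct,
      smul_dotProduct, huv, hvu, smul_eq_mul]
    ring
  rw [e]
  simp only [trace_add, trace_sub, c1, c2, c3, c4, t1, t2, t3]
  ring

theorem diffVec_dot_self {x y : V} (h : x ≠ y) : diffVec x y ⬝ᵥ diffVec x y = 2 := by
  rw [diffVec_dotProduct]; simp [diffVec, h, h.symm]

theorem diffVec_dot_zero {x y p q : V} (h1 : x ≠ p) (h2 : x ≠ q) (h3 : y ≠ p) (h4 : y ≠ q) :
    diffVec x y ⬝ᵥ diffVec p q = 0 := by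
  rw [diffVec_dotProduct]; simp [diffVec, h1, h2, h3, h4]

theorem diffVec_amat_self (G : SimpleGraph V) (x y : V) :
    diffVec x y ⬝ᵥ (G.amat *ᵥ diffVec x y) = - 2 * G.amat x y := by
  rw [diffVec_dotProduct, mulVec_diffVec, mulVec_diffVec, amat_self, amat_self, G.amat_symm y x]
  ring

/-- Switching along an alternating 4-cycle of a unigraph preserves the number of triangles. -/
theorem IsUni.triangles {G : SimpleGraph V} (hG : G.IsUni) {x p y q : V} (h : G.Alt x p y q) :
    (G.amat *ᵥ diffVec x y) ⬝ᵥ (G.amat *ᵥ diffVec p q) = - 2 * (G.amat x y + G.amat p q) := by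
  obtain ⟨φ⟩ := hG _ (dg_sw h)
  have h1 := trace_cube_iso φ
  rw [amat_sw h] at h1
  have h2 := trace_cube_sub G.amat G.amat_transpose (diffVec x y) (diffVec p q)
    (diffVec_dot_zero h.xp.ne h.nxq h.nyp h.yq.ne)
  simp only at h2
  rw [h2, diffVec_dot_self h.nxy, diffVec_dot_self h.npq, diffVec_amat_self,
    diffVec_amat_self] at h1
  linarith

theorem priv_sw_left {G : SimpleGraph V} {x p y q w : V} (h : G.Alt x p y q) :
    w ∈ (G.sw x p y q).priv x y ↔ w = q ∨ (w ∈ G.priv x y ∧ w ≠ p) := by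
  have := h.nxq; have := h.npq; have := h.yq.ne; have := h.nyp; have := h.yq; have := h.xq
  rw [mem_priv, mem_priv, sw_adj_left h, sw_adj_right h]
  grind

theorem priv_sw_right {G : SimpleGraph V} {x p y q w : V} (h : G.Alt x p y q) :
    w ∈ (G.sw x p y q).priv y x ↔ w = p ∨ (w ∈ G.priv y x ∧ w ≠ q) := by
  have := h.nxq; have := h.npq; have := h.xp.ne; have := h.nyp; have := h.yp; have := h.xp
  rw [mem_priv, mem_priv, sw_adj_left h, sw_adj_right h]
  grind

/-- The identity `triangles` for `x, p, y, q` holds before and after switching `x, s, y, t`. That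
switching changes only the first vector in it, by `-2 diffVec s t`, so `diffVec s t` is orthogonal
to `amat *ᵥ diffVec p q`. -/
theorem IsUni.priv_four_aux {G : SimpleGraph V} (hG : G.IsUni) {x y p s q t : V}
    (hp : p ∈ G.priv x y) (hs : s ∈ G.priv x y) (hq : q ∈ G.priv y x) (ht : t ∈ G.priv y x)
    (hps : p ≠ s) (hqt : q ≠ t) :
    G.amat p s + G.amat q t = G.amat p t + G.amat q s := by
  have a1 := alt_of_priv hp hq
  have a2 := alt_of_priv hs ht
  have hpq := a1.npq
  have hst := a2.npq
  have hpt := (alt_of_priv hp ht).npq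
  have hsq := (alt_of_priv hs hq).npq
  have a3 : (G.sw x s y t).Alt x p y q := by
    apply alt_of_priv
    · rw [priv_sw_left a2]; exact Or.inr ⟨hp, hps⟩
    · rw [priv_sw_right a2]; exact Or.inr ⟨hq, hqt⟩
  have t1 := hG.triangles a1
  have t2 := (hG.sw a2).triangles a3
  have e1 : (G.sw x s y t).amat *ᵥ diffVec x y =
      G.amat *ᵥ diffVec x y - (2 : ℤ) • diffVec s t := by
    rw [amat_sw a2, sub_mulVec, add_mulVec, vecMulVec_mulVec, vecMulVec_mulVec,
      diffVec_dot_self a2.nxy, dotProduct_comm,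
      diffVec_dot_zero a2.xp.ne a2.nxq a2.nyp a2.yq.ne]
    ext w; simp; ring
  have e2 : (G.sw x s y t).amat *ᵥ diffVec p q = G.amat *ᵥ diffVec p q := by
    rw [amat_sw a2, sub_mulVec, add_mulVec, vecMulVec_mulVec, vecMulVec_mulVec,
      diffVec_dot_zero a1.xp.ne a1.nxq a1.nyp a1.yq.ne,
      diffVec_dot_zero hps.symm hsq hpt.symm hqt.symm]
    ext w; simp
  have e3 : (G.sw x s y t).amat p q = G.amat p q :=
    amat_sw_of_ne a1.xp.ne.symm a1.nyp.symm a1.nxq.symm a1.yq.ne.symm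
  have e4 : (G.sw x s y t).amat x y = G.amat x y := by
    have : (G.sw x s y t).Adj x y ↔ G.Adj x y := by
      rw [sw_adj_left a2]
      have := a2.yq.ne; have := a2.nyp
      grind
    simp [amat, this]
  rw [e1, e2, e3, e4, sub_dotProduct, smul_dotProduct, diffVec_dotProduct, mulVec_diffVec,
    mulVec_diffVec, smul_eq_mul] at t2
  rw [t1] at t2
  rw [G.amat_symm p s, G.amat_symm p t, G.amat_symm q t, G.amat_symm q s]
  linarith

/-- In a unigraph, for `p, s` private to `x` and `q, t` private to `y`, the three perfect matchings
on `p, s, q, t` contain the same number of edges. -/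
theorem IsUni.priv_four {G : SimpleGraph V} (hG : G.IsUni) {x y p s q t : V}
    (hp : p ∈ G.priv x y) (hs : s ∈ G.priv x y) (hq : q ∈ G.priv y x) (ht : t ∈ G.priv y x)
    (hps : p ≠ s) (hqt : q ≠ t) :
    G.amat p s + G.amat q t = G.amat p t + G.amat q s ∧
    G.amat p s + G.amat q t = G.amat p q + G.amat s t := by
  refine ⟨hG.priv_four_aux hp hs hq ht hps hqt, ?_⟩
  have h := hG.priv_four_aux hp hs ht hq hps hqt.symm
  rw [G.amat_symm t q, G.amat_symm t s] at h
  exact h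

/-- Switching `x, r, y, t` makes `r` private to `y` and leaves the edges away from `x` and `y`
alone, so `priv_four` applies. -/
theorem IsUni.priv_three_one {G : SimpleGraph V} (hG : G.IsUni) {x y p s r q t : V}
    (hp : p ∈ G.priv x y) (hs : s ∈ G.priv x y) (hr : r ∈ G.priv x y) (hq : q ∈ G.priv y x)
    (ht : t ∈ G.priv y x) (hps : p ≠ s) (hpr : p ≠ r) (hsr : s ≠ r) (hqt : q ≠ t) :
    G.amat p s + G.amat q r = G.amat p r + G.amat q s ∧
    G.amat p s + G.amat q r = G.amat p q + G.amat s r := by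
  have a := alt_of_priv hr ht
  have key := (hG.sw a).priv_four (x := x) (y := y) (p := p) (s := s) (q := q) (t := r)
    ((priv_sw_left a).2 (Or.inr ⟨hp, hpr⟩)) ((priv_sw_left a).2 (Or.inr ⟨hs, hsr⟩))
    ((priv_sw_right a).2 (Or.inr ⟨hq, hqt⟩)) ((priv_sw_right a).2 (Or.inl rfl)) hps
    (alt_of_priv hr hq).npq.symm
  rw [mem_priv] at hp hs hr hq
  have p1 := hp.1.ne'; have p2 := hp.2.2
  have s1 := hs.1.ne'; have s2 := hs.2.2
  have r1 := hr.1.ne'; have r2 := hr.2.2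
  have q1 := hq.1.ne'; have q2 := hq.2.2
  simpa only [amat_sw_of_ne, ne_eq, p1, p2, s1, s2, r1, r2, q1, q2, not_false_eq_true] using key

/-- As in `priv_three_one`, a switching moves `q` to the side of `y`; two private neighbours of `y`
are needed since one is used up. -/
theorem IsUni.priv_four_zero {G : SimpleGraph V} (hG : G.IsUni) {x y p s r q : V}
    (hp : p ∈ G.priv x y) (hs : s ∈ G.priv x y) (hr : r ∈ G.priv x y) (hq : q ∈ G.priv x y)
    (hy : 2 ≤ (G.priv y x).card) (hps : p ≠ s) (hpr : p ≠ r) (hsr : s ≠ r) (hpq : p ≠ q)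
    (hsq : s ≠ q) (hrq : r ≠ q) :
    G.amat p s + G.amat q r = G.amat p r + G.amat q s ∧
    G.amat p s + G.amat q r = G.amat p q + G.amat s r := by
  obtain ⟨t, ht, t', ht', htt⟩ := Finset.one_lt_card.1 hy
  have a := alt_of_priv hq ht
  have key := (hG.sw a).priv_three_one (x := x) (y := y) (p := p) (s := s) (q := q) (r := r)
    (t := t') ((priv_sw_left a).2 (Or.inr ⟨hp, hpq⟩)) ((priv_sw_left a).2 (Or.inr ⟨hs, hsq⟩))
    ((priv_sw_left a).2 (Or.inr ⟨hr, hrq⟩)) ((priv_sw_right a).2 (Or.inl rfl))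
    ((priv_sw_right a).2 (Or.inr ⟨ht', htt.symm⟩)) hps hpr hsr (alt_of_priv hq ht').npq
  rw [mem_priv] at hp hs hr hq
  have p1 := hp.1.ne'; have p2 := hp.2.2
  have s1 := hs.1.ne'; have s2 := hs.2.2
  have r1 := hr.1.ne'; have r2 := hr.2.2
  have q1 := hq.1.ne'; have q2 := hq.2.2
  simpa only [amat_sw_of_ne, ne_eq, p1, p2, s1, s2, r1, r2, q1, q2, not_false_eq_true] using key

/-- The private neighbourhoods of two vertices of a unigraph which have at least two private
neighbours each: any four vertices have the same number of edges in each perfect matching. -/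
theorem IsUni.four {G : SimpleGraph V} (hG : G.IsUni) {x y p q s t : V}
    (hx : 2 ≤ (G.priv x y).card) (hy : 2 ≤ (G.priv y x).card)
    (hp : p ∈ G.priv x y ∪ G.priv y x) (hq : q ∈ G.priv x y ∪ G.priv y x)
    (hs : s ∈ G.priv x y ∪ G.priv y x) (ht : t ∈ G.priv x y ∪ G.priv y x)
    (hpq : p ≠ q) (hps : p ≠ s) (hpt : p ≠ t) (hqs : q ≠ s) (hqt : q ≠ t) (hst : s ≠ t) :
    G.amat p q + G.amat s t = G.amat p s + G.amat q t ∧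
    G.amat p q + G.amat s t = G.amat p t + G.amat q s := by
  have s1 := G.amat_symm p q
  have s2 := G.amat_symm p s
  have s3 := G.amat_symm p t
  have s4 := G.amat_symm q s
  have s5 := G.amat_symm q t
  have s6 := G.amat_symm s t
  have key : ∀ {x y : V}, 2 ≤ (G.priv x y).card → 2 ≤ (G.priv y x).card → p ∈ G.priv x y →
      q ∈ G.priv x y ∪ G.priv y x → s ∈ G.priv x y ∪ G.priv y x → t ∈ G.priv x y ∪ G.priv y x →
      G.amat p q + G.amat s t = G.amat p s + G.amat q t ∧
      G.amat p q + G.amat s t = G.amat p t + G.amat q s := by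
    intro x y hx hy hp hq hs ht
    rw [Finset.mem_union] at hq hs ht
    rcases hq with hq | hq <;> rcases hs with hs | hs <;> rcases ht with ht | ht
    · have := hG.priv_four_zero hp hq hs ht hy hpq hps hqs hpt hqt hst
      constructor <;> linarith
    · obtain ⟨r, hr, hrt⟩ := Finset.exists_mem_ne hy t
      have := hG.priv_three_one hp hq hs ht hr hpq hps hqs hrt.symm
      constructor <;> linarith
    · obtain ⟨r, hr, hrt⟩ := Finset.exists_mem_ne hy s
      have := hG.priv_three_one hp hq ht hs hr hpq hpt hqt hrt.symm
      constructor <;> linarith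
    · have := hG.priv_four hp hq hs ht hpq hst
      constructor <;> linarith
    · obtain ⟨r, hr, hrt⟩ := Finset.exists_mem_ne hy q
      have := hG.priv_three_one hp hs ht hq hr hps hpt hst hrt.symm
      constructor <;> linarith
    · have := hG.priv_four hp hs hq ht hps hqt
      constructor <;> linarith
    · have := hG.priv_four hp ht hq hs hpt hqs
      constructor <;> linarith
    · obtain ⟨r, hr, hrt⟩ := Finset.exists_mem_ne hx p
      have := hG.priv_three_one hq hs ht hp hr hqs hqt hst hrt.symm
      constructor <;> linarith
  rcases Finset.mem_union.1 hp with hp | hp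
  · exact key hx hy hp hq hs ht
  · rw [Finset.union_comm] at hq hs ht
    exact key hy hx hp hq hs ht

/-- The switching identity for triangles, in terms of private neighbours. -/
theorem IsUni.sum_priv {G : SimpleGraph V} (hG : G.IsUni) {x y p q : V} (hp : p ∈ G.priv x y)
    (hq : q ∈ G.priv y x) :
    ∑ w ∈ (G.priv x y).erase p, (G.amat w p - G.amat w q) =
    ∑ w ∈ (G.priv y x).erase q, (G.amat w p - G.amat w q) := by
  have a := alt_of_priv hp hq
  have h := hG.triangles a
  -- The first factor is 1 on `priv x y`, -1 on `priv y x` and 0 elsewhere, except possibly at `x`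
  -- and `y`. The coordinates `x, y` and `p, q` produce the last two terms, which cancel the right
  -- side of `triangles`.
  have e : ∀ w, (G.amat *ᵥ diffVec x y) w * (G.amat *ᵥ diffVec p q) w =
      (if w ∈ (G.priv x y).erase p then G.amat w p - G.amat w q else 0)
      - (if w ∈ (G.priv y x).erase q then G.amat w p - G.amat w q else 0)
      - (diffVec x y w * diffVec x y w) * G.amat x y
      - (diffVec p q w * diffVec p q w) * G.amat p q := by
    intro w
    rw [mulVec_diffVec, mulVec_diffVec]
    have b1 := a.xp; have b2 := a.yq; have b3 := a.xq; have b4 := a.yp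
    have n1 := a.nxq; have n2 := a.nyp; have n3 := a.nxy; have n4 := a.npq
    have n5 := a.xp.ne; have n6 := a.yq.ne
    have c1 := G.adj_comm w x; have c2 := G.adj_comm w y
    have c3 := G.adj_comm w p; have c4 := G.adj_comm w q
    have i1 := G.irrefl (v := w)
    simp only [diffVec, Pi.sub_apply, Pi.single_apply, Finset.mem_erase, mem_priv, amat, c1, c2]
    by_cases hx : w = x
    · subst hx; simp [n1, n3, n5, b1, b3, c2]
    by_cases hy : w = y
    · subst hy; simp [n2, n6, b2, b4, hx]
    by_cases hwp : w = p
    · subst hwp; simp [b1, b4, n4, hx, hy]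
    by_cases hwq : w = q
    · subst hwq; simp [b2, b3, hx, hy, hwp, c3]; split_ifs <;> rfl
    simp only [hx, hy, hwp, hwq]
    by_cases e1 : G.Adj x w <;> by_cases e2 : G.Adj y w <;> simp [e1, e2, hx, hy, hwp, hwq]
  simp only [dotProduct] at h
  simp only [e, Finset.sum_sub_distrib, ← Finset.sum_mul] at h
  have h1 := diffVec_dot_self a.nxy
  have h2 := diffVec_dot_self a.npq
  simp only [dotProduct] at h1 h2
  rw [h1, h2, Finset.sum_ite_mem, Finset.sum_ite_mem, Finset.univ_inter, Finset.univ_inter] at h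
  linarith

/-- Two vertices of different degrees whose neighbourhoods are not nested: all private neighbours
have the same degree. -/
theorem IsUni.not_nested {G : SimpleGraph V} (hG : G.IsUni) {a b x : V} (hab : G.dg a < G.dg b)
    (hx : x ∈ G.priv a b) : (∀ w ∈ G.priv b a, G.dg w = G.dg x) ∧
      (∀ w ∈ G.priv a b, G.dg w = G.dg x) ∧ 2 ≤ (G.priv b a).card := by
  have hc := G.card_priv a b
  have hpos : 0 < (G.priv a b).card := Finset.card_pos.2 ⟨x, hx⟩
  have key : ∀ x ∈ G.priv a b, ∀ w ∈ G.priv b a, G.dg w = G.dg x := by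
    intro x hx w hw
    rcases hG.dg_eq_or (alt_of_priv hw hx) with h | h
    · omega
    · exact h
  refine ⟨key x hx, fun w hw => ?_, by omega⟩
  obtain ⟨z, hz⟩ : (G.priv b a).Nonempty := Finset.card_pos.1 (by omega)
  rw [← key x hx z hz, ← key w hw z hz]

/-- Every degree of a unigraph is attained at a vertex adjacent to vertices of largest degree. -/
theorem IsUni.exists_top {G : SimpleGraph V} (hG : G.IsUni) (x : V) :
    ∃ z, G.dg z = G.dg x ∧ ∀ p q, G.Adj z p → ¬ G.Adj z q → q ≠ z → G.dg q ≤ G.dg p := by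
  -- Among all realisations of the degrees, one maximising the degree sum over the neighbours of `x`
  -- joins `x` to vertices of largest degree, since otherwise a switching at `x` would increase the
  -- sum. It is isomorphic to `G`, and `x` pulls back to the required vertex.
  let S : Finset (SimpleGraph V) := Finset.univ.filter fun H => ∀ v, H.dg v = G.dg v
  obtain ⟨H, hH, hmax⟩ := S.exists_max_image (fun H => ∑ w ∈ H.nb x, G.dg w)
    ⟨G, by simp [S]⟩
  have hd : ∀ v, H.dg v = G.dg v := by simpa [S] using hH
  obtain ⟨φ⟩ := hG H hd
  refine ⟨φ.symm x, ?_, ?_⟩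
  · rw [← dg_iso φ, hd, φ.apply_symm_apply]
  have key : ∀ p q, H.Adj x p → ¬ H.Adj x q → q ≠ x → H.dg q ≤ H.dg p := by
    intro p q hp hq hqx
    by_contra hlt
    push Not at hlt
    have hc := H.card_priv p q
    have hxp : x ∈ H.priv p q := by
      rw [mem_priv]; exact ⟨hp.symm, fun e => hq e.symm, hqx.symm⟩
    have : 1 < (H.priv q p).card := by
      have : 0 < (H.priv p q).card := Finset.card_pos.2 ⟨x, hxp⟩
      omega
    obtain ⟨z, hz⟩ : (H.priv q p).Nonempty := Finset.card_pos.1 (by omega)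
    have a : H.Alt x p z q := (alt_of_priv hxp hz).symm
    have hmem : H.sw x p z q ∈ S := by
      simp only [S, Finset.mem_filter, Finset.mem_univ, true_and]
      intro v; rw [dg_sw a, hd]
    have hle := hmax _ hmem
    have hnb : (H.sw x p z q).nb x = insert q ((H.nb x).erase p) := by
      ext w
      simp only [mem_nb, sw_adj_left a, Finset.mem_insert, Finset.mem_erase]
      tauto
    rw [hnb, Finset.sum_insert (by simp [hq])] at hle
    have hpm : p ∈ H.nb x := by simpa using hp
    have := Finset.add_sum_erase (H.nb x) G.dg hpm
    have h1 := hd p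
    have h2 := hd q
    omega
  intro p q hp hq hqz
  have h1 : H.Adj x (φ p) := by
    have := φ.map_rel_iff.2 hp
    simpa using this
  have h2 : ¬ H.Adj x (φ q) := by
    intro h
    apply hq
    apply φ.map_rel_iff.1
    simpa using h
  have := key (φ p) (φ q) h1 h2 (by
    rintro rfl
    simp at hqz)
  rwa [dg_iso, dg_iso] at this

end

end SimpleGraph

/-! ### Degree classes seen from larger and smaller degrees. -/

namespace SimpleGraph

section
open scoped Classical

variable {V : Type u}

/-- A set-theoretic form of decomposability. -/
def SetDecomp (G : SimpleGraph V) : Prop :=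
  ∃ K S B : Set V, (∀ v, v ∈ K ∨ v ∈ S ∨ v ∈ B) ∧ (∀ v ∈ K, v ∉ S) ∧ (∀ v ∈ K, v ∉ B) ∧
    (∀ v ∈ S, v ∉ B) ∧ (∀ v ∈ K, ∀ w ∈ K, v ≠ w → G.Adj v w) ∧
    (∀ v ∈ S, ∀ w ∈ S, ¬ G.Adj v w) ∧ (∀ v ∈ K, ∀ w ∈ B, G.Adj v w) ∧
    (∀ v ∈ S, ∀ w ∈ B, ¬ G.Adj v w) ∧ (K ∪ S).Nonempty ∧ B.Nonempty

theorem SetDecomp.compl {G : SimpleGraph V} (h : G.SetDecomp) : Gᶜ.SetDecomp := by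
  obtain ⟨K, S, B, h1, h2, h3, h4, h5, h6, h7, h8, h9, h10⟩ := h
  refine ⟨S, K, B, fun v => ?_, fun v hv hk => h2 v hk hv, h4, h3, fun v hv w hw hvw => ?_,
    fun v hv w hw h => ?_, fun v hv w hw => ?_, fun v hv w hw h => ?_, ?_, h10⟩
  · have := h1 v; tauto
  · exact ⟨hvw, h6 v hv w hw⟩
  · exact h.2 (h5 v hv w hw h.1)
  · exact ⟨fun e => h4 v hv (e ▸ hw), h8 v hv w hw⟩
  · exact h.2 (h7 v hv w hw)
  · rwa [Set.union_comm]

variable [Fintype V]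

theorem wsum_priv (G : SimpleGraph V) (ω : ℕ → ℤ) {x y : V} (h : G.dg x = G.dg y) :
    G.wsum ω x - G.wsum ω y =
      ∑ w ∈ G.priv x y, ω (G.dg w) - ∑ w ∈ G.priv y x, ω (G.dg w) := by
  have key : ∀ x y : V, G.wsum ω x = ∑ w ∈ G.priv x y, ω (G.dg w) +
      (∑ w ∈ G.nb x ∩ G.nb y, ω (G.dg w) + if G.Adj x y then ω (G.dg y) else 0) := by
    intro x y
    have : G.nb x = G.priv x y ∪ ((G.nb x ∩ G.nb y) ∪ if G.Adj x y then {y} else ∅) := by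
      ext w
      by_cases h : G.Adj x y <;> by_cases hw : w = y <;> by_cases h2 : G.Adj y w <;>
        simp [h, hw, h2]
    unfold wsum
    rw [this, Finset.sum_union, Finset.sum_union, ← this]
    · congr 2
      split_ifs <;> simp
    · rw [Finset.disjoint_left]
      intro w hw
      split_ifs with h
      · rintro h'
        simp at h' hw
        subst h'
        exact G.irrefl hw.2
      · simp
    · rw [Finset.disjoint_left]
      intro w hw
      simp at hw
      split_ifs with h <;> simp [hw]
  rw [key x y, key y x, Finset.inter_comm, h, G.adj_comm x y]
  ring

theorem wsum_indicator (G : SimpleGraph V) (n : ℕ) (x : V) :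
    G.wsum (fun k => if k = n then 1 else 0) x = G.cnt n x := by
  simp [wsum, cnt]

theorem cnt_pos {G : SimpleGraph V} {x y : V} (h : G.Adj x y) : 0 < G.cnt (G.dg y) x :=
  Finset.card_pos.2 ⟨y, by simp [h]⟩

theorem not_adj_of_cnt_eq_zero {G : SimpleGraph V} {n : ℕ} {x y : V} (h : G.cnt n x = 0)
    (hy : G.dg y = n) : ¬ G.Adj x y := by
  intro e
  have := cnt_pos e
  rw [hy, h] at this
  exact lt_irrefl _ this

theorem eq_of_cnt_eq_one {G : SimpleGraph V} {n : ℕ} {x y z : V} (h : G.cnt n x = 1)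
    (hy : G.dg y = n) (hz : G.dg z = n) (hxy : G.Adj x y) (hxz : G.Adj x z) : y = z := by
  obtain ⟨a, ha⟩ := Finset.card_eq_one.1 h
  have h1 : y ∈ (G.nb x).filter fun w => G.dg w = n := by simp [hy, hxy]
  have h2 : z ∈ (G.nb x).filter fun w => G.dg w = n := by simp [hz, hxz]
  rw [ha, Finset.mem_singleton] at h1 h2
  rw [h1, h2]

theorem card_priv_eq {G : SimpleGraph V} {x y : V} (h : G.dg x = G.dg y) :
    (G.priv x y).card = (G.priv y x).card := by
  have := G.card_priv x y
  omega

/-- In a unigraph, if `b` and `a` have larger and smaller degree than `x`, and `x` is adjacent to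
`a` but not to `b`, then no `z` in `N(b) \ N[a]` is adjacent to `x`. -/
theorem IsUni.no_cross_aux {G : SimpleGraph V} (hG : G.IsUni) {x a b z : V}
    (hb : G.dg x < G.dg b) (ha : G.dg a < G.dg x) (hxb : ¬ G.Adj x b) (hxa : G.Adj x a)
    (hz : z ∈ G.priv b a) (hxz : G.Adj x z) : False := by
  have hxm : x ∈ G.priv a b := by
    rw [mem_priv]; exact ⟨hxa.symm, fun e => hxb e.symm, fun e => by rw [e] at hb; omega⟩
  obtain ⟨N1, N2, -⟩ := hG.not_nested (ha.trans hb) hxm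
  have hzd := N1 z hz
  have hz' := mem_priv.1 hz
  have hxb' : x ≠ b := fun e => by rw [e] at hb; omega
  have hab : a ≠ b := fun e => by rw [e] at ha; omega
  have Fh : ∀ y, G.dg y = G.dg x → G.Adj x y →
      (∀ w ∈ G.priv b y, G.dg w = G.dg x) ∧ (∀ w ∈ G.priv y b, G.dg w = G.dg x) ∧
        2 ≤ (G.priv b y).card := by
    intro y hy hxy
    exact hG.not_nested (by omega) (mem_priv.2 ⟨hxy.symm, fun e => hxb e.symm, hxb'⟩)
  have hba : ¬ G.Adj b a := by
    intro e
    have := (Fh z hzd hxz).1 a (mem_priv.2 ⟨e, fun e => hz'.2.1 e.symm, hz'.2.2.symm⟩)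
    omega
  have Fl : ∀ x' ∈ G.priv a b, ∀ w, G.dg w = G.dg x → G.Adj b w → ¬ G.Adj x' w → False := by
    intro x' hx' w hw hbw hn
    have hx'' := mem_priv.1 hx'
    have hne : x' ≠ w := fun e => hx''.2.1 (e ▸ hbw)
    have := (hG.not_nested (a := a) (b := w) (x := x') (by omega)
      (mem_priv.2 ⟨hx''.1, fun e => hn e.symm, hne⟩)).1 b
      (mem_priv.2 ⟨hbw.symm, fun e => hba e.symm, hab.symm⟩)
    have := N2 x' hx'
    omega
  have hall : ∀ x' ∈ G.priv a b, ∀ w ∈ G.priv b a, G.Adj x' w := by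
    intro x' hx' w hw
    by_contra hn
    exact Fl x' hx' w (N1 w hw) (mem_priv.1 hw).1 hn
  have hsum := hG.sum_priv hz hxm
  have hle : ∀ w ∈ (G.priv b a).erase z, G.amat w z - G.amat w x ≤ 0 := by
    intro w hw
    rw [amat_one (hall x hxm w (Finset.mem_of_mem_erase hw)).symm]
    unfold amat; split_ifs <;> simp
  have hge : 0 ≤ ∑ w ∈ (G.priv a b).erase x, (G.amat w z - G.amat w x) := by
    refine Finset.sum_nonneg fun w hw => ?_
    rw [amat_one (hall w (Finset.mem_of_mem_erase hw) z hz)]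
    unfold amat; split_ifs <;> simp
  -- `sum_priv` equates a nonpositive sum with a nonnegative one, so every term on the left
  -- vanishes: `z` is adjacent to all other vertices of `priv b a`. A vertex `u` private to `b`
  -- against `z` contradicts this.
  have hzero : ∀ w ∈ (G.priv b a).erase z, G.amat w z - G.amat w x = 0 :=
    (Finset.sum_eq_zero_iff_of_nonpos hle).1
      (le_antisymm (Finset.sum_nonpos hle) (by rw [hsum]; exact hge))
  obtain ⟨-, -, hc⟩ := Fh z hzd hxz
  obtain ⟨u, hu⟩ : (G.priv b z).Nonempty := Finset.card_pos.1 (by omega)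
  have hud := (Fh z hzd hxz).1 u hu
  have hu' := mem_priv.1 hu
  by_cases hau : G.Adj a u
  · have hxu : G.Adj x u := by
      by_contra hn
      exact Fl x hxm u hud hu'.1 hn
    have := (Fh u hud hxu).2.1 a (mem_priv.2 ⟨hau.symm, hba, hab⟩)
    omega
  · have hua : u ≠ a := fun e => by rw [e] at hud; omega
    have hum : u ∈ G.priv b a := mem_priv.2 ⟨hu'.1, hau, hua⟩
    have h0 := hzero u (Finset.mem_erase.2 ⟨hu'.2.2, hum⟩)
    rw [amat_one (hall x hxm u hum).symm, amat_zero (fun e => hu'.2.1 e.symm)] at h0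
    omega

/-- Pick any `z` in `priv b a`. If `x` is not adjacent to it, the complement, with `a` and `b`
exchanged, is in the situation of `no_cross_aux`. -/
theorem IsUni.no_cross {G : SimpleGraph V} (hG : G.IsUni) {x a b : V}
    (hb : G.dg x < G.dg b) (ha : G.dg a < G.dg x) (hxb : ¬ G.Adj x b) (hxa : G.Adj x a) :
    False := by
  have hxb' : x ≠ b := fun e => by rw [e] at hb; omega
  have hxm : x ∈ G.priv a b := by
    rw [mem_priv]; exact ⟨hxa.symm, fun e => hxb e.symm, hxb'⟩
  obtain ⟨N1, N2, hc⟩ := hG.not_nested (ha.trans hb) hxm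
  obtain ⟨z, hz⟩ : (G.priv b a).Nonempty := Finset.card_pos.1 (by omega)
  by_cases hxz : G.Adj x z
  · exact hG.no_cross_aux hb ha hxb hxa hz hxz
  · have c1 := G.dg_compl x
    have c2 := G.dg_compl a
    have c3 := G.dg_compl b
    have hne : x ≠ z := fun e => (mem_priv.1 hxm).2.1 (e ▸ (mem_priv.1 hz).1)
    refine hG.compl.no_cross_aux (x := x) (a := b) (b := a) (z := z) (by omega) (by omega)
      (fun e => e.2 hxa) ⟨hxb', hxb⟩ (by rwa [priv_compl]) ⟨hne, hxz⟩

/-- In a unigraph, a degree class is complete to all vertices of larger degree or has no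
neighbours of smaller degree. -/
theorem IsUni.low_or_high {G : SimpleGraph V} (hG : G.IsUni) (δ : ℕ) :
    (∀ x l, G.dg x = δ → G.dg l < δ → ¬ G.Adj x l) ∨
    (∀ x h, G.dg x = δ → δ < G.dg h → G.Adj x h) := by
  by_contra hcon
  push Not at hcon
  obtain ⟨⟨x2, l, hx2, hl, hx2l⟩, ⟨x, h, hx, hh, hxh⟩⟩ := hcon
  have hx2H : ∀ h', δ < G.dg h' → G.Adj x2 h' := by
    intro h' hh'
    by_contra hn
    exact hG.no_cross (x := x2) (by omega) (by omega) hn hx2l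
  have hxL : ∀ l', G.dg l' < δ → ¬ G.Adj x l' := fun l' hl' e =>
    hG.no_cross (x := x) (by omega) (by omega) hxh e
  have m1 : h ∈ G.priv x2 x :=
    mem_priv.2 ⟨hx2H h hh, hxh, fun e => by rw [e] at hh; omega⟩
  have m2 : l ∈ G.priv x2 x :=
    mem_priv.2 ⟨hx2l, hxL l hl, fun e => by rw [e] at hl; omega⟩
  have hc := card_priv_eq (G := G) (x := x) (y := x2) (by omega)
  obtain ⟨p, hp⟩ : (G.priv x x2).Nonempty :=
    Finset.card_pos.1 (by rw [hc]; exact Finset.card_pos.2 ⟨h, m1⟩)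
  have hp' := mem_priv.1 hp
  have hpd : G.dg p = δ := by
    rcases lt_trichotomy (G.dg p) δ with h1 | h1 | h1
    · exact absurd hp'.1 (hxL p h1)
    · exact h1
    · exact absurd (hx2H p h1) hp'.2.1
  -- The vertices `h` and `l`, of degrees above and below `δ`, are private to `x2`, while `p`, of
  -- degree `δ`, is private to `x`.
  have := hG.dg_eq_of_priv (by omega) hp m1 m2 (by omega) (by omega)
  omega

end

end SimpleGraph

/-! ### Vertices of larger degree missed by a degree class without smaller neighbours. -/

namespace SimpleGraph

section
open scoped Classical

variable {V : Type u} [Fintype V]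

/-- This is `wsum_priv` for the indicator of `n`, arranged without subtraction. -/
theorem cnt_sub {G : SimpleGraph V} (n : ℕ) {x y : V} (h : G.dg x = G.dg y) :
    G.cnt n x + ((G.priv y x).filter fun w => G.dg w = n).card =
      G.cnt n y + ((G.priv x y).filter fun w => G.dg w = n).card := by
  have := G.wsum_priv (fun k => if k = n then 1 else 0) h
  rw [wsum_indicator, wsum_indicator, Finset.sum_boole, Finset.sum_boole] at this
  omega

/-- In the unigraph `G`, vertices of degree `δ` have no neighbours of smaller degree. -/
structure NoLow (G : SimpleGraph V) (δ : ℕ) : Prop where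
  uni : G.IsUni
  nolow : ∀ x l, G.dg x = δ → G.dg l < δ → ¬ G.Adj x l

namespace NoLow

variable {G : SimpleGraph V} {δ : ℕ}

/-- A vertex `z` from `exists_top` has a neighbour of degree `δ`, hence is adjacent to everything
larger. If `x` missed two larger vertices, then `x` would have at least two more neighbours of
degree `δ` than `z`, whereas `cnt_eq` allows exactly one more. -/
theorem atMostOne_of_all (hN : G.NoLow δ) (hall : ∀ x, G.dg x = δ → ∃ y, G.dg y = δ ∧ G.Adj x y) {d : V}
    (hd : G.dg d = δ) : (∃ z, G.dg z = δ ∧ ∀ h, δ < G.dg h → G.Adj z h) ∧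
      ∀ x h h', G.dg x = δ → δ < G.dg h → δ < G.dg h' → h ≠ h' → ¬ G.Adj x h →
        ¬ G.Adj x h' → False := by
  obtain ⟨z, hz, htop⟩ := hN.uni.exists_top d
  obtain ⟨p, hp, hzp⟩ := hall z (by omega)
  have hzH : ∀ h, δ < G.dg h → G.Adj z h := by
    intro h hh
    by_contra hn
    have := htop p h hzp hn (fun e => by rw [e] at hh; omega)
    omega
  refine ⟨⟨z, by omega, hzH⟩, fun x h h' hx hh hh' hne h1 h2 => ?_⟩
  have hxz : G.dg x = G.dg z := by omega
  have m1 : h ∈ G.priv z x := mem_priv.2 ⟨hzH h hh, h1, fun e => by rw [e] at hh; omega⟩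
  have m2 : h' ∈ G.priv z x := mem_priv.2 ⟨hzH h' hh', h2, fun e => by rw [e] at hh'; omega⟩
  have hc := card_priv_eq hxz
  have hall' : ∀ w ∈ G.priv x z, G.dg w = δ := by
    intro w hw
    have hw' := mem_priv.1 hw
    rcases lt_trichotomy (G.dg w) δ with h3 | h3 | h3
    · exact absurd hw'.1 (hN.nolow x w hx h3)
    · exact h3
    · exact absurd (hzH w h3) hw'.2.1
  obtain ⟨q, hq⟩ : (G.priv x z).Nonempty :=
    Finset.card_pos.1 (by rw [hc]; exact Finset.card_pos.2 ⟨h, m1⟩)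
  have hqd := hall' q hq
  have e1 := hN.uni.cnt_eq (alt_of_priv hq m1) hxz (by omega)
  have e2 := cnt_sub (G := G) δ hxz
  rw [Finset.filter_true_of_mem hall'] at e2
  have : ((G.priv z x).filter fun w => G.dg w = δ).card + 2 ≤ (G.priv z x).card := by
    rw [← Finset.card_pair hne, ← Finset.card_union_of_disjoint]
    · refine Finset.card_le_card fun w hw => ?_
      simp only [Finset.mem_union, Finset.mem_filter, Finset.mem_insert,
        Finset.mem_singleton] at hw
      rcases hw with hw | rfl | rfl
      exacts [hw.1, m1, m2]
    · rw [Finset.disjoint_left]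
      intro w hw
      simp only [Finset.mem_filter] at hw
      simp only [Finset.mem_insert, Finset.mem_singleton]
      rintro (rfl | rfl) <;> omega
  rw [hqd] at e1
  omega

/-- If some vertex of degree `δ` has no neighbour of degree `δ`, each one has at most one. -/
theorem cnt_eq_one (hN : G.NoLow δ) {x0 : V} (h0 : G.dg x0 = δ) (hn0 : G.cnt δ x0 = 0) {x y : V}
    (hx : G.dg x = δ) (hy : G.dg y = δ) (hxy : G.Adj x y) : G.cnt δ x = 1 := by
  have hy0 : y ∈ G.priv x x0 := by
    refine mem_priv.2 ⟨hxy, not_adj_of_cnt_eq_zero hn0 hy, ?_⟩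
    rintro rfl
    exact not_adj_of_cnt_eq_zero hn0 hx hxy.symm
  have hc := card_priv_eq (G := G) (x := x) (y := x0) (by omega)
  obtain ⟨q, hq⟩ : (G.priv x0 x).Nonempty :=
    Finset.card_pos.1 (by rw [← hc]; exact Finset.card_pos.2 ⟨y, hy0⟩)
  have hqd : G.dg q ≠ δ := fun e => not_adj_of_cnt_eq_zero hn0 e (mem_priv.1 hq).1
  have := hN.uni.cnt_eq (alt_of_priv hy0 hq) (by omega) (by omega)
  rw [hy] at this
  omega

/-- By `cnt_eq_one` the edges inside the class form a matching. If `y` were adjacent to `h`, a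
vertex `z` private to `h` would have no neighbour in the class, and some larger `k` would be private
to `z` against `y`. Whether or not `x` is adjacent to `k`, two vertices of different degrees are
forced to have equal degree. -/
theorem mate_misses (hN : G.NoLow δ) {x0 : V} (h0 : G.dg x0 = δ) (hn0 : G.cnt δ x0 = 0) {x y h : V}
    (hx : G.dg x = δ) (hy : G.dg y = δ) (hxy : G.Adj x y) (hh : δ < G.dg h)
    (hxh : ¬ G.Adj x h) : ¬ G.Adj y h := by
  intro hyh
  have c1 := hN.cnt_eq_one h0 hn0 hx hy hxy
  have hxh' : x ≠ h := fun e => by rw [e] at hx; omega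
  obtain ⟨N1, -, N3⟩ := hN.uni.not_nested (a := y) (b := h) (x := x) (by omega)
    (mem_priv.2 ⟨hxy.symm, fun e => hxh e.symm, hxh'⟩)
  obtain ⟨z, hz⟩ : (G.priv h y).Nonempty := Finset.card_pos.1 (by omega)
  have hzd : G.dg z = δ := (N1 z hz).trans hx
  have hz' := mem_priv.1 hz
  have hxz : ¬ G.Adj x z := fun e => hz'.2.2 (eq_of_cnt_eq_one c1 hzd hy e hxy)
  have hxz' : x ≠ z := fun e => hxh (e ▸ hz'.1.symm)
  have cz := hN.uni.cnt_eq (x := x) (p := y) (y := z) (q := h)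
    ⟨hxy, hz'.1.symm, hxh, fun e => hz'.2.1 e.symm, hxh', hz'.2.2⟩ (by omega) (by omega)
  rw [hy, c1] at cz
  have hm : x ∈ G.priv y z := mem_priv.2 ⟨hxy.symm, fun e => hxz e.symm, hxz'⟩
  have hc := card_priv_eq (G := G) (x := y) (y := z) (by omega)
  obtain ⟨k, hk⟩ : (G.priv z y).Nonempty :=
    Finset.card_pos.1 (by rw [← hc]; exact Finset.card_pos.2 ⟨x, hm⟩)
  have hk' := mem_priv.1 hk
  have hkd : δ < G.dg k := by
    rcases lt_trichotomy (G.dg k) δ with h3 | h3 | h3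
    · exact absurd hk'.1 (hN.nolow z k hzd h3)
    · exact absurd hk'.1 (not_adj_of_cnt_eq_zero (by omega) h3)
    · exact h3
  have hkh : k ≠ h := fun e => hk'.2.1 (e ▸ hyh)
  have hhk : ¬ G.Adj h k := by
    intro e
    have := N1 k (mem_priv.2 ⟨e, hk'.2.1, hk'.2.2⟩)
    omega
  by_cases hxk : G.Adj x k
  · have := hN.uni.dg_eq_or (x := x) (p := k) (y := h) (q := z)
      ⟨hxk, hz'.1, hxz, hhk, hxz', hkh.symm⟩
    omega
  · have := (hN.uni.not_nested (a := y) (b := k) (x := x) (by omega)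
      (mem_priv.2 ⟨hxy.symm, fun e => hxk e.symm, fun e => by rw [e] at hx; omega⟩)).2.1 h
      (mem_priv.2 ⟨hyh, fun e => hhk e.symm, hkh.symm⟩)
    omega

/-- The vertex `x` is private to `y` against `h`, so by `not_nested` the two neighbourhoods differ
only inside the class. -/
theorem adj_iff_of_misses (hN : G.NoLow δ) {x y h w : V} (hx : G.dg x = δ) (hy : G.dg y = δ) (hxy : G.Adj x y)
    (hh : δ < G.dg h) (hxh : ¬ G.Adj x h) (hyh : ¬ G.Adj y h) (hw : G.dg w ≠ δ) :
    G.Adj h w ↔ G.Adj y w := by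
  obtain ⟨N1, N2, -⟩ := hN.uni.not_nested (a := y) (b := h) (x := x) (by omega)
    (mem_priv.2 ⟨hxy.symm, fun e => hxh e.symm, fun e => by rw [e] at hx; omega⟩)
  constructor
  · intro e
    by_contra hn
    exact hw ((N1 w (mem_priv.2 ⟨e, hn, fun e => hw (e ▸ hy)⟩)).trans hx)
  · intro e
    by_contra hn
    exact hw ((N2 w (mem_priv.2 ⟨e, hn, fun e' => hyh (e' ▸ e)⟩)).trans hx)

/-- Outside the class, `h`, `h'`, `x`, `y` have the same neighbours; in particular `h` and `h'` are
nonadjacent. Some `z` in the class, with no neighbour in the class, is adjacent to both. Comparing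
`z` with `x` gives `q` of the degree of `h`, and comparing `q` with `h` gives `w`; the matching
identities then fail. -/
theorem atMostOne_of_matched (hN : G.NoLow δ) {x0 : V} (h0 : G.dg x0 = δ) (hn0 : G.cnt δ x0 = 0) {x y h h' : V}
    (hx : G.dg x = δ) (hy : G.dg y = δ) (hxy : G.Adj x y) (hh : δ < G.dg h)
    (hh' : δ < G.dg h') (hne : h ≠ h') (hxh : ¬ G.Adj x h) (hxh' : ¬ G.Adj x h') : False := by
  have hyh := hN.mate_misses h0 hn0 hx hy hxy hh hxh
  have hyh' := hN.mate_misses h0 hn0 hx hy hxy hh' hxh'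
  have c1 := hN.cnt_eq_one h0 hn0 hx hy hxy
  have hhh : ¬ G.Adj h h' := fun e => hyh' ((hN.adj_iff_of_misses hx hy hxy hh hxh hyh
    (by omega)).1 e)
  have key : ∀ k, δ < G.dg k → ¬ G.Adj x k → ¬ G.Adj y k → ∃ z, G.dg z = δ ∧ G.Adj z k ∧
      ¬ G.Adj z y ∧ z ≠ y ∧ G.cnt δ z = 0 := by
    intro k hk hxk hyk
    obtain ⟨N1, N2, N3⟩ := hN.uni.not_nested (a := y) (b := k) (x := x) (by omega)
      (mem_priv.2 ⟨hxy.symm, fun e => hxk e.symm, fun e => by rw [e] at hx; omega⟩)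
    obtain ⟨z, hz⟩ : (G.priv k y).Nonempty := Finset.card_pos.1 (by omega)
    have hz' := mem_priv.1 hz
    have hzd := N1 z hz
    refine ⟨z, by omega, hz'.1.symm, fun e => hz'.2.1 e.symm, hz'.2.2, ?_⟩
    have := hN.uni.cnt_eq (x := x) (p := y) (y := z) (q := k)
      ⟨hxy, hz'.1.symm, hxk, fun e => hz'.2.1 e.symm, fun e => by rw [e] at hx; omega, hz'.2.2⟩
      (by omega) (by omega)
    rw [hy] at this
    omega
  obtain ⟨z, hz, hzh, hzh', hzy, hzy', cz⟩ : ∃ z, G.dg z = δ ∧ G.Adj z h ∧ G.Adj z h' ∧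
      ¬ G.Adj z y ∧ z ≠ y ∧ G.cnt δ z = 0 := by
    obtain ⟨z1, a1, a2, a3, a4, a5⟩ := key h hh hxh hyh
    obtain ⟨z2, b1, b2, b3, b4, b5⟩ := key h' hh' hxh' hyh'
    by_cases e1 : G.Adj z1 h'
    · exact ⟨z1, a1, a2, e1, a3, a4, a5⟩
    by_cases e2 : G.Adj z2 h
    · exact ⟨z2, b1, e2, b2, b3, b4, b5⟩
    have := hN.uni.dg_eq_or (x := z1) (p := h) (y := h') (q := z2)
      ⟨a2, b2.symm, not_adj_of_cnt_eq_zero a5 b1, fun e => hhh e.symm,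
        fun e => e1 (e ▸ b2), hne.symm⟩
    omega
  have hzx : ¬ G.Adj z x := not_adj_of_cnt_eq_zero cz hx
  have hzx' : z ≠ x := fun e => hxh (e ▸ hzh)
  have mh : h ∈ G.priv z x := mem_priv.2 ⟨hzh, hxh, fun e => by rw [e] at hh; omega⟩
  have mh' : h' ∈ G.priv z x := mem_priv.2 ⟨hzh', hxh', fun e => by rw [e] at hh'; omega⟩
  have my : y ∈ G.priv x z := mem_priv.2 ⟨hxy, hzy, hzy'.symm⟩
  have hc := card_priv_eq (G := G) (x := x) (y := z) (by omega)
  have hc2 : 1 < (G.priv x z).card := by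
    rw [hc]; exact Finset.one_lt_card.2 ⟨h, mh, h', mh', hne⟩
  obtain ⟨q, hq, hqy⟩ := Finset.exists_mem_ne hc2 y
  have hq' := mem_priv.1 hq
  have hqd : G.dg q ≠ δ := fun e => hqy (eq_of_cnt_eq_one c1 e hy hq'.1 hxy)
  have hdq : G.dg q = G.dg h := by
    by_contra hn
    have := hN.uni.dg_eq_of_priv (x := z) (y := x) (by omega) mh hq my (Ne.symm hn) (by omega)
    omega
  have i1 : ∀ w, G.dg w ≠ δ → (G.Adj h w ↔ G.Adj y w) := fun w hw =>
    hN.adj_iff_of_misses hx hy hxy hh hxh hyh hw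
  have i2 : ∀ w, G.dg w ≠ δ → (G.Adj h w ↔ G.Adj x w) := fun w hw =>
    hN.adj_iff_of_misses hy hx hxy.symm hh hyh hxh hw
  have i3 : ∀ w, G.dg w ≠ δ → (G.Adj h' w ↔ G.Adj x w) := fun w hw =>
    hN.adj_iff_of_misses hy hx hxy.symm hh' hyh' hxh' hw
  have hhq : G.Adj h q := (i2 q hqd).2 hq'.1
  have hyq : G.Adj y q := (i1 q hqd).1 hhq
  have nx : x ∈ G.priv q h := mem_priv.2 ⟨hq'.1.symm, fun e => hxh e.symm,
    fun e => by rw [e] at hx; omega⟩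
  have ny : y ∈ G.priv q h := mem_priv.2 ⟨hyq.symm, fun e => hyh e.symm,
    fun e => by rw [e] at hy; omega⟩
  have nz : z ∈ G.priv h q := mem_priv.2 ⟨hzh.symm, fun e => hq'.2.1 e.symm, hq'.2.2.symm⟩
  have hc3 : 1 < (G.priv h q).card := by
    rw [← card_priv_eq hdq]; exact Finset.one_lt_card.2 ⟨x, nx, y, ny, hxy.ne⟩
  obtain ⟨w, hw, hwz⟩ := Finset.exists_mem_ne hc3 z
  have hw' := mem_priv.1 hw
  have r1 := (hN.uni.priv_four nx ny nz hw hxy.ne hwz.symm).1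
  rw [amat_one hxy, amat_zero hzy] at r1
  have hxw : G.Adj x w := by
    by_contra hn
    rw [amat_zero hn] at r1
    unfold amat at r1; split_ifs at r1 <;> omega
  have hzw : ¬ G.Adj z w := by
    intro hn
    rw [amat_one hn, amat_one hxw] at r1
    omega
  have hwd : G.dg w ≠ δ := fun e => hyh (eq_of_cnt_eq_one c1 e hy hxw hxy ▸ hw'.1.symm)
  have nw : w ∈ G.priv x z := mem_priv.2 ⟨hxw, hzw, hwz⟩
  -- One perfect matching of `q, w, h, h'` has no edge, while another contains the edge `h w`.
  have r2 := (hN.uni.priv_four hq nw mh mh' (fun e => hw'.2.2 e.symm) hne).1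
  rw [amat_zero hw'.2.1, amat_zero hhh, amat_one hw'.1] at r2
  unfold amat at r2; split_ifs at r2 <;> omega

/-- A vertex of degree `δ` misses at most one vertex of larger degree; some vertex of degree `δ`
misses none; those that miss one have a neighbour of degree `δ`. -/
theorem misses (hN : G.NoLow δ) {d d' : V} (hd : G.dg d = δ) (hd' : G.dg d' = δ) (hdd : G.Adj d d') :
    (∃ z, G.dg z = δ ∧ ∀ h, δ < G.dg h → G.Adj z h) ∧
      (∀ x h h', G.dg x = δ → δ < G.dg h → δ < G.dg h' → h ≠ h' → ¬ G.Adj x h →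
        ¬ G.Adj x h' → False) ∧
      (∀ x h, G.dg x = δ → δ < G.dg h → ¬ G.Adj x h → ∃ y, G.dg y = δ ∧ G.Adj x y) := by
  by_cases hall : ∀ x, G.dg x = δ → ∃ y, G.dg y = δ ∧ G.Adj x y
  · obtain ⟨h1, h2⟩ := hN.atMostOne_of_all hall hd
    exact ⟨h1, h2, fun x _ hx _ _ => hall x hx⟩
  push Not at hall
  have hz : ∀ x, (∀ y, G.dg y = δ → ¬ G.Adj x y) → G.cnt δ x = 0 := by
    intro x hx
    rw [cnt, Finset.card_eq_zero, Finset.filter_eq_empty_iff]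
    intro w hw e
    exact hx w e (by simpa using hw)
  obtain ⟨x0, h0, hx0⟩ := hall
  have hn0 := hz x0 hx0
  -- Every vertex private to `x` against `d` has larger degree and is missed by `d`, so there is
  -- exactly one, `q`. Then `d` cannot miss `h` as well, so `d'` and `h` are two vertices private to
  -- `d` against `x`, one too many.
  have hcompl : ∀ x h, G.dg x = δ → (∀ y, G.dg y = δ → ¬ G.Adj x y) → δ < G.dg h →
      G.Adj x h := by
    intro x h hx hxD hh
    by_contra hn
    have m1 : d' ∈ G.priv d x := mem_priv.2 ⟨hdd, hxD d' hd',
      fun e => hxD d hd (e ▸ hdd.symm)⟩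
    have hc := card_priv_eq (G := G) (x := d) (y := x) (by omega)
    have hsub : ∀ w ∈ G.priv x d, δ < G.dg w := by
      intro w hw
      have hw' := mem_priv.1 hw
      rcases lt_trichotomy (G.dg w) δ with h3 | h3 | h3
      · exact absurd hw'.1 (hN.nolow x w hx h3)
      · exact absurd hw'.1 (hxD w h3)
      · exact h3
    have hle : (G.priv x d).card ≤ 1 := by
      by_contra hcon
      obtain ⟨p, hp, q, hq, hpq⟩ := Finset.one_lt_card.1 (not_le.1 hcon)
      exact hN.atMostOne_of_matched h0 hn0 hd hd' hdd (hsub p hp) (hsub q hq) hpq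
        (mem_priv.1 hp).2.1 (mem_priv.1 hq).2.1
    obtain ⟨q, hq⟩ : (G.priv x d).Nonempty :=
      Finset.card_pos.1 (by rw [← hc]; exact Finset.card_pos.2 ⟨d', m1⟩)
    have hqh : q ≠ h := fun e => hn (e ▸ (mem_priv.1 hq).1)
    have hdh : G.Adj d h := by
      by_contra hn'
      exact hN.atMostOne_of_matched h0 hn0 hd hd' hdd (hsub q hq) hh hqh
        (mem_priv.1 hq).2.1 hn'
    have m2 : h ∈ G.priv d x := mem_priv.2 ⟨hdh, hn, fun e => by rw [e] at hh; omega⟩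
    have : 1 < (G.priv d x).card :=
      Finset.one_lt_card.2 ⟨d', m1, h, m2, fun e => by rw [e] at hd'; omega⟩
    omega
  refine ⟨⟨x0, h0, fun h => hcompl x0 h h0 hx0⟩, fun x h h' hx hh hh' hne h1 h2 => ?_,
    fun x h hx hh hxh => ?_⟩
  · by_cases hxD : ∃ y, G.dg y = δ ∧ G.Adj x y
    · obtain ⟨y, hy, hxy⟩ := hxD
      exact hN.atMostOne_of_matched h0 hn0 hx hy hxy hh hh' hne h1 h2
    · push Not at hxD
      exact h1 (hcompl x h hx hxD hh)
  · by_contra hcon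
    push Not at hcon
    exact hxh (hcompl x h hx hcon hh)

end NoLow

end

end SimpleGraph

/-! ### At most one vertex outside a mixed degree class. -/

namespace SimpleGraph

section
open scoped Classical

variable {V : Type u} [Fintype V]

namespace NoLow

variable {G : SimpleGraph V} {δ : ℕ}

/-- If `b` and `h` were nonadjacent, `not_nested` would make every neighbour of `x` in the class
miss `h`. So `x` is not adjacent to a vertex `z` of the class complete to the larger degrees, and
`x, h, b, z` is an alternating cycle violating `dg_eq_or`. -/
theorem adj_of_missed (hN : G.NoLow δ) {d d' : V} (hd : G.dg d = δ) (hd' : G.dg d' = δ)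
    (hdd : G.Adj d d') {x b h : V} (hx : G.dg x = δ) (hb : δ < G.dg b) (hxb : ¬ G.Adj x b)
    (hh : δ < G.dg h) (hne : h ≠ b) : G.Adj b h := by
  obtain ⟨⟨z, hz, hzH⟩, P1, P3⟩ := hN.misses hd hd' hdd
  obtain ⟨y, hy, hxy⟩ := P3 x b hx hb hxb
  have hxb' : x ≠ b := fun e => by rw [e] at hx; omega
  by_contra hbh
  have hxh : G.Adj x h := by
    by_contra hn
    exact P1 x h b hx hh hb hne hn hxb
  have step : ∀ w, G.dg w = δ → G.Adj x w → ¬ G.Adj w h := by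
    intro w hw hxw hwh
    have := (hN.uni.not_nested (a := w) (b := b) (x := x) (by omega)
      (mem_priv.2 ⟨hxw.symm, fun e => hxb e.symm, hxb'⟩)).2.1 h (mem_priv.2 ⟨hwh, hbh, hne⟩)
    omega
  have hxz : ¬ G.Adj x z := fun e => step z hz e (hzH h hh)
  have := hN.uni.dg_eq_or (x := x) (p := h) (y := b) (q := z)
    ⟨hxh, (hzH b hb).symm, hxz, hbh, fun e => hxb (e ▸ hzH b hb), hne.symm⟩
  omega

theorem not_adj_low_of_missed (hN : G.NoLow δ) {d d' : V} (hd : G.dg d = δ) (hd' : G.dg d' = δ)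
    (hdd : G.Adj d d') {x b l : V} (hx : G.dg x = δ) (hb : δ < G.dg b) (hxb : ¬ G.Adj x b)
    (hl : G.dg l < δ) : ¬ G.Adj b l := by
  intro hbl
  obtain ⟨-, -, P3⟩ := hN.misses hd hd' hdd
  obtain ⟨y, hy, hxy⟩ := P3 x b hx hb hxb
  have := (hN.uni.not_nested (a := y) (b := b) (x := x) (by omega)
    (mem_priv.2 ⟨hxy.symm, fun e => hxb e.symm, fun e => by rw [e] at hx; omega⟩)).1 l
    (mem_priv.2 ⟨hbl, hN.nolow y l hy hl, fun e => by rw [e] at hl; omega⟩)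
  omega

/-- By `adj_of_missed`, `b'` is private to `b` against `x'`; if `x` and `x'` were adjacent,
`not_nested` would give it degree `δ`. -/
theorem not_adj_of_missed_ne (hN : G.NoLow δ) {d d' : V} (hd : G.dg d = δ) (hd' : G.dg d' = δ)
    (hdd : G.Adj d d') {x x' b b' : V} (hx : G.dg x = δ) (hx' : G.dg x' = δ) (hb : δ < G.dg b)
    (hb' : δ < G.dg b') (hne : b ≠ b') (hxb : ¬ G.Adj x b) (hxb' : ¬ G.Adj x' b') :
    ¬ G.Adj x x' := by
  intro hxx
  have := (hN.uni.not_nested (a := x') (b := b) (x := x) (by omega)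
    (mem_priv.2 ⟨hxx.symm, fun e => hxb e.symm, fun e => by rw [e] at hx; omega⟩)).1 b'
    (mem_priv.2 ⟨hN.adj_of_missed hd hd' hdd hx hb hxb hb' hne.symm, hxb',
      fun e => by rw [e] at hb'; omega⟩)
  omega

theorem of_iso (hN : G.NoLow δ) {H : SimpleGraph V} (φ : G ≃g H) : H.NoLow δ := by
  refine ⟨hN.uni.of_iso φ, fun x l hx hl h => ?_⟩
  rw [← dg_iso φ.symm] at hx hl
  exact hN.nolow _ _ hx hl (φ.symm.map_rel_iff.2 h)

/-- Each of `priv x x'` and `priv x' x` contains exactly one vertex outside the class, namely `b'`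
and `b`, so `x` and `x'` have equally many neighbours in the class. A neighbour `y` of `x` alone
would contradict this through `cnt_eq`. -/
theorem common_nbr (hN : G.NoLow δ) {d d' : V} (hd : G.dg d = δ) (hd' : G.dg d' = δ)
    (hdd : G.Adj d d') {x x' b b' : V} (hx : G.dg x = δ) (hx' : G.dg x' = δ) (hb : δ < G.dg b)
    (hb' : δ < G.dg b') (hne : b ≠ b') (hxb : ¬ G.Adj x b) (hxb' : ¬ G.Adj x' b') {y : V}
    (hy : G.dg y = δ) (hxy : G.Adj x y) : G.Adj x' y := by
  obtain ⟨-, P1, -⟩ := hN.misses hd hd' hdd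
  by_contra hn
  have hQ := hN.not_adj_of_missed_ne hd hd' hdd hx hx' hb hb' hne hxb hxb'
  have hyx' : y ≠ x' := fun e => hQ (e ▸ hxy)
  have h1 : G.Adj x' b := by
    by_contra h
    exact P1 x' b b' hx' hb hb' hne h hxb'
  have h2 : G.Adj x b' := by
    by_contra h
    exact P1 x b b' hx hb hb' hne hxb h
  have m1 : y ∈ G.priv x x' := mem_priv.2 ⟨hxy, hn, hyx'⟩
  have m2 : b ∈ G.priv x' x := mem_priv.2 ⟨h1, hxb, fun e => by rw [e] at hb; omega⟩
  have e1 := hN.uni.cnt_eq (alt_of_priv m1 m2) (by omega) (by omega)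
  have e2 := cnt_sub (G := G) δ (x := x) (y := x') (by omega)
  have e3 := card_priv_eq (G := G) (x := x) (y := x') (by omega)
  have key : ∀ x x' b b', G.dg x = δ → G.dg x' = δ → δ < G.dg b → δ < G.dg b' → b ≠ b' →
      ¬ G.Adj x b → ¬ G.Adj x' b' → G.Adj x b' → (G.priv x x').card =
      ((G.priv x x').filter fun w => G.dg w = δ).card + 1 := by
    intro x x' b b' hx hx' hb hb' hne hxb hxb' h2
    rw [← Finset.card_filter_add_card_filter_not (s := G.priv x x') (fun w => G.dg w = δ)]
    congr 1
    rw [Finset.card_eq_one]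
    refine ⟨b', Finset.ext fun w => ?_⟩
    simp only [Finset.mem_filter, mem_priv, Finset.mem_singleton]
    constructor
    · rintro ⟨⟨w1, w2, w3⟩, w4⟩
      by_contra hw
      rcases lt_or_gt_of_ne w4 with h3 | h3
      · exact hN.nolow x w hx h3 w1
      · exact P1 x' w b' hx' h3 hb' hw w2 hxb'
    · rintro rfl
      exact ⟨⟨h2, hxb', fun e => by rw [e] at hb'; omega⟩, by omega⟩
  have k1 := key x x' b b' hx hx' hb hb' hne hxb hxb' h2
  have k2 := key x' x b' b hx' hx hb' hb hne.symm hxb' hxb h1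
  rw [hy] at e1
  omega

/-- Otherwise the neighbours of `x` in the class are adjacent to `x'` and complete to the larger
degrees. Switching `x, y, z, b` with two such nonadjacent neighbours `y`, `z` makes `z` miss `b`
while it stays adjacent to `x'`, which still misses `b'`; this contradicts `not_adj_of_missed_ne` in
the new unigraph. -/
theorem missed_unique (hN : G.NoLow δ) {d d' : V} (hd : G.dg d = δ) (hd' : G.dg d' = δ)
    (hdd : G.Adj d d') {x x' b b' : V} (hx : G.dg x = δ) (hx' : G.dg x' = δ) (hb : δ < G.dg b)
    (hb' : δ < G.dg b') (hxb : ¬ G.Adj x b) (hxb' : ¬ G.Adj x' b') : b = b' := by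
  by_contra hne
  obtain ⟨-, P1, P3⟩ := hN.misses hd hd' hdd
  have hN1 : ∀ y, G.dg y = δ → G.Adj x y → G.Adj x' y := fun y hy =>
    hN.common_nbr hd hd' hdd hx hx' hb hb' hne hxb hxb' hy
  have hyH : ∀ y, G.dg y = δ → G.Adj x y → ∀ c, δ < G.dg c → G.Adj y c := by
    intro y hy hxy c hc
    by_contra hn
    by_cases hcb : c = b
    · exact hN.not_adj_of_missed_ne hd hd' hdd hx' hy hb' hc
        (by rw [hcb]; exact Ne.symm hne) hxb' hn (hN1 y hy hxy)
    · exact hN.not_adj_of_missed_ne hd hd' hdd hx hy hb hc (Ne.symm hcb) hxb hn hxy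
  obtain ⟨y, hy, hxy⟩ := P3 x b hx hb hxb
  have m1 : b ∈ G.priv y x := mem_priv.2 ⟨hyH y hy hxy b hb, hxb,
    fun e => by rw [e] at hb; omega⟩
  have hc := card_priv_eq (G := G) (x := x) (y := y) (by omega)
  obtain ⟨z, hz⟩ : (G.priv x y).Nonempty :=
    Finset.card_pos.1 (by rw [hc]; exact Finset.card_pos.2 ⟨b, m1⟩)
  obtain ⟨hxz, hyz, hzy⟩ := mem_priv.1 hz
  have hzd : G.dg z = δ := by
    rcases lt_trichotomy (G.dg z) δ with h3 | h3 | h3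
    · exact absurd hxz (hN.nolow x z hx h3)
    · exact h3
    · exact absurd (hyH y hy hxy z h3) hyz
  have hzH := hyH z hzd hxz
  have a : G.Alt x y z b := ⟨hxy, hzH b hb, hxb, fun e => hyz e.symm,
    fun e => by rw [e] at hx; omega, hzy⟩
  obtain ⟨φ⟩ := hN.uni _ (dg_sw a)
  have hN' := hN.of_iso φ
  have hsd := dg_sw a
  have hxx' : x' ≠ x := by
    rintro rfl
    exact P1 x' b b' hx' hb hb' hne hxb hxb'
  have hx'z : x' ≠ z := fun e => hxb' (e ▸ hzH b' hb')
  refine hN'.not_adj_of_missed_ne (d := φ d) (d' := φ d') (x := z) (x' := x') (b := b)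
    (b' := b') (by rw [dg_iso, hd]) (by rw [dg_iso, hd']) (φ.map_rel_iff.2 hdd) (by rw [hsd, hzd])
    (by rw [hsd, hx']) (by rw [hsd]; exact hb) (by rw [hsd]; exact hb') hne ?_ ?_ ?_
  · rw [sw_adj_right a]
    rintro (e | e)
    · rw [e] at hb; omega
    · exact e.2 rfl
  · rw [sw_adj_of_ne hxx' hx'z]
    · exact hxb'
    · rintro rfl; omega
    · rintro rfl; omega
  · rw [sw_adj_right a]
    exact Or.inr ⟨(hN1 z hzd hxz).symm, fun e => by rw [e] at hx'; omega⟩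

theorem exists_exception (hN : G.NoLow δ) (hS : ¬ G.SetDecomp) {d d' : V} (hd : G.dg d = δ)
    (hd' : G.dg d' = δ) (hdd : G.Adj d d') {e e' : V} (he : G.dg e = δ) (he' : G.dg e' = δ)
    (hee : ¬ G.Adj e e') (hne : e ≠ e') : ∃ b, ∀ v, v ≠ b → G.dg v = δ := by
  have hempty : ¬ ∃ v, (δ < G.dg v ∧ ∀ x, G.dg x = δ → G.Adj x v) ∨ G.dg v < δ := by
    rintro ⟨v, hv⟩
    -- The clique consists of the larger vertices missed by nobody in the class, the stable set of
    -- the smaller vertices. The non-edge `e e'` makes the former a clique and the edge `d d'` makes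
    -- the latter stable, both through `dg_eq_or`.
    refine hS ⟨{v | δ < G.dg v ∧ ∀ x, G.dg x = δ → G.Adj x v}, {v | G.dg v < δ},
      {v | G.dg v = δ ∨ (δ < G.dg v ∧ ∃ x, G.dg x = δ ∧ ¬ G.Adj x v)}, fun w => ?_,
      fun w hw hw' => ?_, fun w hw hw' => ?_, fun w hw hw' => ?_, fun w hw w' hw' hww => ?_,
      fun w hw w' hw' hww => ?_, fun w hw w' hw' => ?_, fun w hw w' hw' hww => ?_, ⟨v, hv⟩,
      ⟨d, Or.inl hd⟩⟩
    · by_cases h : ∀ x, G.dg x = δ → G.Adj x w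
      · rcases lt_trichotomy (G.dg w) δ with h1 | h1 | h1
        · exact Or.inr (Or.inl h1)
        · exact Or.inr (Or.inr (Or.inl h1))
        · exact Or.inl ⟨h1, h⟩
      · rcases lt_trichotomy (G.dg w) δ with h1 | h1 | h1
        · exact Or.inr (Or.inl h1)
        · exact Or.inr (Or.inr (Or.inl h1))
        · push Not at h
          exact Or.inr (Or.inr (Or.inr ⟨h1, h⟩))
    · simp only [Set.mem_ofPred_eq] at hw hw'; omega
    · simp only [Set.mem_ofPred_eq] at hw hw'
      rcases hw' with h | ⟨h, x, hx, hxw⟩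
      · omega
      · exact hxw (hw.2 x hx)
    · simp only [Set.mem_ofPred_eq] at hw hw'; omega
    · simp only [Set.mem_ofPred_eq] at hw hw'
      by_contra hn
      have := hN.uni.dg_eq_or (x := e) (p := w') (y := w) (q := e')
        ⟨hw'.2 e he, (hw.2 e' he').symm, hee, hn, hne, hww⟩
      omega
    · simp only [Set.mem_ofPred_eq] at hw hw'
      have := hN.uni.dg_eq_or (x := w) (p := w') (y := d) (q := d')
        ⟨hww, hdd, fun e => hN.nolow d' w hd' hw e.symm, hN.nolow d w' hd hw',
          fun e => by rw [e] at hw; omega, fun e => by rw [← e] at hw'; omega⟩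
      omega
    · simp only [Set.mem_ofPred_eq] at hw hw'
      rcases hw' with h | ⟨h, x, hx, hxw⟩
      · exact (hw.2 w' h).symm
      · exact (hN.adj_of_missed hd hd' hdd hx h hxw hw.1
          (fun e => hxw (e ▸ hw.2 x hx))).symm
    · simp only [Set.mem_ofPred_eq] at hw hw'
      rcases hw' with h | ⟨h, x, hx, hxw⟩
      · exact hN.nolow w' w h hw hww.symm
      · exact hN.not_adj_low_of_missed hd hd' hdd hx h hxw hw hww.symm
  push Not at hempty
  by_cases hb : ∃ b, δ < G.dg b
  · obtain ⟨b, hb⟩ := hb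
    obtain ⟨x, hx, hxb⟩ := (hempty b).1 hb
    refine ⟨b, fun v hv => ?_⟩
    by_contra hvd
    have hvd' : δ < G.dg v := lt_of_le_of_ne (hempty v).2 (Ne.symm hvd)
    obtain ⟨x', hx', hxv⟩ := (hempty v).1 hvd'
    exact hv (hN.missed_unique hd hd' hdd hx' hx hvd' hb hxv hxb)
  · push Not at hb
    exact ⟨d, fun v _ => le_antisymm (hb v) (hempty v).2⟩

end NoLow

/-- In an indecomposable unigraph with a degree class that is neither a clique nor stable, all but
at most one vertex have the same degree. -/
theorem IsUni.exists_exception {G : SimpleGraph V} (hG : G.IsUni) (hS : ¬ G.SetDecomp) {δ : ℕ}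
    {d d' : V} (hd : G.dg d = δ) (hd' : G.dg d' = δ) (hdd : G.Adj d d') {e e' : V}
    (he : G.dg e = δ) (he' : G.dg e' = δ) (hee : ¬ G.Adj e e') (hne : e ≠ e') :
    ∃ b, ∀ v, v ≠ b → G.dg v = δ := by
  rcases hG.low_or_high δ with h | h
  · exact NoLow.exists_exception ⟨hG, h⟩ hS hd hd' hdd he he' hee hne
  · have hc := G.dg_compl
    have hcd := hc d
    have hN : Gᶜ.NoLow (Gᶜ.dg d) := by
      refine ⟨hG.compl, fun x l hx hl hxl => ?_⟩
      have := hc x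
      have := hc l
      exact hxl.2 (h x l (by omega) (by omega))
    have hS' : ¬ Gᶜ.SetDecomp := fun h => hS (by simpa using h.compl)
    have he1 := hc e
    have he2 := hc e'
    have hd2 := hc d'
    obtain ⟨b, hb⟩ := hN.exists_exception hS' (d := e) (d' := e') (e := d) (e' := d')
      (by omega) (by omega) ⟨hne, hee⟩ rfl (by omega) (fun h => h.2 hdd) hdd.ne
    refine ⟨b, fun v hv => ?_⟩
    have := hb v hv
    have := hc v
    omega

end

end SimpleGraph

/-! ### Nearly regular unigraphs: the private neighbours of a nonadjacent pair. -/

namespace SimpleGraph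

section
open scoped Classical

variable {V : Type u} [Fintype V]

/-- A unigraph all of whose vertices but `b` have degree `δ`, with nonadjacent `x` and `y` such
that `x` is adjacent to `b`, `y` is not, and no common neighbours or no common non-neighbours. -/
structure Cfg (G : SimpleGraph V) (b : V) (δ : ℕ) (x y : V) : Prop where
  uni : G.IsUni
  deg : ∀ v, v ≠ b → G.dg v = δ
  three_le : 3 ≤ δ
  le_card : 2 * δ + 1 ≤ Fintype.card V
  nxy : x ≠ y
  not_adj : ¬ G.Adj x y
  xb : G.Adj x b
  yb : ¬ G.Adj y b
  ext : (∀ w, ¬ (G.Adj x w ∧ G.Adj y w)) ∨ ∀ w, w ≠ x → w ≠ y → G.Adj x w ∨ G.Adj y w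

namespace Cfg

variable {G : SimpleGraph V} {b x y : V} {δ : ℕ}

theorem x_ne (h : G.Cfg b δ x y) : x ≠ b := h.xb.ne

theorem y_ne (h : G.Cfg b δ x y) : y ≠ b := by
  rintro rfl
  exact h.not_adj h.xb

theorem b_mem (h : G.Cfg b δ x y) : b ∈ G.priv x y :=
  mem_priv.2 ⟨h.xb, h.yb, h.y_ne.symm⟩

theorem card_eq (h : G.Cfg b δ x y) : (G.priv x y).card = (G.priv y x).card :=
  card_priv_eq (by rw [h.deg x h.x_ne, h.deg y h.y_ne])

theorem disj (G : SimpleGraph V) (x y : V) : Disjoint (G.priv x y) (G.priv y x) := by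
  rw [Finset.disjoint_left]
  intro w h1 h2
  exact (mem_priv.1 h1).2.1 (mem_priv.1 h2).1

theorem card_union (h : G.Cfg b δ x y) :
    (G.priv x y ∪ G.priv y x).card = 2 * (G.priv x y).card := by
  rw [Finset.card_union_of_disjoint (disj G x y), ← h.card_eq]; ring

theorem deg_split (h : G.Cfg b δ x y) :
    (G.nb x ∩ G.nb y).card + (G.priv x y).card = δ := by
  rw [← h.deg x h.x_ne, dg, ← Finset.card_union_of_disjoint]
  · congr 1
    ext w
    have : G.Adj x w → w ≠ y := fun e e' => h.not_adj (e' ▸ e)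
    simp only [Finset.mem_union, Finset.mem_inter, mem_nb, mem_priv]
    tauto
  · rw [Finset.disjoint_left]
    intro w h1 h2
    simp at h1 h2
    exact h2.2.1 h1.2

theorem card_split (h : G.Cfg b δ x y) :
    Fintype.card V = 2 + (G.nb x ∩ G.nb y).card + 2 * (G.priv x y).card +
      (Finset.univ.filter fun w => w ≠ x ∧ w ≠ y ∧ ¬ G.Adj x w ∧ ¬ G.Adj y w).card := by
  obtain ⟨N, hN⟩ : ∃ N : Finset V, N = Finset.univ.filter fun w => w ≠ x ∧ w ≠ y ∧
      ¬ G.Adj x w ∧ ¬ G.Adj y w := ⟨_, rfl⟩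
  have hu : (Finset.univ : Finset V) = ((({x, y} : Finset V) ∪ (G.nb x ∩ G.nb y)) ∪
      (G.priv x y ∪ G.priv y x)) ∪ N := by
    ext w
    rw [hN]
    simp only [Finset.mem_univ, Finset.mem_union, Finset.mem_inter, mem_nb, mem_priv,
      Finset.mem_insert, Finset.mem_singleton, Finset.mem_filter, true_iff, true_and]
    tauto
  have h3 : ∀ e : G.Adj y x, False := fun e => h.not_adj e.symm
  have h4 := h.not_adj
  rw [← hN, ← Finset.card_univ, hu, Finset.card_union_of_disjoint, Finset.card_union_of_disjoint,
    Finset.card_union_of_disjoint, Finset.card_pair h.nxy, h.card_union]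
  · rw [Finset.disjoint_left]
    intro w h1 h2
    simp only [Finset.mem_inter, mem_nb, Finset.mem_insert, Finset.mem_singleton] at h1 h2
    rcases h1 with rfl | rfl
    · exact G.irrefl h2.1
    · exact G.irrefl h2.2
  · rw [Finset.disjoint_left]
    intro w h1 h2
    simp only [Finset.mem_union, Finset.mem_inter, mem_nb, mem_priv,
      Finset.mem_insert, Finset.mem_singleton] at h1 h2
    rcases h1 with (rfl | rfl) | h1
    · exact h2.elim (fun e => G.irrefl e.1) (fun e => h3 e.1)
    · exact h2.elim (fun e => h4 e.1) (fun e => G.irrefl e.1)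
    · tauto
  · rw [Finset.disjoint_left]
    intro w h1 h2
    rw [hN] at h2
    simp only [Finset.mem_union, Finset.mem_inter, mem_nb, mem_priv,
      Finset.mem_insert, Finset.mem_singleton, Finset.mem_filter] at h1 h2
    tauto

theorem inter_or (h : G.Cfg b δ x y) : (G.nb x ∩ G.nb y).card = 0 ∨
    (Finset.univ.filter fun w => w ≠ x ∧ w ≠ y ∧ ¬ G.Adj x w ∧ ¬ G.Adj y w).card = 0 := by
  rcases h.ext with e | e
  · left
    rw [Finset.card_eq_zero, Finset.eq_empty_iff_forall_notMem]
    intro w hw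
    exact e w (by simpa using hw)
  · right
    rw [Finset.card_eq_zero, Finset.filter_eq_empty_iff]
    rintro w - ⟨h1, h2, h3, h4⟩
    exact (e w h1 h2).elim h3 h4

/-- Without common neighbours all neighbours are private. Without common non-neighbours, `2 δ + 1`
being at most the order leaves room for at most one common neighbour. -/
theorem le_succ (h : G.Cfg b δ x y) : δ ≤ (G.priv x y).card + 1 := by
  have h1 := h.deg_split
  have h2 := h.card_split
  have h3 := h.le_card
  rcases h.inter_or with e | e <;> omega

theorem ne_of_mem (h : G.Cfg b δ x y) {p : V} (hp : p ∈ G.priv x y ∪ G.priv y x) :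
    p ≠ x ∧ p ≠ y := by
  have h3 : ¬ G.Adj y x := fun e => h.not_adj e.symm
  have h4 := h.not_adj
  rw [Finset.mem_union, mem_priv, mem_priv] at hp
  constructor
  · rintro rfl
    exact hp.elim (fun e => G.irrefl e.1) (fun e => h3 e.1)
  · rintro rfl
    exact hp.elim (fun e => h4 e.1) (fun e => G.irrefl e.1)

/-- The extra neighbour is `x` or `y`. -/
theorem succ_le_dg {p : V} (hp : p ∈ G.priv x y ∪ G.priv y x) {T : Finset V}
    (hT : ∀ w ∈ T, G.Adj p w) (hx : x ∉ T) (hy : y ∉ T) : T.card + 1 ≤ G.dg p := by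
  obtain ⟨z, hz, hpz⟩ : ∃ z, z ∉ T ∧ G.Adj p z := by
    rw [Finset.mem_union, mem_priv, mem_priv] at hp
    exact hp.elim (fun e => ⟨x, hx, e.1.symm⟩) (fun e => ⟨y, hy, e.1.symm⟩)
  rw [← Finset.card_insert_of_notMem hz]
  refine Finset.card_le_card fun w hw => ?_
  rw [Finset.mem_insert] at hw
  rw [mem_nb]
  rcases hw with rfl | hw
  exacts [hpz, hT w hw]

theorem one_adj {p : V} (hp : p ∈ G.priv x y ∪ G.priv y x) :
    ¬ (G.Adj p x ∧ G.Adj p y) := by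
  rw [Finset.mem_union, mem_priv, mem_priv] at hp
  have := G.adj_comm p x
  have := G.adj_comm p y
  tauto

/-- Here `x, b` are private to `m` and `p', s` are private to `p`. The matching `x b, p' s` has two
edges, but `x s, p' b` has at most one, against `priv_four`. -/
theorem small_aux (h : G.Cfg b δ x y) {m p p' s : V} (hp : p ∈ G.priv y x)
    (hmx : G.Adj m x) (hmb : G.Adj m b) (hmp' : ¬ G.Adj m p') (hms : ¬ G.Adj m s)
    (hpp : G.Adj p p') (hps : G.Adj p s) (hps' : G.Adj p' s) (hpb : ¬ G.Adj p b)
    (hpb' : ¬ G.Adj p' b) (hne : p ≠ b) (hmpn : m ≠ p')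
    (hmsn : m ≠ s) : False := by
  obtain ⟨q1, q2, q3⟩ := mem_priv.1 hp
  have := (h.uni.priv_four (x := m) (y := p) (p := x) (s := b) (q := p') (t := s)
    (mem_priv.2 ⟨hmx, fun e => q2 e.symm, q3.symm⟩) (mem_priv.2 ⟨hmb, hpb, hne.symm⟩)
    (mem_priv.2 ⟨hpp, hmp', hmpn.symm⟩) (mem_priv.2 ⟨hps, hms, hmsn.symm⟩) h.x_ne hps'.ne).1
  rw [amat_one h.xb, amat_one hps', amat_zero hpb'] at this
  unfold amat at this; split_ifs at this <;> omega

/-- The one case not excluded by counting: seven vertices `x, y, m, p, p', s, t`, where `m` is the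
only common neighbour and the private neighbours form a triangle and an isolated `t`. Degree 3
forces `t = b` and `m` adjacent to `b`. Then `small_aux` applies unless `p`, `p'` and `b` are all
private to `x`, which are too many. -/
theorem small (h : G.Cfg b δ x y) (hδ : δ = 3) (hr : (G.priv x y).card = 2) {p p' s t : V}
    (hp : p ∈ G.priv x y ∪ G.priv y x) (hp' : p' ∈ G.priv x y ∪ G.priv y x)
    (hs : s ∈ G.priv x y ∪ G.priv y x) (ht : t ∈ G.priv x y ∪ G.priv y x)
    (hall : ∀ w ∈ G.priv x y ∪ G.priv y x, w = p ∨ w = p' ∨ w = s ∨ w = t)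
    (hpb : p ≠ b) (hpb' : p' ≠ b) (hpp : G.Adj p p') (hps : G.Adj p s) (hps' : G.Adj p' s)
    (hpt : ¬ G.Adj p t) (hpt' : ¬ G.Adj p' t) (hst : ¬ G.Adj s t) (hnpt : p ≠ t) (hnpt' : p' ≠ t)
    (hnst : s ≠ t) : False := by
  have h1 := h.deg_split
  have h2 := h.card_split
  have hm1 : (G.nb x ∩ G.nb y).card = 1 := by omega
  have h0 := h.inter_or
  rw [hm1] at h0
  have hN := h0.resolve_left one_ne_zero
  obtain ⟨m, hm⟩ := Finset.card_eq_one.1 hm1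
  have hmm : G.Adj x m ∧ G.Adj y m := by
    have : m ∈ G.nb x ∩ G.nb y := by rw [hm]; simp
    simpa using this
  have hmu : ∀ w, G.Adj x w → G.Adj y w → w = m := by
    intro w h1 h2
    have : w ∈ G.nb x ∩ G.nb y := by simp [h1, h2]
    rw [hm] at this; simpa using this
  have hmR : m ∉ G.priv x y ∪ G.priv y x := by
    rw [Finset.mem_union, mem_priv, mem_priv]; tauto
  have hmb : m ≠ b := fun e => h.yb (e ▸ hmm.2)
  have hcov : ∀ w, w = x ∨ w = y ∨ w = m ∨ w = p ∨ w = p' ∨ w = s ∨ w = t := by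
    intro w
    rw [Finset.card_eq_zero, Finset.filter_eq_empty_iff] at hN
    by_cases w1 : w = x
    · exact Or.inl w1
    by_cases w2 : w = y
    · exact Or.inr (Or.inl w2)
    refine Or.inr (Or.inr ?_)
    by_cases w3 : G.Adj x w <;> by_cases w4 : G.Adj y w
    · exact Or.inl (hmu w w3 w4)
    · exact Or.inr (hall w (Finset.mem_union_left _ (mem_priv.2 ⟨w3, w4, w2⟩)))
    · exact Or.inr (hall w (Finset.mem_union_right _ (mem_priv.2 ⟨w4, w3, w1⟩)))
    · exact absurd ⟨w1, w2, w3, w4⟩ (hN (Finset.mem_univ w))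
  have hmp : m ≠ p := fun e => hmR (e ▸ hp)
  have hmp' : m ≠ p' := fun e => hmR (e ▸ hp')
  have hms : m ≠ s := fun e => hmR (e ▸ hs)
  have hmt : m ≠ t := fun e => hmR (e ▸ ht)
  have full : ∀ u v w, u ∈ G.priv x y ∪ G.priv y x → v ∈ G.priv x y ∪ G.priv y x →
      w ∈ G.priv x y ∪ G.priv y x → u ≠ b → G.Adj u v → G.Adj u w → v ≠ w → m ≠ v → m ≠ w →
      ¬ G.Adj m u := by
    intro u v w hu hv hw hub huv huw hvw hmv hmw hmu
    have := succ_le_dg hu (T := {m, v, w}) (by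
      intro z hz
      simp only [Finset.mem_insert, Finset.mem_singleton] at hz
      rcases hz with rfl | rfl | rfl
      exacts [hmu.symm, huv, huw]) (by
        simp only [Finset.mem_insert, Finset.mem_singleton, not_or]
        exact ⟨hmm.1.ne, (h.ne_of_mem hv).1.symm, (h.ne_of_mem hw).1.symm⟩) (by
        simp only [Finset.mem_insert, Finset.mem_singleton, not_or]
        exact ⟨hmm.2.ne, (h.ne_of_mem hv).2.symm, (h.ne_of_mem hw).2.symm⟩)
    rw [h.deg u hub, Finset.card_eq_three.2 ⟨m, v, w, hmv, hmw, hvw, rfl⟩] at this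
    omega
  have n1 := full p p' s hp hp' hs hpb hpp hps hps'.ne hmp' hms
  have n2 := full p' p s hp' hp hs hpb' hpp.symm hps' hps.ne hmp hms
  have htb : t = b := by
    by_contra htb
    have hd := h.deg t htb
    have ho := one_adj ht
    have hsub : ∃ z, G.nb t ⊆ {m, z} := by
      by_cases e : G.Adj t x
      · refine ⟨x, fun w hw => ?_⟩
        rw [mem_nb] at hw
        simp only [Finset.mem_insert, Finset.mem_singleton]
        rcases hcov w with rfl | rfl | rfl | rfl | rfl | rfl | rfl
        exacts [Or.inr rfl, absurd ⟨e, hw⟩ ho, Or.inl rfl, absurd hw.symm hpt,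
          absurd hw.symm hpt', absurd hw.symm hst, absurd hw G.irrefl]
      · refine ⟨y, fun w hw => ?_⟩
        rw [mem_nb] at hw
        simp only [Finset.mem_insert, Finset.mem_singleton]
        rcases hcov w with rfl | rfl | rfl | rfl | rfl | rfl | rfl
        exacts [absurd hw e, Or.inr rfl, Or.inl rfl, absurd hw.symm hpt,
          absurd hw.symm hpt', absurd hw.symm hst, absurd hw G.irrefl]
    obtain ⟨z, hz⟩ := hsub
    have := (Finset.card_le_card hz).trans Finset.card_le_two
    change G.dg t ≤ 2 at this
    omega
  subst htb
  have n3 := full s p p' hs hp hp' hnst hps.symm hps'.symm hpp.ne hmp hmp'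
  have hmt' : G.Adj m t := by
    by_contra hn
    have hsub : G.nb m ⊆ {x, y} := by
      intro w hw
      rw [mem_nb] at hw
      simp only [Finset.mem_insert, Finset.mem_singleton]
      rcases hcov w with rfl | rfl | rfl | rfl | rfl | rfl | rfl
      exacts [Or.inl rfl, Or.inr rfl, absurd hw G.irrefl, absurd hw n1, absurd hw n2,
        absurd hw n3, absurd hw hn]
    have := (Finset.card_le_card hsub).trans Finset.card_le_two
    change G.dg m ≤ 2 at this
    have := h.deg m hmb
    omega
  by_cases e1 : p ∈ G.priv y x
  · exact h.small_aux e1 hmm.1.symm hmt' n2 n3 hpp hps hps' hpt hpt' hpb hmp' hms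
  by_cases e2 : p' ∈ G.priv y x
  · exact h.small_aux e2 hmm.1.symm hmt' n1 n3 hpp.symm hps' hps hpt' hpt hpb' hmp
      hms
  · have f1 := (Finset.mem_union.1 hp).resolve_right e1
    have f2 := (Finset.mem_union.1 hp').resolve_right e2
    have : 3 ≤ (G.priv x y).card := by
      rw [← Finset.card_eq_three.2 ⟨p, p', t, hpp.ne, hnpt, hnpt', rfl⟩]
      refine Finset.card_le_card fun w hw => ?_
      simp only [Finset.mem_insert, Finset.mem_singleton] at hw
      rcases hw with rfl | rfl | rfl
      exacts [f1, f2, h.b_mem]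
    omega

/-- The private neighbours of `x` and `y` other than `b` form a stable set. -/
theorem stable (h : G.Cfg b δ x y) {p p' : V} (hp : p ∈ G.priv x y ∪ G.priv y x)
    (hp' : p' ∈ G.priv x y ∪ G.priv y x) (hpb : p ≠ b) (hpb' : p' ≠ b) : ¬ G.Adj p p' := by
  intro hpp
  set R := G.priv x y ∪ G.priv y x with hR
  have hRc := h.card_union
  rw [← hR] at hRc
  have hle := h.le_succ
  have h3 := h.three_le
  have hce := h.card_eq
  have hfour : ∀ s t, s ∈ R → t ∈ R → s ≠ p → s ≠ p' → t ≠ p → t ≠ p' → s ≠ t →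
      1 + G.amat s t = G.amat p s + G.amat p' t ∧ 1 + G.amat s t = G.amat p t + G.amat p' s := by
    intro s t hs ht h1 h2 h3 h4 h5
    have := h.uni.four (x := x) (y := y) (by omega) (by omega) hp hp' hs ht hpp.ne h1.symm h3.symm
      h2.symm h4.symm h5
    rwa [amat_one hpp] at this
  have a01 : ∀ u v, G.amat u v = 0 ∨ G.amat u v = 1 := by
    intro u v
    unfold amat; split_ifs <;> simp
  have hR2 : ∀ u v, u ∈ R → v ∈ R → u ≠ v → ((R.erase u).erase v).card + 2 = R.card := by
    intro u v hu hv huv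
    rw [Finset.card_erase_of_mem (Finset.mem_erase.2 ⟨huv.symm, hv⟩), Finset.card_erase_of_mem hu]
    omega
  have hxR : ∀ u v, x ∉ (R.erase u).erase v := fun u v hu =>
    (h.ne_of_mem (Finset.mem_of_mem_erase (Finset.mem_of_mem_erase hu))).1 rfl
  have hyR : ∀ u v, y ∉ (R.erase u).erase v := fun u v hu =>
    (h.ne_of_mem (Finset.mem_of_mem_erase (Finset.mem_of_mem_erase hu))).2 rfl
  -- Either `p` is adjacent to all of `R` other than `p, p'`, or it misses some `s`; then the
  -- matching identity makes `p'` adjacent to everything in `R` other than `p', s`. With `le_succ`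
  -- and `3 ≤ δ` only `δ = 3` and two private neighbours on each side remain.
  have hbig : 2 * (G.priv x y).card - 2 + 1 ≤ δ := by
    by_cases hall : ∀ s ∈ R, s ≠ p → s ≠ p' → G.Adj p s
    · have := succ_le_dg hp (T := (R.erase p).erase p') (fun w hw => by
        rw [Finset.mem_erase, Finset.mem_erase] at hw
        exact hall w hw.2.2 hw.2.1 hw.1) (hxR _ _) (hyR _ _)
      have := hR2 p p' hp hp' hpp.ne
      rw [h.deg p hpb] at *
      omega
    · push Not at hall
      obtain ⟨s, hs, hsp, hsp', hps⟩ := hall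
      have := succ_le_dg hp' (T := (R.erase p').erase s) (fun w hw => by
        rw [Finset.mem_erase, Finset.mem_erase] at hw
        by_cases hwp : w = p
        · rw [hwp]; exact hpp.symm
        · have e := (hfour s w hs hw.2.2 hsp hsp' hwp hw.2.1 hw.1.symm).1
          by_contra hn
          rw [amat_zero hps, amat_zero hn] at e
          rcases a01 s w with e' | e' <;> omega) (hxR _ _) (hyR _ _)
      have := hR2 p' s hp' hs hsp'.symm
      rw [h.deg p' hpb'] at *
      omega
  have hδ : δ = 3 := by omega
  have hr : (G.priv x y).card = 2 := by omega
  have hc2 : ((R.erase p).erase p').card = 2 := by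
    have := hR2 p p' hp hp' hpp.ne
    omega
  obtain ⟨s, t, hst, hE⟩ := Finset.card_eq_two.1 hc2
  have hall : ∀ w ∈ R, w = p ∨ w = p' ∨ w = s ∨ w = t := by
    intro w hw
    by_contra hcon
    push Not at hcon
    have : w ∈ (R.erase p).erase p' := by simp [hcon.1, hcon.2.1, hw]
    rw [hE] at this
    simp [hcon.2.2.1, hcon.2.2.2] at this
  have hs : s ≠ p' ∧ s ≠ p ∧ s ∈ R := by
    have : s ∈ (R.erase p).erase p' := by rw [hE]; simp
    simpa using this
  have ht : t ≠ p' ∧ t ≠ p ∧ t ∈ R := by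
    have : t ∈ (R.erase p).erase p' := by rw [hE]; simp
    simpa using this
  have full : ∀ u v, u ∈ R → v ∈ R → u ≠ b → G.Adj u v → v ≠ s → v ≠ t →
      ¬ (G.Adj u s ∧ G.Adj u t) := by
    rintro u v hu hv hub huv hvs hvt ⟨h1, h2⟩
    have := succ_le_dg hu (T := {v, s, t}) (by
      intro z hz
      simp only [Finset.mem_insert, Finset.mem_singleton] at hz
      rcases hz with rfl | rfl | rfl
      exacts [huv, h1, h2]) (by
        simp only [Finset.mem_insert, Finset.mem_singleton, not_or]
        exact ⟨(h.ne_of_mem hv).1.symm, (h.ne_of_mem hs.2.2).1.symm,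
          (h.ne_of_mem ht.2.2).1.symm⟩) (by
        simp only [Finset.mem_insert, Finset.mem_singleton, not_or]
        exact ⟨(h.ne_of_mem hv).2.symm, (h.ne_of_mem hs.2.2).2.symm,
          (h.ne_of_mem ht.2.2).2.symm⟩)
    rw [h.deg u hub, Finset.card_eq_three.2 ⟨v, s, t, hvs, hvt, hst, rfl⟩] at this
    omega
  have f1 := full p p' hp hp' hpb hpp hs.1.symm ht.1.symm
  have f2 := full p' p hp' hp hpb' hpp.symm hs.2.1.symm ht.2.1.symm
  obtain ⟨e1, e2⟩ := hfour s t hs.2.2 ht.2.2 hs.2.1 hs.1 ht.2.1 ht.1 hst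
  have key : ∀ u v, G.amat u v = 1 ↔ G.Adj u v := by
    intro u v; unfold amat; split_ifs with h <;> simp [h]
  rw [← key, ← key] at f1 f2
  -- Neither `p` nor `p'` is adjacent to both `s` and `t`, so equality of the three matchings leaves
  -- a triangle on `p, p'` and one of `s, t`, with the other isolated in `R`.
  by_cases hps : G.amat p s = 1
  · have c1 : G.amat p t = 0 := (a01 p t).resolve_right fun e => f1 ⟨hps, e⟩
    have c2 : G.amat p' s = 1 ∧ G.amat p' t = 0 ∧ G.amat s t = 0 := by
      rcases a01 p' s with d1 | d1 <;> rcases a01 p' t with d2 | d2 <;>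
        rcases a01 s t with d3 | d3 <;> omega
    obtain ⟨c2, c3, c4⟩ := c2
    refine h.small hδ hr hp hp' hs.2.2 ht.2.2 hall hpb hpb' hpp ((key _ _).1 hps)
      ((key _ _).1 c2) ?_ ?_ ?_ ht.2.1.symm ht.1.symm hst <;> rw [← key] <;> omega
  · have hps0 := (a01 p s).resolve_right hps
    have c2 : G.amat p t = 1 ∧ G.amat p' t = 1 ∧ G.amat p' s = 0 ∧ G.amat s t = 0 := by
      rcases a01 p' s with d1 | d1 <;> rcases a01 p' t with d2 | d2 <;>
        rcases a01 s t with d3 | d3 <;> rcases a01 p t with d4 | d4 <;>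
        omega
    obtain ⟨c1, c2, c3, c4⟩ := c2
    have c4' := G.amat_symm s t
    refine h.small hδ hr hp hp' ht.2.2 hs.2.2 (fun w hw => ?_) hpb hpb' hpp ((key _ _).1 c1)
      ((key _ _).1 c2) ?_ ?_ ?_ hs.2.1.symm hs.1.symm hst.symm
    · have := hall w hw; tauto
    all_goals rw [← key]; omega

end Cfg

end

end SimpleGraph

/-! ### Nearly regular unigraphs: the bound on the common degree. -/

namespace SimpleGraph

section
open scoped Classical

theorem sw_adj_of_notMem {V : Type u} {G : SimpleGraph V} {x p y q u w : V} (h : G.Alt x p y q)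
    (h1 : u ≠ x) (h2 : u ≠ p) (h3 : u ≠ y) (h4 : u ≠ q) :
    (G.sw x p y q).Adj u w ↔ G.Adj u w := by
  rw [sw_adj_iff h]
  simp [h1, h2, h3, h4]

variable {V : Type u} [Fintype V]

namespace Cfg

variable {G : SimpleGraph V} {b x y : V} {δ : ℕ}

theorem mem_cases (h : G.Cfg b δ x y) {l w : V} (hl : l ∈ G.priv x y ∪ G.priv y x) (hlb : l ≠ b)
    (hlw : G.Adj l w) : w = x ∨ w = y ∨ w = b ∨ w ∈ G.nb x ∩ G.nb y ∨
      (w ≠ x ∧ w ≠ y ∧ ¬ G.Adj x w ∧ ¬ G.Adj y w) := by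
  by_cases w1 : w = x
  · exact Or.inl w1
  by_cases w2 : w = y
  · exact Or.inr (Or.inl w2)
  by_cases w0 : w = b
  · exact Or.inr (Or.inr (Or.inl w0))
  refine Or.inr (Or.inr (Or.inr ?_))
  by_cases w3 : G.Adj x w <;> by_cases w4 : G.Adj y w
  · exact Or.inl (by simp [w3, w4])
  · exact absurd hlw (h.stable hl (Finset.mem_union_left _ (mem_priv.2 ⟨w3, w4, w2⟩)) hlb w0)
  · exact absurd hlw (h.stable hl (Finset.mem_union_right _ (mem_priv.2 ⟨w4, w3, w1⟩)) hlb w0)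
  · exact Or.inr ⟨w1, w2, w3, w4⟩

theorem exists_hub {l : V} (hl : l ∈ G.priv x y ∪ G.priv y x) :
    ∃ z, ∀ w, G.Adj l w → w = x ∨ w = y → w = z := by
  have := one_adj hl
  by_cases e : G.Adj l x
  · exact ⟨x, fun w hw h => h.elim id fun h => absurd ⟨e, h ▸ hw⟩ this⟩
  · exact ⟨y, fun w hw h => h.elim (fun h => absurd (h ▸ hw) e) id⟩

theorem card_erase (h : G.Cfg b δ x y) :
    ((G.priv x y ∪ G.priv y x).erase b).card + 1 = 2 * (G.priv x y).card := by
  have hb : b ∈ G.priv x y ∪ G.priv y x := Finset.mem_union_left _ h.b_mem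
  rw [Finset.card_erase_of_mem hb, ← h.card_union]
  have := Finset.card_pos.2 ⟨b, hb⟩
  omega

/-- By stability a private neighbour other than `b` is adjacent only to one of `x, y`, to `b`, and
to common neighbours, of which there is at most one. So `δ = 3`, and the common neighbour `m` is
adjacent to all these vertices and to `x`, exceeding its degree. -/
theorem exists_common_nonnbr (h : G.Cfg b δ x y)
    (hN : ∀ w, w ≠ x → w ≠ y → G.Adj x w ∨ G.Adj y w) : False := by
  have h1 := h.deg_split
  have h2 := h.le_succ
  have h3 := h.three_le
  have hce := h.card_erase
  have hM : (G.nb x ∩ G.nb y).card ≤ 1 := by omega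
  have hsub : ∀ l ∈ (G.priv x y ∪ G.priv y x).erase b, ∃ z,
      G.nb l ⊆ insert z (insert b (G.nb l ∩ (G.nb x ∩ G.nb y))) := by
    intro l hl
    rw [Finset.mem_erase] at hl
    obtain ⟨z, hz⟩ := exists_hub hl.2
    refine ⟨z, fun w hw => ?_⟩
    have hw' := mem_nb.1 hw
    rw [Finset.mem_insert, Finset.mem_insert, Finset.mem_inter]
    rcases h.mem_cases hl.2 hl.1 hw' with e | e | e | e | e
    · exact Or.inl (hz w hw' (Or.inl e))
    · exact Or.inl (hz w hw' (Or.inr e))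
    · exact Or.inr (Or.inl e)
    · exact Or.inr (Or.inr ⟨hw, e⟩)
    · exact ((hN w e.1 e.2.1).elim e.2.2.1 e.2.2.2).elim
  have hcard : ∀ l ∈ (G.priv x y ∪ G.priv y x).erase b,
      δ ≤ 2 + (G.nb l ∩ (G.nb x ∩ G.nb y)).card := by
    intro l hl
    obtain ⟨z, hz⟩ := hsub l hl
    rw [← h.deg l (Finset.mem_erase.1 hl).1, dg]
    refine (Finset.card_le_card hz).trans ((Finset.card_insert_le _ _).trans ?_)
    have := Finset.card_insert_le b (G.nb l ∩ (G.nb x ∩ G.nb y))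
    omega
  have hle : ∀ l, (G.nb l ∩ (G.nb x ∩ G.nb y)).card ≤ (G.nb x ∩ G.nb y).card := fun l =>
    Finset.card_le_card Finset.inter_subset_right
  obtain ⟨l0, hl0⟩ : ((G.priv x y ∪ G.priv y x).erase b).Nonempty :=
    Finset.card_pos.1 (by omega)
  have hδ : δ = 3 := by have := hcard l0 hl0; have := hle l0; omega
  obtain ⟨m, hm⟩ := Finset.card_eq_one.1
    (show (G.nb x ∩ G.nb y).card = 1 by have := hcard l0 hl0; have := hle l0; omega)
  have hmm : G.Adj x m ∧ G.Adj y m := by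
    have : m ∈ G.nb x ∩ G.nb y := by rw [hm]; simp
    simpa using this
  have hml : ∀ l ∈ (G.priv x y ∪ G.priv y x).erase b, G.Adj m l := by
    intro l hl
    have h4 := hcard l hl
    by_contra hn
    have : G.nb l ∩ (G.nb x ∩ G.nb y) = ∅ := by
      rw [hm, Finset.inter_singleton_of_notMem]
      rw [mem_nb]
      exact fun e => hn e.symm
    rw [this, Finset.card_empty] at h4
    omega
  have hsub2 : insert x ((G.priv x y ∪ G.priv y x).erase b) ⊆ G.nb m := by
    intro w hw
    rw [Finset.mem_insert] at hw
    rw [mem_nb]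
    rcases hw with rfl | hw
    exacts [hmm.1.symm, hml w hw]
  have hx : x ∉ (G.priv x y ∪ G.priv y x).erase b := fun hx =>
    (h.ne_of_mem (Finset.mem_erase.1 hx).2).1 rfl
  have h5 := Finset.card_le_card hsub2
  rw [Finset.card_insert_of_notMem hx] at h5
  have h6 := h.deg m (fun e => h.yb (e ▸ hmm.2))
  rw [dg] at h6
  omega

/-- Were `s` and `t` nonadjacent, switching `l, s, t, l'` would keep the configuration but join `l`
to `l'`, against `stable`. -/
theorem cross (h : G.Cfg b δ x y) {l l' s t : V} (hl : l ∈ G.priv x y ∪ G.priv y x)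
    (hl' : l' ∈ G.priv x y ∪ G.priv y x) (hlb : l ≠ b) (hlb' : l' ≠ b) (hll : l ≠ l')
    (hs : s ≠ x ∧ s ≠ y ∧ ¬ G.Adj x s ∧ ¬ G.Adj y s)
    (ht : t ≠ x ∧ t ≠ y ∧ ¬ G.Adj x t ∧ ¬ G.Adj y t) (hst : s ≠ t) (hls : G.Adj l s)
    (hlt : G.Adj l' t) : G.Adj s t := by
  by_contra hn
  have a : G.Alt l s t l' := ⟨hls, hlt.symm, h.stable hl hl' hlb hlb', fun e => hn e.symm, hll,
    hst.symm⟩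
  have n1 := h.ne_of_mem hl
  have n2 := h.ne_of_mem hl'
  have hx : ∀ w, (G.sw l s t l').Adj x w ↔ G.Adj x w := fun w =>
    sw_adj_of_notMem a n1.1.symm hs.1.symm ht.1.symm n2.1.symm
  have hy : ∀ w, (G.sw l s t l').Adj y w ↔ G.Adj y w := fun w =>
    sw_adj_of_notMem a n1.2.symm hs.2.1.symm ht.2.1.symm n2.2.symm
  have h' : (G.sw l s t l').Cfg b δ x y := by
    refine ⟨h.uni.sw a, fun v hv => ?_, h.three_le, h.le_card, h.nxy, ?_, ?_, ?_, ?_⟩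
    · rw [dg_sw a, h.deg v hv]
    · rw [hx]; exact h.not_adj
    · rw [hx]; exact h.xb
    · rw [hy]; exact h.yb
    · simp only [hx, hy]; exact h.ext
  have e1 : (G.sw l s t l').priv x y ∪ (G.sw l s t l').priv y x = G.priv x y ∪ G.priv y x := by
    ext w
    simp only [Finset.mem_union, mem_priv, hx, hy]
  exact h'.stable (e1 ▸ hl) (e1 ▸ hl') hlb hlb' ((sw_adj_left a).2 (Or.inl rfl))

/-- In the remaining case there are `2 δ - 1` private neighbours `Q` other than `b`, each sending at
least `δ - 2` edges to the common non-neighbours `Ω` it reaches. By `cross` the set `Ω` is so dense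
that double counting these edges exceeds the degree `δ`. -/
theorem false (h : G.Cfg b δ x y) : False := by
  rcases h.ext with hM | hN
  swap
  · exact h.exists_common_nonnbr hN
  have h1 := h.deg_split
  have h3 := h.three_le
  have hce := h.card_erase
  have hM0 : G.nb x ∩ G.nb y = ∅ := by
    rw [Finset.eq_empty_iff_forall_notMem]
    intro w hw
    exact hM w (by simpa using hw)
  rw [hM0, Finset.card_empty, zero_add] at h1
  obtain ⟨Q, hQ⟩ : ∃ Q, Q = (G.priv x y ∪ G.priv y x).erase b := ⟨_, rfl⟩
  have hQm : ∀ l ∈ Q, l ≠ b ∧ l ∈ G.priv x y ∪ G.priv y x := by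
    intro l hl; rwa [hQ, Finset.mem_erase] at hl
  rw [← hQ, h1] at hce
  obtain ⟨Ω, hΩ⟩ : ∃ Ω : Finset V, Ω = Finset.univ.filter fun w =>
    (w ≠ x ∧ w ≠ y ∧ ¬ G.Adj x w ∧ ¬ G.Adj y w) ∧ ∃ l ∈ Q, G.Adj l w := ⟨_, rfl⟩
  have hΩm : ∀ w, w ∈ Ω ↔ (w ≠ x ∧ w ≠ y ∧ ¬ G.Adj x w ∧ ¬ G.Adj y w) ∧ ∃ l ∈ Q, G.Adj l w := by
    intro w; rw [hΩ]; simp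
  have hΩb : ∀ w ∈ Ω, G.dg w = δ := fun w hw =>
    h.deg w fun e => ((hΩm w).1 hw).1.2.2.1 (e ▸ h.xb)
  have hQΩ : ∀ l ∈ Q, l ∉ Ω := by
    intro l hl hl'
    have h5 := ((hΩm l).1 hl').1
    have h6 := (hQm l hl).2
    rw [Finset.mem_union, mem_priv, mem_priv] at h6
    exact h6.elim (fun e => h5.2.2.1 e.1) (fun e => h5.2.2.2 e.1)
  have ho : ∀ l ∈ Q, δ ≤ 2 + (Ω.filter (G.Adj l)).card ∧ (Ω.filter (G.Adj l)).card + 1 ≤ δ := by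
    intro l hl
    obtain ⟨hlb, hlR⟩ := hQm l hl
    constructor
    · obtain ⟨z, hz⟩ := exists_hub hlR
      have hsub : G.nb l ⊆ insert z (insert b (Ω.filter (G.Adj l))) := by
        intro w hw
        have hw' := mem_nb.1 hw
        rw [Finset.mem_insert, Finset.mem_insert, Finset.mem_filter]
        rcases h.mem_cases hlR hlb hw' with e | e | e | e | e
        · exact Or.inl (hz w hw' (Or.inl e))
        · exact Or.inl (hz w hw' (Or.inr e))
        · exact Or.inr (Or.inl e)
        · rw [hM0] at e; simp at e
        · exact Or.inr (Or.inr ⟨(hΩm w).2 ⟨e, l, hl, hw'⟩, hw'⟩)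
      rw [← h.deg l hlb, dg]
      refine (Finset.card_le_card hsub).trans ((Finset.card_insert_le _ _).trans ?_)
      have := Finset.card_insert_le b (Ω.filter (G.Adj l))
      omega
    · rw [← h.deg l hlb]
      refine succ_le_dg hlR (fun w hw => (Finset.mem_filter.1 hw).2) (fun hx => ?_) fun hy => ?_
      · exact ((hΩm x).1 (Finset.mem_filter.1 hx).1).1.1 rfl
      · exact ((hΩm y).1 (Finset.mem_filter.1 hy).1).1.2.1 rfl
  have hcross : ∀ l ∈ Q, ∀ l' ∈ Q, l ≠ l' → ∀ s ∈ Ω, ∀ t ∈ Ω, s ≠ t → G.Adj l s → G.Adj l' t →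
      G.Adj s t := fun l hl l' hl' hll s hs t ht hst hls hlt =>
    h.cross (hQm l hl).2 (hQm l' hl').2 (hQm l hl).1 (hQm l' hl').1 hll ((hΩm s).1 hs).1
      ((hΩm t).1 ht).1 hst hls hlt
  have hdc : ∑ l ∈ Q, (Ω.filter (G.Adj l)).card =
      ∑ s ∈ Ω, (Q.filter fun l => G.Adj l s).card :=
    Finset.sum_card_bipartiteAbove_eq_sum_card_bipartiteBelow G.Adj
  have hlow : Q.card * (δ - 2) ≤ ∑ l ∈ Q, (Ω.filter (G.Adj l)).card := by
    rw [← smul_eq_mul]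
    refine Finset.card_nsmul_le_sum _ _ _ fun l hl => ?_
    have := (ho l hl).1
    omega
  rw [hdc] at hlow
  obtain ⟨k, rfl⟩ : ∃ k, δ = k + 3 := ⟨δ - 3, by omega⟩
  have hQc : Q.card = 2 * k + 5 := by omega
  rw [hQc, show k + 3 - 2 = k + 1 by omega] at hlow
  obtain ⟨l1, hl1⟩ : Q.Nonempty := Finset.card_pos.1 (by omega)
  obtain ⟨s1, hs1⟩ : (Ω.filter (G.Adj l1)).Nonempty :=
    Finset.card_pos.1 (by have := (ho l1 hl1).1; omega)
  rw [Finset.mem_filter] at hs1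
  obtain ⟨s, hs, hmax⟩ := Ω.exists_max_image (fun s => (Q.filter fun l => G.Adj l s).card)
    ⟨s1, hs1.1⟩
  have hup : ∑ s ∈ Ω, (Q.filter fun l => G.Adj l s).card ≤
      Ω.card * (Q.filter fun l => G.Adj l s).card := by
    rw [← smul_eq_mul]
    exact Finset.sum_le_card_nsmul _ _ _ hmax
  by_cases ha : (Q.filter fun l => G.Adj l s).card ≤ 1
  -- If no vertex of `Ω` has two neighbours in `Q`, then `Ω` has at least `(2 δ - 1) (δ - 2)`
  -- vertices, and `s1` is adjacent to all but at most `δ - 1` of them.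
  · have hnb : insert l1 (Ω \ Ω.filter (G.Adj l1)) ⊆ G.nb s1 := by
      intro t ht
      rw [Finset.mem_insert, Finset.mem_sdiff] at ht
      rw [mem_nb]
      rcases ht with rfl | ⟨ht, ht'⟩
      · exact hs1.2.symm
      · obtain ⟨l', hl', hlt⟩ := ((hΩm t).1 ht).2
        refine hcross l1 hl1 l' hl' ?_ s1 hs1.1 t ht ?_ hs1.2 hlt
        · rintro rfl
          exact ht' (Finset.mem_filter.2 ⟨ht, hlt⟩)
        · rintro rfl
          exact ht' (Finset.mem_filter.2 ⟨ht, hs1.2⟩)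
    have hc := Finset.card_le_card hnb
    rw [Finset.card_insert_of_notMem fun e => hQΩ l1 hl1 (Finset.mem_sdiff.1 e).1,
      Finset.card_sdiff_of_subset (Finset.filter_subset _ _)] at hc
    have hd := hΩb s1 hs1.1
    rw [dg] at hd
    have h7 := (ho l1 hl1).2
    have h8 : Ω.card * (Q.filter fun l => G.Adj l s).card ≤ Ω.card * 1 :=
      Nat.mul_le_mul_left _ ha
    have h9 : (2 * k + 5) * (k + 1) ≤ Ω.card := by omega
    have h10 : 5 * (k + 1) ≤ (2 * k + 5) * (k + 1) := Nat.mul_le_mul_right _ (by omega)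
    omega
  · push Not at ha
    -- With two neighbours in `Q`, one can always be chosen different from a given `l'`, so `s` is
    -- adjacent to all of `Ω`. Hence `|Ω| + a ≤ δ + 1`, while `|Ω| a ≥ (2 δ - 1) (δ - 2)`,
    -- contradicting the inequality of the means.
    have hnb : Ω.erase s ∪ (Q.filter fun l => G.Adj l s) ⊆ G.nb s := by
      intro t ht
      rw [Finset.mem_union, Finset.mem_erase, Finset.mem_filter] at ht
      rw [mem_nb]
      rcases ht with ⟨hts, ht⟩ | ⟨ht, ht'⟩
      · obtain ⟨l', hl', hlt⟩ := ((hΩm t).1 ht).2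
        obtain ⟨l, hl, hll⟩ := Finset.exists_mem_ne ha l'
        rw [Finset.mem_filter] at hl
        exact hcross l hl.1 l' hl' hll s hs t ht hts.symm hl.2 hlt
      · exact ht'.symm
    have hc := Finset.card_le_card hnb
    rw [Finset.card_union_of_disjoint, Finset.card_erase_of_mem hs] at hc
    · have hd := hΩb s hs
      rw [dg] at hd
      generalize (Q.filter fun l => G.Adj l s).card = a at *
      have h7 : Ω.card + a ≤ k + 4 := by omega
      have h8 := hlow.trans hup
      nlinarith [sq_nonneg ((Ω.card : ℤ) - a), sq_nonneg (Ω.card - a : ℤ),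
        Nat.mul_le_mul h7 h7, four_mul_le_sq_add Ω.card a]
    · rw [Finset.disjoint_left]
      intro w hw hw'
      exact hQΩ w (Finset.mem_filter.1 hw').1 (Finset.mem_of_mem_erase hw)

end Cfg

/-- If every neighbour of `b` were adjacent to every non-neighbour other than `b`, a neighbour and a
non-neighbour would together give order at most `2 δ`. So a nonadjacent pair `x, y` separated by `b`
exists, and a suitable realisation of the degrees turns it into a `Cfg`. -/
theorem IsUni.exists_cfg {G : SimpleGraph V} (hG : G.IsUni) {b : V} {δ : ℕ}
    (hdeg : ∀ v, v ≠ b → G.dg v = δ) (h1 : ∃ u, G.Adj b u) (h2 : ∃ w, w ≠ b ∧ ¬ G.Adj b w)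
    (h3 : 3 ≤ δ) (hc : 2 * δ + 1 ≤ Fintype.card V) : False := by
  obtain ⟨x, y, hxy, hnxy, hxb, hyb, hyb'⟩ : ∃ x y, x ≠ y ∧ ¬ G.Adj x y ∧ G.Adj x b ∧
      ¬ G.Adj y b ∧ y ≠ b := by
    by_contra hcon
    push Not at hcon
    have hadj : ∀ x y, G.Adj x b → ¬ G.Adj y b → y ≠ b → G.Adj x y := by
      intro x y hx hy hyb
      by_contra hn
      exact hyb (hcon x y (fun e => hy (e ▸ hx)) hn hx hy)
    obtain ⟨u, hu⟩ := h1
    obtain ⟨w, hwb, hw⟩ := h2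
    have e1 : insert b (G.nb b ∪ {b})ᶜ ⊆ G.nb u := by
      intro z hz
      simp only [Finset.mem_insert, Finset.mem_compl, Finset.mem_union, mem_nb,
        Finset.mem_singleton, not_or] at hz
      rw [mem_nb]
      rcases hz with rfl | hz
      · exact hu.symm
      · exact hadj u z hu.symm (fun e => hz.1 e.symm) hz.2
    have e2 : G.nb b ⊆ G.nb w := by
      intro z hz
      rw [mem_nb] at hz ⊢
      exact (hadj z w hz.symm (fun e => hw e.symm) hwb).symm
    have c1 := Finset.card_le_card e1
    have c2 := Finset.card_le_card e2
    rw [Finset.card_insert_of_notMem (by simp), Finset.card_compl,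
      Finset.card_union_of_disjoint (by simp), Finset.card_singleton] at c1
    have d1 := hdeg u hu.ne'
    have d2 := hdeg w hwb
    rw [dg] at d1 d2
    omega
  -- A realisation with fewest common neighbours of `x` and `y` has none or has no common
  -- non-neighbour: otherwise a switching at `x` trades a common neighbour `p` for a common
  -- non-neighbour `u`.
  let S : Finset (SimpleGraph V) := Finset.univ.filter fun H =>
    (∀ v, H.dg v = G.dg v) ∧ ¬ H.Adj x y ∧ H.Adj x b ∧ ¬ H.Adj y b
  obtain ⟨H, hH, hmin⟩ := S.exists_min_image (fun H => (H.nb x ∩ H.nb y).card)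
    ⟨G, by simp [S, hnxy, hxb, hyb]⟩
  simp only [S, Finset.mem_filter, Finset.mem_univ, true_and] at hH hmin
  obtain ⟨hd, hn, hb1, hb2⟩ := hH
  obtain ⟨φ⟩ := hG H hd
  refine Cfg.false (G := H) (b := b) (δ := δ) (x := x) (y := y) ⟨hG.of_iso φ, fun v hv => ?_,
    h3, hc, hxy, hn, hb1, hb2, ?_⟩
  · rw [hd, hdeg v hv]
  by_contra hcon
  push Not at hcon
  obtain ⟨⟨p, hxp, hyp⟩, u, hux, huy, hxu, hyu⟩ := hcon
  have hpb : p ≠ b := fun e => hb2 (e ▸ hyp)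
  have hub : u ≠ b := fun e => hxu (e ▸ hb1)
  have hdd : H.dg p = H.dg u := by rw [hd, hd, hdeg p hpb, hdeg u hub]
  have hcard := card_priv_eq hdd
  have : 1 < (H.priv u p).card := by
    rw [← hcard]
    exact Finset.one_lt_card.2 ⟨x, mem_priv.2 ⟨hxp.symm, fun e => hxu e.symm, hux.symm⟩, y,
      mem_priv.2 ⟨hyp.symm, fun e => hyu e.symm, huy.symm⟩, hxy⟩
  obtain ⟨v, hv⟩ := Finset.card_pos.1 (by omega : 0 < (H.priv u p).card)
  obtain ⟨hv1, hv2, hv3⟩ := mem_priv.1 hv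
  have a : H.Alt x p v u := ⟨hxp, hv1.symm, hxu, fun e => hv2 e.symm, hux.symm, hv3⟩
  have hy : ∀ w, (H.sw x p v u).Adj y w ↔ H.Adj y w := fun w =>
    sw_adj_of_notMem a hxy.symm hyp.ne (fun e => hyu (e ▸ hv1.symm)) huy.symm
  have hle := hmin (H.sw x p v u) ⟨fun v => by rw [dg_sw a, hd], ?_, ?_, ?_⟩
  · have : (H.sw x p v u).nb x ∩ (H.sw x p v u).nb y ⊂ H.nb x ∩ H.nb y := by
      refine Finset.ssubset_iff_of_subset (fun w hw => ?_) |>.2 ⟨p, by simp [hxp, hyp], ?_⟩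
      · simp only [Finset.mem_inter, mem_nb, hy, sw_adj_left a] at hw ⊢
        refine ⟨?_, hw.2⟩
        rcases hw.1 with rfl | e
        · exact absurd hw.2 hyu
        · exact e.1
      · simp only [Finset.mem_inter, mem_nb, hy, sw_adj_left a]
        rintro ⟨e | e, -⟩
        · exact a.npq e
        · exact e.2 rfl
    exact absurd hle (not_le.2 (Finset.card_lt_card this))
  · rw [sw_adj_left a]
    rintro (e | e)
    · exact huy e.symm
    · exact hn e.1
  · rw [sw_adj_left a]
    exact Or.inr ⟨hb1, hpb.symm⟩
  · rw [hy]; exact hb2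

/-- In a unigraph all of whose vertices but `b` have degree `δ`, where `b` is neither isolated nor
dominating, `δ ≤ 2` or `δ` is at least the order minus `3`. -/
theorem IsUni.le_two_or {G : SimpleGraph V} (hG : G.IsUni) {b : V} {δ : ℕ}
    (hdeg : ∀ v, v ≠ b → G.dg v = δ) (h1 : ∃ u, G.Adj b u) (h2 : ∃ w, w ≠ b ∧ ¬ G.Adj b w) :
    δ ≤ 2 ∨ Fintype.card V ≤ δ + 3 := by
  by_contra hcon
  push Not at hcon
  by_cases hc : 2 * δ + 1 ≤ Fintype.card V
  · exact hG.exists_cfg hdeg h1 h2 (by omega) hc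
  -- When `2 δ + 1` exceeds the order, the complement, of common degree order minus `1 + δ`,
  -- satisfies the bound.
  · refine hG.compl.exists_cfg (b := b) (δ := Fintype.card V - 1 - δ) (fun v hv => ?_) ?_ ?_
      (by omega) (by omega)
    · have := G.dg_compl v
      have := hdeg v hv
      omega
    · obtain ⟨w, hw, hbw⟩ := h2
      exact ⟨w, hw.symm, hbw⟩
    · obtain ⟨u, hu⟩ := h1
      exact ⟨u, hu.ne', fun e => e.2 hu⟩

end

end SimpleGraph

/-! ### Split unigraphs, and near-regularity of the indecomposable nonsplit ones. -/

namespace SimpleGraph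

section
open scoped Classical

variable {V : Type u} [Fintype V]

/-- A unigraph in which every degree class is a clique or stable is split. -/
theorem IsUni.exists_split {G : SimpleGraph V} (hG : G.IsUni)
    (hp : ∀ d d' e e', G.dg d' = G.dg d → G.dg e = G.dg d → G.dg e' = G.dg d → G.Adj d d' →
      e ≠ e' → G.Adj e e') :
    ∃ K : Finset V, (∀ v ∈ K, ∀ w ∈ K, v ≠ w → G.Adj v w) ∧ ∀ v ∉ K, ∀ w ∉ K, ¬ G.Adj v w := by
  -- Excluding induced `2K₂`, `C₄` and `C₅` makes a graph split (Földes–Hammer). Here `dg_eq_or`,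
  -- applied to the alternating cycles, puts an edge and a non-edge into one degree class.
  have no2K2 : ∀ a b c d, G.Adj a b → G.Adj c d → ¬ G.Adj a c → ¬ G.Adj a d → ¬ G.Adj b c →
      ¬ G.Adj b d → a ≠ c → a ≠ d → b ≠ c → b ≠ d → False := by
    intro a b c d h1 h2 h3 h4 h5 h6 n1 n2 n3 n4
    have e1 := hG.dg_eq_or (x := a) (p := b) (y := c) (q := d)
      ⟨h1, h2, h4, fun e => h5 e.symm, n2, n3.symm⟩
    have e2 := hG.dg_eq_or (x := a) (p := b) (y := d) (q := c)
      ⟨h1, h2.symm, h3, fun e => h6 e.symm, n1, n4.symm⟩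
    rcases e1 with e1 | e1 <;> rcases e2 with e2 | e2
    · exact h3 (hp c d a c (by omega) (by omega) (by omega) h2 n1)
    · exact h3 (hp a b a c (by omega) (by omega) (by omega) h1 n1)
    · exact h4 (hp a b a d (by omega) (by omega) (by omega) h1 n2)
    · exact h6 (hp c d b d (by omega) (by omega) (by omega) h2 n4)
  have noC4 : ∀ a b c d, G.Adj a b → G.Adj b c → G.Adj c d → G.Adj d a → ¬ G.Adj a c →
      ¬ G.Adj b d → a ≠ c → b ≠ d → False := by
    intro a b c d h1 h2 h3 h4 h5 h6 n1 n2
    have e1 := hG.dg_eq_or (x := a) (p := b) (y := d) (q := c)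
      ⟨h1, h3.symm, h5, fun e => h6 e.symm, n1, n2.symm⟩
    have e2 := hG.dg_eq_or (x := a) (p := d) (y := b) (q := c)
      ⟨h4.symm, h2, h5, h6, n1, n2⟩
    rcases e1 with e1 | e1 <;> rcases e2 with e2 | e2
    · exact h6 (hp a b b d (by omega) (by omega) (by omega) h1 n2)
    · exact h5 (hp c d a c (by omega) (by omega) (by omega) h3 n1)
    · exact h5 (hp a b a c (by omega) (by omega) (by omega) h1 n1)
    · exact h6 (hp b c b d (by omega) (by omega) (by omega) h2 n2)
  have noC5 : ∀ a b c d e, G.Adj a b → G.Adj b c → G.Adj c d → G.Adj d e → G.Adj e a →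
      ¬ G.Adj a c → ¬ G.Adj b d → ¬ G.Adj c e → ¬ G.Adj d a → ¬ G.Adj e b → False := by
    intro a b c d e h1 h2 h3 h4 h5 h6 h7 h8 h9 h10
    have key : ∀ a b c d, G.Adj a b → G.Adj c d → ¬ G.Adj a c → ¬ G.Adj b d → a ≠ c → b ≠ d →
        G.dg a = G.dg d ∨ G.dg b = G.dg c := by
      intro a b c d h1 h2 h3 h4 n1 n2
      exact hG.dg_eq_or (x := a) (p := b) (y := d) (q := c)
        ⟨h1, h2.symm, h3, fun e => h4 e.symm, n1, n2.symm⟩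
    have nac : a ≠ c := fun e => h9 (e ▸ h3).symm
    have nbd : b ≠ d := fun e => h10 (e ▸ h4).symm
    have nce : c ≠ e := fun e' => h6 (e' ▸ h5).symm
    have nda : d ≠ a := fun e => h7 (e ▸ h1).symm
    have neb : e ≠ b := fun e => h8 (e ▸ h2).symm
    -- Any three vertices of a five-cycle span an edge and a non-edge, so no three degrees agree and
    -- at most two pairs are equal. Each of the five induced four-vertex paths demands an equal
    -- pair, its ends or its middle vertices, and these pairs all differ.
    have triple : ∀ a b c, G.Adj a b → ¬ G.Adj b c → b ≠ c → ¬ (G.dg b = G.dg a ∧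
        G.dg c = G.dg a) := fun a b c h1 h2 n h3 =>
      h2 (hp a b b c h3.1 h3.1 h3.2 h1 n)
    have t1 := triple b a c h1.symm h6 nac
    have t2 := triple c b d h2.symm h7 nbd
    have t3 := triple d c e h3.symm h8 nce
    have t4 := triple e d a h4.symm h9 nda
    have t5 := triple a e b h5.symm h10 neb
    have t6 := triple a b d h1 h7 nbd
    have t7 := triple b c e h2 h8 nce
    have t8 := triple c d a h3 h9 nda
    have t9 := triple d e b h4 h10 neb
    have t10 := triple e a c h5 h6 nac
    have k1 := key a b c d h1 h3 h6 h7 nac nbd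
    have k2 := key b c d e h2 h4 h7 h8 nbd nce
    have k3 := key c d e a h3 h5 h8 h9 nce nda
    have k4 := key d e a b h4 h1 h9 h10 nda neb
    have k5 := key e a b c h5 h2 h10 h6 neb nac
    generalize G.dg a = a' at *
    generalize G.dg b = b' at *
    generalize G.dg c = c' at *
    generalize G.dg d = d' at *
    generalize G.dg e = e' at *
    omega
  let F : Finset (Finset V) := Finset.univ.filter fun K => ∀ v ∈ K, ∀ w ∈ K, v ≠ w → G.Adj v w
  obtain ⟨K0, hK0, hmax0⟩ := F.exists_max_image Finset.card ⟨∅, by simp [F]⟩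
  -- Among cliques of maximum size, a largest degree sum means fewest edges outside the clique.
  obtain ⟨K, hK, hmax⟩ := (F.filter fun K => K.card = K0.card).exists_max_image
    (fun K => ∑ v ∈ K, G.dg v) ⟨K0, by simp [hK0]⟩
  simp only [F, Finset.mem_filter, Finset.mem_univ, true_and] at hK hmax hmax0
  obtain ⟨hK, hKc⟩ := hK
  refine ⟨K, hK, ?_⟩
  have hne : ∀ x ∉ K, ∃ z ∈ K, ¬ G.Adj x z := by
    intro x hx
    by_contra hcon
    push Not at hcon
    have := hmax0 (insert x K) (by
      intro v hv w hw hvw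
      rw [Finset.mem_insert] at hv hw
      rcases hv with rfl | hv <;> rcases hw with rfl | hw
      · exact absurd rfl hvw
      · exact hcon w hw
      · exact (hcon v hv).symm
      · exact hK v hv w hw hvw)
    rw [Finset.card_insert_of_notMem hx] at this
    omega
  have main : ∀ x ∉ K, ∀ y ∉ K, G.Adj x y → (∀ z ∈ K, ¬ G.Adj x z → ¬ G.Adj y z) → False := by
    intro x hx y hy hxy hnest
    obtain ⟨z, hz, hxz⟩ := hne x hx
    have hyz := hnest z hz hxz
    have hxn : ∀ w ∈ K, x ≠ w := fun w hw e => hx (e ▸ hw)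
    have hyn : ∀ w ∈ K, y ≠ w := fun w hw e => hy (e ▸ hw)
    have hxK : ∀ w ∈ K, w ≠ z → G.Adj x w := by
      intro w hw hwz
      by_contra hn
      exact no2K2 x y z w hxy (hK z hz w hw hwz.symm) hxz hn hyz (hnest w hw hn) (hxn z hz)
        (hxn w hw) (hyn z hz) (hyn w hw)
    have hxe : x ∉ K.erase z := fun h => hx (Finset.mem_of_mem_erase h)
    have hcard : (insert x (K.erase z)).card = K0.card := by
      rw [Finset.card_insert_of_notMem hxe, Finset.card_erase_add_one hz, hKc]
    have hle := hmax (insert x (K.erase z)) ⟨by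
      intro v hv w hw hvw
      rw [Finset.mem_insert, Finset.mem_erase] at hv hw
      rcases hv with rfl | hv <;> rcases hw with rfl | hw
      · exact absurd rfl hvw
      · exact hxK w hw.2 hw.1
      · exact (hxK v hv.2 hv.1).symm
      · exact hK v hv.2 w hw.2 hvw, hcard⟩
    rw [Finset.sum_insert hxe, ← Finset.add_sum_erase K _ hz] at hle
    have hc := G.card_priv x z
    have hpos : 0 < (G.priv x z).card :=
      Finset.card_pos.2 ⟨y, mem_priv.2 ⟨hxy, fun e => hyz e.symm, hyn z hz⟩⟩
    obtain ⟨u, hu⟩ : (G.priv z x).Nonempty := Finset.card_pos.1 (by omega)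
    obtain ⟨hzu, hxu, hux⟩ := mem_priv.1 hu
    have huK : u ∉ K := fun h => hxu (hxK u h hzu.ne')
    have huy : u ≠ y := fun e => hyz (e ▸ hzu.symm)
    have hyu : G.Adj y u := by
      by_contra hn
      exact no2K2 x y z u hxy hzu hxz hxu hyz hn (hxn z hz) hux.symm (hyn z hz) huy.symm
    have hun : ∀ w ∈ K, u ≠ w := fun w hw e => huK (e ▸ hw)
    -- Replacing `z` in `K` by the two adjacent vertices `y` and `u` will give a larger clique; any
    -- missing edge to `w` closes an induced `C₄` or `C₅`.
    have hK2 : ∀ w ∈ K, w ≠ z → G.Adj y w ∧ G.Adj u w := by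
      intro w hw hwz
      have h1 := hxK w hw hwz
      have h2 := hK z hz w hw hwz.symm
      by_cases c1 : G.Adj y w <;> by_cases c2 : G.Adj u w
      · exact ⟨c1, c2⟩
      · exact (noC4 y u z w hyu hzu.symm h2 c1.symm hyz c2 (hyn z hz) (hun w hw)).elim
      · exact (noC4 x y u w hxy hyu c2 h1.symm hxu c1 hux.symm (hyn w hw)).elim
      · exact (noC5 x y u z w hxy hyu hzu.symm h2 h1.symm hxu hyz c2 (fun e => hxz e.symm)
          (fun e => c1 e.symm)).elim
    have hye : y ∉ K.erase z := fun h => hy (Finset.mem_of_mem_erase h)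
    have hue : u ∉ insert y (K.erase z) := by
      rw [Finset.mem_insert, not_or]
      exact ⟨huy, fun h => huK (Finset.mem_of_mem_erase h)⟩
    have hbig := hmax0 (insert u (insert y (K.erase z))) (by
      intro v hv w hw hvw
      rw [Finset.mem_insert, Finset.mem_insert, Finset.mem_erase] at hv hw
      rcases hv with rfl | rfl | hv <;> rcases hw with rfl | rfl | hw
      · exact absurd rfl hvw
      · exact hyu.symm
      · exact (hK2 w hw.2 hw.1).2
      · exact hyu
      · exact absurd rfl hvw
      · exact (hK2 w hw.2 hw.1).1
      · exact (hK2 v hv.2 hv.1).2.symm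
      · exact (hK2 v hv.2 hv.1).1.symm
      · exact hK v hv.2 w hw.2 hvw)
    rw [Finset.card_insert_of_notMem hue, Finset.card_insert_of_notMem hye,
      Finset.card_erase_add_one hz] at hbig
    omega
  intro x hx y hy hxy
  by_cases h1 : ∀ z ∈ K, ¬ G.Adj x z → ¬ G.Adj y z
  · exact main x hx y hy hxy h1
  by_cases h2 : ∀ z ∈ K, ¬ G.Adj y z → ¬ G.Adj x z
  · exact main y hy x hx hxy.symm h2
  push Not at h1 h2
  obtain ⟨z, hz, hxz, hyz⟩ := h1
  obtain ⟨w, hw, hyw, hxw⟩ := h2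
  exact noC4 x y z w hxy hyz (hK z hz w hw fun e => hxz (e ▸ hxw)) hxw.symm hxz hyw
    (fun e => hx (e ▸ hz)) (fun e => hy (e ▸ hw))

/-- In an indecomposable nonsplit unigraph all but at most one vertex have the same degree, and
this degree is at most `2` or at least the order minus `3`. -/
theorem IsUni.exists_near_regular {G : SimpleGraph V} (hG : G.IsUni) (hS : ¬ G.SetDecomp)
    (hK : ¬ ∃ K : Finset V, (∀ v ∈ K, ∀ w ∈ K, v ≠ w → G.Adj v w) ∧
      ∀ v ∉ K, ∀ w ∉ K, ¬ G.Adj v w) :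
    ∃ b δ, (∀ v, v ≠ b → G.dg v = δ) ∧ (δ ≤ 2 ∨ Fintype.card V ≤ δ + 3) := by
  have hmix : ∃ d d' e e', G.dg d' = G.dg d ∧ G.dg e = G.dg d ∧ G.dg e' = G.dg d ∧ G.Adj d d' ∧
      e ≠ e' ∧ ¬ G.Adj e e' := by
    by_contra hcon
    push Not at hcon
    exact hK (hG.exists_split hcon)
  obtain ⟨d, d', e, e', h1, h2, h3, h4, h5, h6⟩ := hmix
  obtain ⟨b, hb⟩ := hG.exists_exception hS rfl h1 h4 h2 h3 h6 h5
  refine ⟨b, G.dg d, hb, hG.le_two_or hb ?_ ?_⟩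
  · by_contra hcon
    push Not at hcon
    -- An isolated `b` alone is the left part of a decomposition, and likewise a dominating `b`
    -- below.
    refine hS ⟨∅, {b}, {b}ᶜ, fun v => ?_, by simp, by simp, by simp, by simp,
      fun v hv w _ => ?_, by simp, fun v hv w _ => ?_, by simp, ?_⟩
    · by_cases hv : v = b <;> simp [hv]
    · rw [Set.mem_singleton_iff.1 hv]; exact hcon w
    · rw [Set.mem_singleton_iff.1 hv]; exact hcon w
    · by_cases hd : d = b
      · exact ⟨d', fun e => h4.ne (hd.trans (Set.mem_singleton_iff.1 e).symm)⟩
      · exact ⟨d, hd⟩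
  · by_contra hcon
    push Not at hcon
    refine hS ⟨{b}, ∅, {b}ᶜ, fun v => ?_, by simp, by simp, by simp, by simp,
      by simp, fun v hv w hw => ?_, by simp, by simp, ?_⟩
    · by_cases hv : v = b <;> simp [hv]
    · rw [Set.mem_singleton_iff.1 hv]; exact hcon w hw
    · by_cases hd : d = b
      · exact ⟨d', fun e => h4.ne (hd.trans (Set.mem_singleton_iff.1 e).symm)⟩
      · exact ⟨d, hd⟩

end

end SimpleGraph

/-! ### Bipartite relations determined by their row and column sums. -/

open scoped Classical in
/-- A finite bipartite relation determined up to isomorphism by its row and column sums. -/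
def BiUni {A B : Type u} [Fintype A] [Fintype B] (E : A → B → Prop) : Prop :=
  ∀ E' : A → B → Prop,
    (∀ a, (Finset.univ.filter (E' a)).card = (Finset.univ.filter (E a)).card) →
    (∀ b, (Finset.univ.filter fun a => E' a b).card = (Finset.univ.filter fun a => E a b).card) →
    ∃ (σ : Equiv.Perm A) (τ : Equiv.Perm B), ∀ a b, E' (σ a) (τ b) ↔ E a b

section
open scoped Classical

theorem BiUni.of_isEmpty {A B : Type u} [Fintype A] [Fintype B] (E : A → B → Prop)
    (h : IsEmpty A ∨ IsEmpty B) : BiUni E := by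
  intro E' _ _
  refine ⟨Equiv.refl A, Equiv.refl B, fun a b => ?_⟩
  rcases h with h | h
  exacts [h.elim a, h.elim b]

theorem card_filter_not {A : Type u} [Fintype A] (p : A → Prop) [DecidablePred p]
    [DecidablePred fun a => ¬ p a] :
    (Finset.univ.filter fun a => ¬ p a).card = Fintype.card A - (Finset.univ.filter p).card := by
  have := Finset.card_filter_add_card_filter_not (s := (Finset.univ : Finset A)) p
  rw [Finset.card_univ] at this
  omega

/-- Complementing a split graph complements the relation between the parts and exchanges their
roles. -/
theorem BiUni.dual {A B : Type u} [Fintype A] [Fintype B] {E : A → B → Prop} (h : BiUni E) :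
    BiUni fun b a => ¬ E a b := by
  intro E' h1 h2
  obtain ⟨σ, τ, hστ⟩ := h (fun a b => ¬ E' b a) (fun a => by
    have h3 := h2 a
    rw [card_filter_not] at h3
    rw [card_filter_not, h3, ← card_filter_not, ← card_filter_not]
    simp) (fun b => by
    have h3 := h1 b
    rw [card_filter_not] at h3
    rw [card_filter_not, h3, ← card_filter_not, ← card_filter_not]
    simp)
  exact ⟨τ, σ, fun b a => by
    change _ ↔ ¬ E a b
    rw [← hστ, not_not]⟩

/-- The relation between a pair and a set in which one element of the pair is related to a single
element of the set, and the other one to all others, is determined by its row and column sums. -/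
theorem BiUni.of_pair {A B : Type u} [Fintype A] [Fintype B] {a0 a1 : A} (h01 : a0 ≠ a1)
    (hA : ∀ a, a = a0 ∨ a = a1) (b1 : B) : BiUni fun a b => (a = a1 ↔ b = b1) := by
  intro E' h1 h2
  have hrow : (Finset.univ.filter (E' a1)).card = 1 := by
    rw [h1, Finset.card_eq_one]
    exact ⟨b1, by ext b; simp⟩
  obtain ⟨b2, hb2⟩ := Finset.card_eq_one.1 hrow
  have hE1 : ∀ b, E' a1 b ↔ b = b2 := fun b => by
    have : b ∈ Finset.univ.filter (E' a1) ↔ b ∈ ({b2} : Finset B) := by rw [hb2]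
    simpa using this
  have hcol : ∀ b, (Finset.univ.filter fun a => E' a b).card = 1 := by
    intro b
    rw [h2, Finset.card_eq_one]
    by_cases hb : b = b1
    · exact ⟨a1, by ext a; simp [hb]⟩
    · refine ⟨a0, ?_⟩
      ext a
      rcases hA a with rfl | rfl
      · simp [hb, h01]
      · simp [hb, h01.symm]
  have hE0 : ∀ b, E' a0 b ↔ ¬ E' a1 b := by
    intro b
    obtain ⟨a, ha⟩ := Finset.card_eq_one.1 (hcol b)
    have hm : ∀ c, E' c b ↔ c = a := fun c => by
      have : c ∈ Finset.univ.filter (fun a => E' a b) ↔ c ∈ ({a} : Finset A) := by rw [ha]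
      simpa using this
    rw [hm, hm]
    rcases hA a with rfl | rfl
    · simp [h01.symm]
    · simp [h01]
  refine ⟨Equiv.refl A, Equiv.swap b1 b2, fun a b => ?_⟩
  have hs : Equiv.swap b1 b2 b = b2 ↔ b = b1 := by
    rw [Equiv.swap_apply_eq_iff, Equiv.swap_apply_right]
  rcases hA a with rfl | rfl
  · simp [hE0, hE1, hs, h01]
  · simp [hE1, hs]

end

/-! ### Restricting a unigraph to degree classes. -/

namespace SimpleGraph

section
open scoped Classical

variable {V : Type u} [Fintype V]

theorem card_filter_subtype {q : V → Prop} (r : V → Prop) :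
    (Finset.univ.filter fun b : {w // q w} => r b).card =
      ((Finset.univ.filter r).filter q).card := by
  rw [← Finset.card_map (Function.Embedding.subtype q)]
  congr 1
  ext w
  simp only [Finset.mem_map, Finset.mem_filter, Finset.mem_univ, true_and,
    Function.Embedding.subtype_apply, Subtype.exists, exists_and_right, exists_eq_right]
  tauto

theorem dg_comap_val (G : SimpleGraph V) (q : V → Prop) (v : {w // q w}) :
    (G.comap (Subtype.val : {w // q w} → V)).dg v = ((G.nb v).filter q).card := by
  rw [nb, ← card_filter_subtype]
  rfl

theorem dg_eq_of_filter {G G' : SimpleGraph V} {q : V → Prop} {v : V}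
    (h1 : ((G'.nb v).filter q).card = ((G.nb v).filter q).card)
    (h2 : ∀ w, ¬ q w → (G'.Adj v w ↔ G.Adj v w)) : G'.dg v = G.dg v := by
  rw [dg, dg, ← Finset.card_filter_add_card_filter_not (s := G'.nb v) q,
    ← Finset.card_filter_add_card_filter_not (s := G.nb v) q, h1]
  congr 2
  ext w
  simp only [Finset.mem_filter, mem_nb]
  have := h2 w
  tauto

/-- A union of degree classes of a unigraph induces a unigraph. -/
theorem IsUni.induce {G : SimpleGraph V} (hG : G.IsUni) (p : ℕ → Prop) :
    (G.comap (Subtype.val : {w // p (G.dg w)} → V)).IsUni := by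
  intro H hH
  -- Replacing the graph induced on the union of classes by `H` keeps all degrees. An isomorphism
  -- from `G` to the result preserves degrees, hence the union, and restricts to an isomorphism onto
  -- `H`.
  let G' : SimpleGraph V :=
    { Adj := fun a b => (∃ h h', H.Adj ⟨a, h⟩ ⟨b, h'⟩) ∨
        (¬ (p (G.dg a) ∧ p (G.dg b)) ∧ G.Adj a b)
      symm := ⟨by
        rintro a b (⟨h, h', e⟩ | ⟨h, e⟩)
        · exact Or.inl ⟨h', h, e.symm⟩
        · exact Or.inr ⟨fun k => h ⟨k.2, k.1⟩, e.symm⟩⟩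
      loopless := ⟨by
        rintro a (⟨h, h', e⟩ | ⟨h, e⟩)
        · exact H.irrefl e
        · exact G.irrefl e⟩ }
  have hin : ∀ a b : {w // p (G.dg w)}, G'.Adj a b ↔ H.Adj a b := by
    intro a b
    change (_ ∨ _) ↔ _
    simp [a.2, b.2]
  have hout : ∀ a b, ¬ (p (G.dg a) ∧ p (G.dg b)) → (G'.Adj a b ↔ G.Adj a b) := by
    intro a b hab
    change (_ ∨ _) ↔ _
    constructor
    · rintro (⟨h, h', -⟩ | h)
      · exact absurd ⟨h, h'⟩ hab
      · exact h.2
    · exact fun h => Or.inr ⟨hab, h⟩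
  have hd : ∀ v, G'.dg v = G.dg v := by
    intro v
    by_cases hv : p (G.dg v)
    · refine dg_eq_of_filter (q := fun w => p (G.dg w)) ?_ fun w hw => hout v w fun h => hw h.2
      rw [← dg_comap_val G (fun w => p (G.dg w)) ⟨v, hv⟩, ← hH ⟨v, hv⟩,
        ← dg_comap_val G' (fun w => p (G.dg w)) ⟨v, hv⟩]
      congr 1
      ext a b
      exact hin a b
    · unfold dg
      congr 1
      ext w
      rw [mem_nb, mem_nb]
      exact hout v w fun h => hv h.1
  obtain ⟨φ⟩ := hG G' hd
  have hφ : ∀ v, G.dg (φ v) = G.dg v := fun v => by rw [← hd, dg_iso]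
  refine ⟨⟨φ.toEquiv.subtypeEquiv fun v => ?_, ?_⟩⟩
  · change _ ↔ p (G.dg (φ v))
    rw [hφ]
  · intro a b
    rw [← hin]
    exact φ.map_rel_iff

/-- In a unigraph, the bipartite graph between two disjoint unions of degree classes is determined
by its row and column sums. -/
theorem IsUni.biUni {G : SimpleGraph V} (hG : G.IsUni) (p q : ℕ → Prop)
    (hpq : ∀ n, p n → ¬ q n) :
    BiUni fun (a : {w // p (G.dg w)}) (b : {w // q (G.dg w)}) => G.Adj a b := by
  intro E h1 h2
  -- Only the edges between the two unions of classes are replaced, by those of `E`; the margins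
  -- being equal, all degrees survive.
  let G' : SimpleGraph V :=
    { Adj := fun a b => (∃ h h', E ⟨a, h⟩ ⟨b, h'⟩) ∨ (∃ h h', E ⟨b, h⟩ ⟨a, h'⟩) ∨
        (¬ (p (G.dg a) ∧ q (G.dg b)) ∧ ¬ (p (G.dg b) ∧ q (G.dg a)) ∧ G.Adj a b)
      symm := ⟨by
        rintro a b (e | e | ⟨h, h', e⟩)
        · exact Or.inr (Or.inl e)
        · exact Or.inl e
        · exact Or.inr (Or.inr ⟨h', h, e.symm⟩)⟩
      loopless := ⟨by
        rintro a (⟨h, h', e⟩ | ⟨h, h', e⟩ | ⟨h, h', e⟩)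
        · exact hpq _ h h'
        · exact hpq _ h h'
        · exact G.irrefl e⟩ }
  have hin : ∀ (a : {w // p (G.dg w)}) (b : {w // q (G.dg w)}), G'.Adj a b ↔ E a b := by
    intro a b
    change (_ ∨ _ ∨ _) ↔ _
    have h3 := hpq _ a.2
    simp [a.2, b.2, h3]
  have hout : ∀ a b, ¬ (p (G.dg a) ∧ q (G.dg b)) → ¬ (p (G.dg b) ∧ q (G.dg a)) →
      (G'.Adj a b ↔ G.Adj a b) := by
    intro a b hab hba
    change (_ ∨ _ ∨ _) ↔ _
    constructor
    · rintro (⟨h, h', -⟩ | ⟨h, h', -⟩ | h)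
      · exact absurd ⟨h, h'⟩ hab
      · exact absurd ⟨h, h'⟩ hba
      · exact h.2.2
    · exact fun h => Or.inr (Or.inr ⟨hab, hba, h⟩)
  have hd : ∀ v, G'.dg v = G.dg v := by
    intro v
    by_cases hv : p (G.dg v)
    · refine dg_eq_of_filter (q := fun w => q (G.dg w)) ?_ fun w hw =>
        hout v w (fun h => hw h.2) fun h => hpq _ hv h.2
      rw [nb, nb, ← card_filter_subtype, ← card_filter_subtype]
      refine Eq.trans ?_ (h1 ⟨v, hv⟩)
      congr 1
      ext b
      simp only [Finset.mem_filter, Finset.mem_univ, true_and]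
      exact hin ⟨v, hv⟩ b
    by_cases hv' : q (G.dg v)
    · refine dg_eq_of_filter (q := fun w => p (G.dg w)) ?_ fun w hw =>
        hout v w (fun h => hv h.1) fun h => hw h.1
      rw [nb, nb, ← card_filter_subtype, ← card_filter_subtype]
      have := h2 ⟨v, hv'⟩
      simp only [← hin, G'.adj_comm _ v, G.adj_comm _ v] at this
      convert this
    · unfold dg
      congr 1
      ext w
      rw [mem_nb, mem_nb]
      exact hout v w (fun h => hv h.1) fun h => hv' h.2
  obtain ⟨φ⟩ := hG G' hd
  have hφ : ∀ v, G.dg (φ v) = G.dg v := fun v => by rw [← hd, dg_iso]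
  refine ⟨φ.toEquiv.subtypeEquiv fun v => ?_, φ.toEquiv.subtypeEquiv fun v => ?_, fun a b => ?_⟩
  · change _ ↔ p (G.dg (φ v))
    rw [hφ]
  · change _ ↔ q (G.dg (φ v))
    rw [hφ]
  · rw [← hin]
    exact φ.map_rel_iff

end

end SimpleGraph

/-! ### Indecomposable split graphs inside unigraphs. -/

namespace SimpleGraph

section
open scoped Classical

variable {X : Type u}

/-- A `KS`-partition in which every vertex has a neighbour and a non-neighbour in the other part. -/
structure KSIrr (C : SimpleGraph X) (K S : Set X) : Prop where
  cov : ∀ v, v ∈ K ∨ v ∈ S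
  disj : ∀ v ∈ K, v ∉ S
  clique : ∀ v ∈ K, ∀ w ∈ K, v ≠ w → C.Adj v w
  stable : ∀ v ∈ S, ∀ w ∈ S, ¬ C.Adj v w
  nbrK : ∀ k ∈ K, ∃ s ∈ S, C.Adj k s
  nonK : ∀ k ∈ K, ∃ s ∈ S, ¬ C.Adj k s
  nbrS : ∀ s ∈ S, ∃ k ∈ K, C.Adj k s
  nonS : ∀ s ∈ S, ∃ k ∈ K, ¬ C.Adj k s

theorem KSIrr.compl {C : SimpleGraph X} {K S : Set X} (h : C.KSIrr K S) : Cᶜ.KSIrr S K where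
  cov v := (h.cov v).symm
  disj v hv hk := h.disj v hk hv
  clique v hv w hw hvw := ⟨hvw, h.stable v hv w hw⟩
  stable v hv w hw e := e.2 (h.clique v hv w hw e.1)
  nbrK s hs := by
    obtain ⟨k, hk, e⟩ := h.nonS s hs
    exact ⟨k, hk, fun e' => h.disj k hk (e' ▸ hs), fun e' => e e'.symm⟩
  nonK s hs := by
    obtain ⟨k, hk, e⟩ := h.nbrS s hs
    exact ⟨k, hk, fun e' => e'.2 e.symm⟩
  nbrS k hk := by
    obtain ⟨s, hs, e⟩ := h.nonK k hk
    exact ⟨s, hs, fun e' => h.disj k hk (e' ▸ hs), fun e' => e e'.symm⟩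
  nonS k hk := by
    obtain ⟨s, hs, e⟩ := h.nbrK k hk
    exact ⟨s, hs, fun e' => e'.2 e.symm⟩

/-- A decomposition of `C` compatible with the `KS`-partition `K ∪ S`. -/
def KSSplit (C : SimpleGraph X) (K S : Set X) : Prop :=
  ∃ P Q : Set X, P ⊆ K ∧ Q ⊆ S ∧ (∀ v ∈ P, ∀ w, w ∉ P → w ∉ Q → C.Adj v w) ∧
    (∀ v ∈ Q, ∀ w, w ∉ P → w ∉ Q → ¬ C.Adj v w) ∧ (∃ v, v ∈ P ∨ v ∈ Q) ∧ ∃ v, v ∉ P ∧ v ∉ Q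

theorem KSSplit.compl {C : SimpleGraph X} {K S : Set X} (h : C.KSSplit K S) : Cᶜ.KSSplit S K := by
  obtain ⟨P, Q, h1, h2, h3, h4, ⟨v, hv⟩, w, hw⟩ := h
  exact ⟨Q, P, h2, h1, fun v hv w hw hw' => ⟨fun e => hw (e ▸ hv), h4 v hv w hw' hw⟩,
    fun v hv w hw hw' e => e.2 (h3 v hv w hw' hw), ⟨v, hv.symm⟩, w, hw.symm⟩

theorem KSSplit.setDecomp {C : SimpleGraph X} {K S : Set X} (disj : ∀ v ∈ K, v ∉ S)
    (clique : ∀ v ∈ K, ∀ w ∈ K, v ≠ w → C.Adj v w) (stable : ∀ v ∈ S, ∀ w ∈ S, ¬ C.Adj v w)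
    (h : C.KSSplit K S) : C.SetDecomp := by
  obtain ⟨P, Q, h1, h2, h3, h4, ⟨v, hv⟩, w, hw⟩ := h
  refine ⟨P, Q, {w | w ∉ P ∧ w ∉ Q}, fun v => ?_, fun v hv hv' => disj v (h1 hv) (h2 hv'),
    fun v hv hv' => hv'.1 hv, fun v hv hv' => hv'.2 hv,
    fun v hv w hw => clique v (h1 hv) w (h1 hw), fun v hv w hw => stable v (h2 hv) w (h2 hw),
    fun v hv w hw => h3 v hv w hw.1 hw.2, fun v hv w hw => h4 v hv w hw.1 hw.2, ⟨v, hv⟩, w, hw⟩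
  rw [Set.mem_ofPred_eq]
  tauto

/-- A vertex of `K` adjacent to all of `S` can be split off as a left part; one with no neighbour in
`S` can be left as the right part. Complementation handles `S`. -/
theorem KSIrr.of_not_ksSplit [Nontrivial X] {C : SimpleGraph X} {K S : Set X}
    (cov : ∀ v, v ∈ K ∨ v ∈ S) (disj : ∀ v ∈ K, v ∉ S)
    (clique : ∀ v ∈ K, ∀ w ∈ K, v ≠ w → C.Adj v w) (stable : ∀ v ∈ S, ∀ w ∈ S, ¬ C.Adj v w)
    (h : ¬ C.KSSplit K S) : C.KSIrr K S := by
  have key : ∀ (C : SimpleGraph X) (K S : Set X), (∀ v, v ∈ K ∨ v ∈ S) →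
      (∀ v ∈ K, v ∉ S) → (∀ v ∈ K, ∀ w ∈ K, v ≠ w → C.Adj v w) → ¬ C.KSSplit K S →
      (∀ k ∈ K, ∃ s ∈ S, C.Adj k s) ∧ ∀ k ∈ K, ∃ s ∈ S, ¬ C.Adj k s := by
    intro C K S cov disj clique h
    refine ⟨fun k hk => ?_, fun k hk => ?_⟩
    · by_contra hcon
      push Not at hcon
      have hw : ∀ w, w ∉ K \ {k} → w ∉ S → w = k := by
        intro w h1 h2
        by_contra e
        exact (cov w).elim (fun hv => h1 ⟨hv, e⟩) h2
      refine h ⟨K \ {k}, S, fun v hv => hv.1, fun v => id, fun v hv w h1 h2 => ?_,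
        fun v hv w h1 h2 e => ?_, ?_, k, fun e => e.2 rfl, fun hk' => ?_⟩
      · rw [hw w h1 h2]; exact clique v hv.1 k hk hv.2
      · rw [hw w h1 h2] at e; exact hcon v hv e.symm
      · obtain ⟨v, hv⟩ := exists_ne k
        exact ⟨v, (cov v).elim (fun h => Or.inl ⟨h, hv⟩) Or.inr⟩
      · exact disj k hk hk'
    · by_contra hcon
      push Not at hcon
      refine h ⟨{k}, ∅, by simpa using hk, by simp, fun v hv w hw _ => ?_, by simp, ⟨k, by simp⟩, ?_⟩
      · rw [Set.mem_singleton_iff.1 hv]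
        exact (cov w).elim (fun hw' => clique k hk w hw' (Ne.symm hw)) fun hw' => hcon w hw'
      · obtain ⟨v, hv⟩ := exists_ne k
        exact ⟨v, by simpa using hv⟩
  obtain ⟨h1, h2⟩ := key C K S cov disj clique h
  obtain ⟨h3, h4⟩ := key Cᶜ S K (fun v => (cov v).symm) (fun v hv hk => disj v hk hv)
    (fun v hv w hw hvw => ⟨hvw, stable v hv w hw⟩) (fun e => h (by simpa using e.compl))
  refine ⟨cov, disj, clique, stable, h1, h2, fun s hs => ?_, fun s hs => ?_⟩
  · obtain ⟨k, hk, e⟩ := h4 s hs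
    refine ⟨k, hk, ?_⟩
    by_contra hn
    exact e ⟨fun e' => disj k hk (e' ▸ hs), fun e' => hn e'.symm⟩
  · obtain ⟨k, hk, e⟩ := h3 s hs
    exact ⟨k, hk, fun e' => e.2 e'.symm⟩

/-- Every decomposition is compatible with a `KS`-partition in which every vertex has a neighbour
and a non-neighbour in the other part. -/
theorem KSIrr.ksSplit {C : SimpleGraph X} {K S : Set X} (h : C.KSIrr K S) (hd : C.SetDecomp) :
    C.KSSplit K S := by
  have key : ∀ (C : SimpleGraph X) (K S : Set X), C.KSIrr K S → ∀ P Q R : Set X,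
      (∀ v, v ∈ P ∨ v ∈ Q ∨ v ∈ R) → (∀ v ∈ P, ∀ w ∈ P, v ≠ w → C.Adj v w) →
      (∀ v ∈ P, ∀ w ∈ R, C.Adj v w) → (∀ v ∈ Q, ∀ w ∈ R, ¬ C.Adj v w) → R.Nonempty → P ⊆ K := by
    intro C K S h P Q R h1 h5 h7 h8 ⟨w, hw⟩ v hv
    by_contra hvK
    have hvS := (h.cov v).resolve_left hvK
    have hwK : w ∈ K := (h.cov w).resolve_right fun hwS => h.stable v hvS w hwS (h7 v hv w hw)
    obtain ⟨k, hk, hn⟩ := h.nonS v hvS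
    have hkv : k ≠ v := fun e => h.disj k hk (e ▸ hvS)
    rcases h1 k with hk' | hk' | hk'
    · exact hn (h5 k hk' v hv hkv)
    · refine h8 k hk' w hw (h.clique k hk w hwK ?_)
      rintro rfl
      exact hn (h7 v hv k hw).symm
    · exact hn (h7 v hv k hk').symm
  obtain ⟨P, Q, R, h1, h2, h3, h4, h5, h6, h7, h8, ⟨v, hv⟩, w, hw⟩ := hd
  have hR : ∀ w, w ∉ P → w ∉ Q → w ∈ R := fun w hP hQ =>
    ((h1 w).resolve_left hP).resolve_left hQ
  refine ⟨P, Q, key C K S h P Q R h1 h5 h7 h8 ⟨w, hw⟩,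
    key Cᶜ S K h.compl Q P R (fun v => ?_) (fun v hv w hw hvw => ⟨hvw, h6 v hv w hw⟩)
      (fun v hv w hw => ⟨fun e => h4 v hv (e ▸ hw), h8 v hv w hw⟩)
      (fun v hv w hw e => e.2 (h7 v hv w hw)) ⟨w, hw⟩,
    fun v hv w hP hQ => h7 v hv w (hR w hP hQ), fun v hv w hP hQ => h8 v hv w (hR w hP hQ),
    ⟨v, hv⟩, w, fun e => h3 w e hw, fun e => h4 w e hw⟩
  have := h1 v
  tauto

/-- The adjacencies between `K` and `S` embed in a bipartite relation which is determined by its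
row and column sums. -/
def KSEmb (C : SimpleGraph X) (K S : Set X) : Prop :=
  ∃ (A B : Type u) (_ : Fintype A) (_ : Fintype B) (E : A → B → Prop), BiUni E ∧
    ∃ (f : K → A) (g : S → B), f.Injective ∧ g.Injective ∧ ∀ (k : K) (s : S), C.Adj k s ↔ E (f k) (g s)

theorem KSEmb.of_compl {C : SimpleGraph X} {K S : Set X} (hd : ∀ v ∈ K, v ∉ S)
    (h : Cᶜ.KSEmb S K) : C.KSEmb K S := by
  obtain ⟨A, B, _, _, E, hE, f, g, hf, hg, he⟩ := h
  refine ⟨B, A, _, _, _, hE.dual, g, f, hg, hf, fun k s => ?_⟩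
  rw [← he, compl_adj, C.adj_comm]
  have : (s : X) ≠ k := fun e => hd k k.2 (e ▸ s.2)
  tauto

variable {W : Type u} [Fintype W]

theorem IsUni.ksEmb_of_dg_ne {C : SimpleGraph X} {K S : Set X} {U : SimpleGraph W} (hU : U.IsUni)
    (e : C ↪g U) (h : ∀ k ∈ K, ∀ s ∈ S, U.dg (e k) ≠ U.dg (e s)) : C.KSEmb K S := by
  refine ⟨_, _, _, _, _, hU.biUni (fun n => ∃ k ∈ K, U.dg (e k) = n)
    (fun n => ∃ s ∈ S, U.dg (e s) = n) ?_, fun k => ⟨e k, k, k.2, rfl⟩, fun s => ⟨e s, s, s.2, rfl⟩,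
    fun k k' hk => ?_, fun k k' hk => ?_, fun k s => ?_⟩
  · rintro n ⟨k, hk, rfl⟩ ⟨s, hs, h'⟩
    exact h k hk s hs h'.symm
  · exact Subtype.ext (e.injective (Subtype.ext_iff.1 hk))
  · exact Subtype.ext (e.injective (Subtype.ext_iff.1 hk))
  · exact e.map_rel_iff.symm

/-- The neighbours and non-neighbours across the parts force `K` into `P` and `S` into `Q`. A vertex
of `K` then has degree at least `|P|`, thanks to a neighbour in `S`. One of `S` has degree less than
`|P|`, because it misses a vertex of `K`. -/
theorem KSIrr.dg_ne {C : SimpleGraph X} {K S : Set X} (h : C.KSIrr K S) {U : SimpleGraph W}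
    (e : C ↪g U) {P Q R : Set W} (h1 : ∀ v, v ∈ P ∨ v ∈ Q ∨ v ∈ R) (h2 : ∀ v ∈ P, v ∉ Q)
    (h5 : ∀ v ∈ P, ∀ w ∈ P, v ≠ w → U.Adj v w) (h6 : ∀ v ∈ Q, ∀ w ∈ Q, ¬ U.Adj v w)
    (h8 : ∀ v ∈ Q, ∀ w ∈ R, ¬ U.Adj v w) (hR : ∀ c, e c ∉ R) :
    ∀ k ∈ K, ∀ s ∈ S, U.dg (e k) ≠ U.dg (e s) := by
  have ea : ∀ a b, U.Adj (e a) (e b) ↔ C.Adj a b := fun a b => e.map_rel_iff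
  have hPQ : ∀ c, e c ∈ P ∨ e c ∈ Q := fun c => by
    have := h1 (e c); have := hR c; tauto
  have hK : ∀ k ∈ K, e k ∈ P := by
    intro k hk
    by_contra hkP
    have hkQ := (hPQ k).resolve_left hkP
    obtain ⟨s, hs, hks⟩ := h.nbrK k hk
    have hsP : e s ∈ P := (hPQ s).resolve_right fun hq => h6 _ hkQ _ hq ((ea _ _).2 hks)
    obtain ⟨k', hk', hn⟩ := h.nonS s hs
    have hks' : k' ≠ s := fun e' => h.disj k' hk' (e' ▸ hs)
    have hkQ' : e k' ∈ Q := (hPQ k').resolve_left fun hp =>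
      hn ((ea _ _).1 (h5 _ hp _ hsP fun e' => hks' (e.injective e')))
    have hkk : k ≠ k' := fun e' => hn (e' ▸ hks)
    exact h6 _ hkQ _ hkQ' ((ea _ _).2 (h.clique k hk k' hk' hkk))
  have hS : ∀ s ∈ S, e s ∈ Q := by
    intro s hs
    obtain ⟨k, hk, hn⟩ := h.nonS s hs
    have hks : k ≠ s := fun e' => h.disj k hk (e' ▸ hs)
    exact (hPQ s).resolve_left fun hp =>
      hn ((ea _ _).1 (h5 _ (hK k hk) _ hp fun e' => hks (e.injective e')))
  intro k hk s hs heq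
  obtain ⟨s', hs', hks'⟩ := h.nbrK k hk
  obtain ⟨k', hk', hn⟩ := h.nonS s hs
  let PF : Finset W := Finset.univ.filter (· ∈ P)
  have hPF : ∀ w, w ∈ PF ↔ w ∈ P := fun w => by simp [PF]
  have c1 : insert (e s') (PF.erase (e k)) ⊆ U.nb (e k) := by
    intro w hw
    rw [Finset.mem_insert, Finset.mem_erase, hPF] at hw
    rw [mem_nb]
    rcases hw with rfl | hw
    · exact (ea _ _).2 hks'
    · exact h5 _ (hK k hk) _ hw.2 hw.1.symm
  have c2 : U.nb (e s) ⊆ PF.erase (e k') := by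
    intro w hw
    rw [mem_nb] at hw
    rw [Finset.mem_erase, hPF]
    refine ⟨?_, ?_⟩
    · rintro rfl
      exact hn ((ea _ _).1 hw).symm
    · rcases h1 w with h | h | h
      · exact h
      · exact absurd hw (h6 _ (hS s hs) _ h)
      · exact absurd hw (h8 _ (hS s hs) _ h)
  have d1 := Finset.card_le_card c1
  have d2 := Finset.card_le_card c2
  rw [Finset.card_insert_of_notMem fun e' => h2 _ ((hPF _).1 (Finset.mem_of_mem_erase e'))
    (hS s' hs'), Finset.card_erase_add_one ((hPF _).2 (hK k hk))] at d1
  rw [Finset.card_erase_of_mem ((hPF _).2 (hK k' hk'))] at d2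
  have := Finset.card_pos.2 ⟨_, (hPF _).2 (hK k hk)⟩
  rw [dg, dg] at heq
  omega

theorem KSIrr.not_dominating {C : SimpleGraph X} {K S : Set X} (h : C.KSIrr K S) (c : X) :
    ∃ c', c' ≠ c ∧ ¬ C.Adj c c' := by
  rcases h.cov c with hc | hc
  · obtain ⟨s, hs, hn⟩ := h.nonK c hc
    exact ⟨s, fun e => h.disj c hc (e ▸ hs), hn⟩
  · obtain ⟨k, hk, hn⟩ := h.nonS c hc
    exact ⟨k, fun e => h.disj k hk (e ▸ hc), fun e => hn e.symm⟩

theorem KSIrr.not_isolated {C : SimpleGraph X} {K S : Set X} (h : C.KSIrr K S) (c : X) :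
    ∃ c', C.Adj c c' := by
  rcases h.cov c with hc | hc
  · obtain ⟨s, hs, hn⟩ := h.nbrK c hc
    exact ⟨s, hn⟩
  · obtain ⟨k, hk, hn⟩ := h.nbrS c hc
    exact ⟨k, hn.symm⟩

/-- No vertex of `C` is dominating or isolated. So a vertex of `R` in the image has smaller degree
than every vertex of `P` and larger degree than every vertex of `Q`, and the degrees on the left
part would not occur on `C`. -/
theorem KSIrr.not_subset {C : SimpleGraph X} {K S : Set X} (h : C.KSIrr K S) {U : SimpleGraph W}
    (e : C ↪g U) {P Q R : Set W} (h1 : ∀ v, v ∈ P ∨ v ∈ Q ∨ v ∈ R) (h3 : ∀ v ∈ P, v ∉ R)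
    (h4 : ∀ v ∈ Q, v ∉ R) (h5 : ∀ v ∈ P, ∀ w ∈ P, v ≠ w → U.Adj v w)
    (h6 : ∀ v ∈ Q, ∀ w ∈ Q, ¬ U.Adj v w) (h7 : ∀ v ∈ P, ∀ w ∈ R, U.Adj v w)
    (h8 : ∀ v ∈ Q, ∀ w ∈ R, ¬ U.Adj v w) (hne : (P ∪ Q).Nonempty)
    (hfull : ∀ w, ∃ c, U.dg (e c) = U.dg w) : ¬ ∀ c, e c ∈ R := by
  intro hR
  have ea : ∀ a b, U.Adj (e a) (e b) ↔ C.Adj a b := fun a b => e.map_rel_iff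
  obtain ⟨v, hv⟩ := hne
  obtain ⟨c, hc⟩ := hfull v
  have hcR := hR c
  rcases hv with hv | hv
  · have c1 : (Finset.univ.filter fun w => w ∉ Q).erase v ⊆ U.nb v := by
      intro w hw
      rw [Finset.mem_erase, Finset.mem_filter] at hw
      rw [mem_nb]
      rcases h1 w with h | h | h
      · exact h5 v hv w h hw.1.symm
      · exact absurd h hw.2.2
      · exact h7 v hv w h
    obtain ⟨c', hcc, hn⟩ := h.not_dominating c
    have hQ : ∀ w ∈ R, w ∉ Q := fun w hw hq => h4 w hq hw
    have c2 : U.nb (e c) ⊆ ((Finset.univ.filter fun w => w ∉ Q).erase (e c)).erase (e c') := by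
      intro w hw
      rw [mem_nb] at hw
      rw [Finset.mem_erase, Finset.mem_erase, Finset.mem_filter]
      refine ⟨?_, hw.ne', Finset.mem_univ w, fun hq => h8 w hq _ hcR hw.symm⟩
      rintro rfl
      exact hn ((ea _ _).1 hw)
    have d1 := Finset.card_le_card c1
    have d2 := Finset.card_le_card c2
    have m1 : e c' ∈ (Finset.univ.filter fun w => w ∉ Q).erase (e c) := by
      rw [Finset.mem_erase, Finset.mem_filter]
      exact ⟨fun e' => hcc (e.injective e'), Finset.mem_univ _, hQ _ (hR c')⟩
    have m2 := Finset.card_pos.2 ⟨_, m1⟩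
    rw [Finset.card_erase_of_mem m1] at d2
    have m3 : e c ∈ Finset.univ.filter fun w => w ∉ Q := by simp [hQ _ hcR]
    rw [Finset.card_erase_of_mem m3] at d2 m2
    have d3 := Finset.pred_card_le_card_erase (s := Finset.univ.filter fun w => w ∉ Q) (a := v)
    rw [dg, dg] at hc
    omega
  · obtain ⟨F, hF⟩ : ∃ F : Finset W, F = Finset.univ.filter (· ∈ P) := ⟨_, rfl⟩
    have c1 : U.nb v ⊆ F := by
      intro w hw
      rw [mem_nb] at hw
      rw [hF, Finset.mem_filter]
      refine ⟨Finset.mem_univ w, ?_⟩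
      rcases h1 w with h | h | h
      · exact h
      · exact absurd hw (h6 v hv w h)
      · exact absurd hw (h8 v hv w h)
    obtain ⟨c', hcc⟩ := h.not_isolated c
    have c2 : insert (e c') F ⊆ U.nb (e c) := by
      intro w hw
      rw [hF, Finset.mem_insert, Finset.mem_filter] at hw
      rw [mem_nb]
      rcases hw with rfl | hw
      · exact (ea _ _).2 hcc
      · exact (h7 w hw.2 _ hcR).symm
    have d1 := Finset.card_le_card c1
    have d2 := Finset.card_le_card c2
    rw [Finset.card_insert_of_notMem fun e' =>
      h3 _ (Finset.mem_filter.1 (hF ▸ e')).2 (hR c')] at d2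
    rw [dg, dg] at hc
    omega

/-- A vertex `k1` of `K` not mapped to `b` has degree at most 2. It has a neighbour `s1` in `S` and
another vertex `k0` of `K` as neighbours, and no others. So `K = {k0, k1}`, and all of `S` except
`s1` hangs on `k0`, which is the relation of `BiUni.of_pair`. -/
theorem KSIrr.ksEmb_of_dg_le_two {C : SimpleGraph X} {K S : Set X} (h : C.KSIrr K S) [Nonempty X]
    {U : SimpleGraph W} (e : C ↪g U) {b : W} (hb : ∀ v, v ≠ b → U.dg v ≤ 2) : C.KSEmb K S := by
  have : Finite X := Finite.of_injective e e.injective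
  have := Fintype.ofFinite X
  have ea : ∀ a b, U.Adj (e a) (e b) ↔ C.Adj a b := fun a b => e.map_rel_iff
  have hpair : ∀ c x y z, e c ≠ b → C.Adj c x → C.Adj c y → C.Adj c z → x ≠ y → x ≠ z → y ≠ z →
      False := by
    intro c x y z hc hx hy hz hxy hxz hyz
    have h3 := hb (e c) hc
    have : 3 ≤ U.dg (e c) := by
      rw [← Finset.card_eq_three.2 ⟨e x, e y, e z, fun h => hxy (e.injective h),
        fun h => hxz (e.injective h), fun h => hyz (e.injective h), rfl⟩]
      refine Finset.card_le_card fun w hw => ?_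
      simp only [Finset.mem_insert, Finset.mem_singleton] at hw
      rw [mem_nb]
      rcases hw with rfl | rfl | rfl
      exacts [(ea _ _).2 hx, (ea _ _).2 hy, (ea _ _).2 hz]
    omega
  obtain ⟨k1, hk1, hk1b⟩ : ∃ k ∈ K, e k ≠ b := by
    obtain ⟨c⟩ := ‹Nonempty X›
    obtain ⟨k, hk⟩ : ∃ k, k ∈ K := by
      rcases h.cov c with hc | hc
      · exact ⟨c, hc⟩
      · obtain ⟨k, hk, -⟩ := h.nbrS c hc
        exact ⟨k, hk⟩
    obtain ⟨s, hs, hks⟩ := h.nbrK k hk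
    obtain ⟨k', hk', hn⟩ := h.nonS s hs
    by_cases e1 : e k = b
    · refine ⟨k', hk', fun e2 => hn ?_⟩
      rwa [e.injective (e2.trans e1.symm)]
    · exact ⟨k, hk, e1⟩
  obtain ⟨s1, hs1, hks1⟩ := h.nbrK k1 hk1
  obtain ⟨k0, hk0, hn0⟩ := h.nonS s1 hs1
  have hk01 : k0 ≠ k1 := fun e => hn0 (e ▸ hks1)
  have hKS : ∀ k ∈ K, ∀ s ∈ S, k ≠ s := fun k hk s hs e => h.disj k hk (e ▸ hs)
  have hK : ∀ k ∈ K, k = k0 ∨ k = k1 := by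
    intro k hk
    by_contra hcon
    push Not at hcon
    exact hpair k1 k0 k s1 hk1b (h.clique _ hk1 _ hk0 hk01.symm)
      (h.clique _ hk1 _ hk hcon.2.symm) hks1 hcon.1.symm (hKS _ hk0 _ hs1) (hKS _ hk _ hs1)
  have hS : ∀ s ∈ S, C.Adj k1 s → s = s1 := by
    intro s hs hks
    by_contra hcon
    exact hpair k1 k0 s s1 hk1b (h.clique _ hk1 _ hk0 hk01.symm) hks hks1 (hKS _ hk0 _ hs)
      (hKS _ hk0 _ hs1) hcon
  refine ⟨K, S, inferInstance, inferInstance, _, BiUni.of_pair (a0 := ⟨k0, hk0⟩)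
    (a1 := ⟨k1, hk1⟩) (fun e => hk01 (Subtype.ext_iff.1 e)) (fun a => ?_) ⟨s1, hs1⟩, id, id,
    Function.injective_id, Function.injective_id, ?_⟩
  · exact (hK a a.2).imp Subtype.ext Subtype.ext
  · rintro ⟨k, hk⟩ ⟨s, hs⟩
    simp only [id, Subtype.mk.injEq]
    have hs' := hS s hs
    rcases hK k hk with rfl | rfl
    · constructor
      · intro hks
        refine iff_of_false hk01 ?_
        rintro rfl
        exact hn0 hks
      · intro hiff
        obtain ⟨k', hk', hks'⟩ := h.nbrS s hs
        rcases hK k' hk' with rfl | rfl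
        · exact hks'
        · exact absurd (hiff.2 (hS s hs hks')) hk01
    · constructor
      · exact fun hks => iff_of_true rfl (hs' hks)
      · intro hiff
        rw [hiff.1 rfl]
        exact hks1

/-- Induction on the order of `U`: degree classes avoiding the image of `C` are discarded. Once all
degrees occur on `C`, the cases are `U` decomposable, split, or nearly regular. -/
theorem KSIrr.ksEmb {C : SimpleGraph X} {K S : Set X} (h : C.KSIrr K S) [Nonempty X]
    (nd : ¬ C.SetDecomp) (n : ℕ) : ∀ (W : Type u) [Fintype W] (U : SimpleGraph W),
    Fintype.card W = n → U.IsUni → (C ↪g U) → C.KSEmb K S := by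
  induction n using Nat.strong_induction_on with
  | _ n ih =>
  intro W _ U hn hU e
  have ea : ∀ a b, U.Adj (e a) (e b) ↔ C.Adj a b := fun a b => e.map_rel_iff
  by_cases hfull : ∀ w, ∃ c, U.dg (e c) = U.dg w
  · by_cases hsd : U.SetDecomp
    · obtain ⟨P, Q, R, h1, h2, h3, h4, h5, h6, h7, h8, h9, h10⟩ := hsd
      by_cases hR : ∃ c, e c ∈ R
      · by_cases hR' : ∀ c, e c ∈ R
        · exact absurd hR' (h.not_subset e h1 h3 h4 h5 h6 h7 h8 h9 hfull)
        · push Not at hR'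
          obtain ⟨c', hc'⟩ := hR'
          -- An image meeting both the left part and `R` would inherit a decomposition.
          refine absurd ⟨e ⁻¹' P, e ⁻¹' Q, e ⁻¹' R, fun v => h1 (e v), fun v => h2 (e v),
            fun v => h3 (e v), fun v => h4 (e v), fun v hv w hw hvw => ?_, fun v hv w hw hvw => ?_,
            fun v hv w hw => (ea _ _).1 (h7 _ hv _ hw),
            fun v hv w hw hvw => h8 _ hv _ hw ((ea _ _).2 hvw), ⟨c', ?_⟩, hR⟩ nd
          · exact (ea _ _).1 (h5 _ hv _ hw fun e' => hvw (e.injective e'))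
          · exact h6 _ hv _ hw ((ea _ _).2 hvw)
          · have := h1 (e c'); simp only [Set.mem_union, Set.mem_preimage]; tauto
      · push Not at hR
        exact hU.ksEmb_of_dg_ne e (h.dg_ne e h1 h2 h5 h6 h8 hR)
    · by_cases hsp : ∃ P : Finset W, (∀ v ∈ P, ∀ w ∈ P, v ≠ w → U.Adj v w) ∧
          ∀ v ∉ P, ∀ w ∉ P, ¬ U.Adj v w
      · obtain ⟨P, h5, h6⟩ := hsp
        exact hU.ksEmb_of_dg_ne e (h.dg_ne e (P := {v | v ∈ P}) (Q := {v | v ∉ P}) (R := ∅)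
          (fun v => (em (v ∈ P)).imp id Or.inl) (fun v hv hv' => hv' hv) h5 h6 (by simp) (by simp))
      · obtain ⟨b, δ, hb, hδ⟩ := hU.exists_near_regular hsd hsp
        rcases hδ with hδ | hδ
        · exact h.ksEmb_of_dg_le_two e fun v hv => (hb v hv).trans_le hδ
        · refine KSEmb.of_compl h.disj (h.compl.ksEmb_of_dg_le_two (U := Uᶜ) (b := b)
            ⟨e.toEmbedding, ?_⟩ fun v hv => ?_)
          · intro a c
            rw [compl_adj, compl_adj]
            exact and_congr e.injective.ne_iff (not_congr (ea a c))
          · have := U.dg_compl v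
            have := hb v hv
            omega
  · push Not at hfull
    obtain ⟨w, hw⟩ := hfull
    let p : ℕ → Prop := fun n => ∃ c, U.dg (e c) = n
    refine ih _ ?_ {w // p (U.dg w)} (U.comap Subtype.val) rfl (hU.induce p)
      ⟨⟨fun c => ⟨e c, c, rfl⟩, fun a c hac => e.injective (Subtype.ext_iff.1 hac)⟩, ?_⟩
    · rw [← hn]
      refine Fintype.card_subtype_lt (x := w) ?_
      rintro ⟨c, hc⟩
      exact hw c hc
    · intro a c
      exact ea a c

end

end SimpleGraph

/-! ### Composing a determined bipartite relation with a unigraph. -/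

/-- The split graph on `A ⊕ B` in which `A` is a clique, `B` is stable, and the edges between `A`
and `B` are given by `E`. -/
def biGraph {A B : Type u} (E : A → B → Prop) : SimpleGraph (A ⊕ B) where
  Adj
    | .inl a, .inl a' => a ≠ a'
    | .inl a, .inr b => E a b
    | .inr b, .inl a => E a b
    | .inr _, .inr _ => False
  symm := ⟨by
    rintro (a | b) (a' | b') h
    · exact h.symm
    · exact h
    · exact h
    · exact h⟩
  loopless := ⟨by
    rintro (a | b) h
    · exact h rfl
    · exact h⟩

namespace SimpleGraph

section
open scoped Classical

theorem adj_iff_of_amat {V : Type u} {G G' : SimpleGraph V} {u v : V}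
    (h : G'.amat u v = G.amat u v) : G'.Adj u v ↔ G.Adj u v := by
  unfold amat at h
  split_ifs at h with h1 h2 h2 <;> simp_all

theorem sum_amat {V : Type u} {B : Type u} [Fintype B] (G : SimpleGraph V) (v : V) (f : B → V) :
    ∑ b, G.amat v (f b) = ((Finset.univ.filter fun b => G.Adj v (f b)).card : ℤ) := by
  simp [amat]

variable {A B W : Type u} [Fintype A] [Fintype B] [Fintype W]

theorem dg_sum_type (G : SimpleGraph ((A ⊕ B) ⊕ W)) (v : (A ⊕ B) ⊕ W) :
    (G.dg v : ℤ) = ∑ a, G.amat v (.inl (.inl a)) + ∑ b, G.amat v (.inl (.inr b)) +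
      ∑ w, G.amat v (.inr w) := by
  rw [dg_eq_sum, Fintype.sum_sum_type, Fintype.sum_sum_type]

/-- Edges between `A` and `B` cancel. What remains is largest exactly when `A` is a clique complete
to `W` and `B` is stable with no edges to `W`. -/
theorem sum_dg_sub (G : SimpleGraph ((A ⊕ B) ⊕ W)) :
    ∑ a : A, (G.dg (.inl (.inl a)) : ℤ) - ∑ b : B, (G.dg (.inl (.inr b)) : ℤ) =
      ∑ a : A, ∑ a' : A, G.amat (.inl (.inl a)) (.inl (.inl a')) +
      ∑ a : A, ∑ w : W, G.amat (.inl (.inl a)) (.inr w) -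
      ∑ b : B, ∑ b' : B, G.amat (.inl (.inr b)) (.inl (.inr b')) -
      ∑ b : B, ∑ w : W, G.amat (.inl (.inr b)) (.inr w) := by
  simp only [dg_sum_type, Finset.sum_add_distrib]
  have : ∑ b : B, ∑ a : A, G.amat (.inl (.inr b)) (.inl (.inl a)) =
      ∑ a : A, ∑ b : B, G.amat (.inl (.inl a)) (.inl (.inr b)) := by
    rw [Finset.sum_comm]
    simp only [amat_symm]
  rw [this]
  ring

theorem sum_sum_eq_zero {I J : Type u} [Fintype I] [Fintype J] {f : I → J → ℤ}
    (h : ∀ i j, 0 ≤ f i j) (h0 : ∑ i, ∑ j, f i j ≤ 0) (i : I) (j : J) : f i j = 0 := by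
  have h1 := (Finset.sum_eq_zero_iff_of_nonneg fun i _ => Finset.sum_nonneg fun j _ => h i j).1
    (le_antisymm h0 (Finset.sum_nonneg fun i _ => Finset.sum_nonneg fun j _ => h i j)) i
    (Finset.mem_univ i)
  exact (Finset.sum_eq_zero_iff_of_nonneg fun j _ => h i j).1 h1 j (Finset.mem_univ j)

/-- Composing a bipartite relation that is determined by its row and column sums with a unigraph
gives a unigraph. -/
theorem IsUni.tyshkevichComp {E : A → B → Prop} (hE : BiUni E) {H : SimpleGraph W} (hH : H.IsUni) :
    (tyshkevichComp (biGraph E) (Set.range Sum.inl) H).IsUni := by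
  obtain ⟨U, hU⟩ : ∃ U, U = _root_.tyshkevichComp (biGraph E) (Set.range Sum.inl) H := ⟨_, rfl⟩
  rw [← hU]
  have uaa : ∀ a a' : A, U.Adj (.inl (.inl a)) (.inl (.inl a')) ↔ a ≠ a' := by
    rw [hU]; exact fun a a' => Iff.rfl
  have uab : ∀ (a : A) (b : B), U.Adj (.inl (.inl a)) (.inl (.inr b)) ↔ E a b := by
    rw [hU]; exact fun a a' => Iff.rfl
  have ubb : ∀ b b' : B, ¬ U.Adj (.inl (.inr b)) (.inl (.inr b')) := by
    rw [hU]; exact fun a a' h => h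
  have uaw : ∀ (a : A) (w : W), U.Adj (.inl (.inl a)) (.inr w) := by
    rw [hU]; exact fun a w => ⟨a, rfl⟩
  have ubw : ∀ (b : B) (w : W), ¬ U.Adj (.inl (.inr b)) (.inr w) := by
    rw [hU]
    rintro b w ⟨a, ha⟩
    cases ha
  have uww : ∀ w w' : W, U.Adj (.inr w) (.inr w') ↔ H.Adj w w' := by
    rw [hU]; exact fun a a' => Iff.rfl
  intro G hG
  have le1 : ∀ u v, G.amat u v ≤ 1 := fun u v => by unfold amat; split_ifs <;> simp
  have ge0 : ∀ u v, 0 ≤ G.amat u v := fun u v => by unfold amat; split_ifs <;> simp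
  have f1 : ∀ a a' : A, 0 ≤ U.amat (.inl (.inl a)) (.inl (.inl a')) -
      G.amat (.inl (.inl a)) (.inl (.inl a')) := by
    intro a a'
    by_cases h : a = a'
    · rw [h, amat_self, amat_self, sub_self]
    · rw [amat_one ((uaa a a').2 h)]
      linarith [le1 (.inl (.inl a)) (.inl (.inl a'))]
  have f2 : ∀ (a : A) (w : W), 0 ≤ U.amat (.inl (.inl a)) (.inr w) -
      G.amat (.inl (.inl a)) (.inr w) := by
    intro a w
    rw [amat_one (uaw a w)]
    linarith [le1 (.inl (.inl a)) (.inr w)]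
  have f3 : ∀ b b' : B, 0 ≤ G.amat (.inl (.inr b)) (.inl (.inr b')) -
      U.amat (.inl (.inr b)) (.inl (.inr b')) := by
    intro b b'
    rw [amat_zero (ubb b b'), sub_zero]
    exact ge0 _ _
  have f4 : ∀ (b : B) (w : W), 0 ≤ G.amat (.inl (.inr b)) (.inr w) -
      U.amat (.inl (.inr b)) (.inr w) := by
    intro b w
    rw [amat_zero (ubw b w), sub_zero]
    exact ge0 _ _
  have s1 := Finset.sum_nonneg fun a (_ : a ∈ Finset.univ) =>
    Finset.sum_nonneg fun a' (_ : a' ∈ Finset.univ) => f1 a a'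
  have s2 := Finset.sum_nonneg fun a (_ : a ∈ Finset.univ) =>
    Finset.sum_nonneg fun a' (_ : a' ∈ Finset.univ) => f2 a a'
  have s3 := Finset.sum_nonneg fun a (_ : a ∈ Finset.univ) =>
    Finset.sum_nonneg fun a' (_ : a' ∈ Finset.univ) => f3 a a'
  have s4 := Finset.sum_nonneg fun a (_ : a ∈ Finset.univ) =>
    Finset.sum_nonneg fun a' (_ : a' ∈ Finset.univ) => f4 a a'
  have e1 := sum_dg_sub U
  have e2 := sum_dg_sub G
  simp only [hG] at e2
  -- Equal degrees make the four nonnegative total defects add up to zero, so each entry agrees with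
  -- the composition. The remaining freedom, between `A` and `B` and inside `W`, is governed by `hE`
  -- and `hH`.
  have g1 := sum_sum_eq_zero f1 (by simp only [Finset.sum_sub_distrib] at s1 s2 s3 s4 ⊢; linarith)
  have g2 := sum_sum_eq_zero f2 (by simp only [Finset.sum_sub_distrib] at s1 s2 s3 s4 ⊢; linarith)
  have g3 := sum_sum_eq_zero f3 (by simp only [Finset.sum_sub_distrib] at s1 s2 s3 s4 ⊢; linarith)
  have g4 := sum_sum_eq_zero f4 (by simp only [Finset.sum_sub_distrib] at s1 s2 s3 s4 ⊢; linarith)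
  have g1' : ∀ a a' : A, G.amat (.inl (.inl a)) (.inl (.inl a')) =
      U.amat (.inl (.inl a)) (.inl (.inl a')) := fun a a' => by linarith [g1 a a']
  have g2' : ∀ (a : A) (w : W), G.amat (.inl (.inl a)) (.inr w) =
      U.amat (.inl (.inl a)) (.inr w) := fun a w => by linarith [g2 a w]
  have g3' : ∀ b b' : B, G.amat (.inl (.inr b)) (.inl (.inr b')) =
      U.amat (.inl (.inr b)) (.inl (.inr b')) := fun a a' => by linarith [g3 a a']
  have g4' : ∀ (b : B) (w : W), G.amat (.inl (.inr b)) (.inr w) =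
      U.amat (.inl (.inr b)) (.inr w) := fun b w => by linarith [g4 b w]
  have gd : ∀ v, (G.dg v : ℤ) = U.dg v := fun v => by rw [hG]
  obtain ⟨σ, τ, hστ⟩ := hE (fun a b => G.Adj (.inl (.inl a)) (.inl (.inr b))) (fun a => by
      have h := gd (.inl (.inl a))
      rw [dg_sum_type, dg_sum_type] at h
      simp only [g1', g2'] at h
      have h' : ∑ b : B, G.amat (.inl (.inl a)) (.inl (.inr b)) =
        ∑ b : B, U.amat (.inl (.inl a)) (.inl (.inr b)) := by linarith
      rw [sum_amat _ _ fun b : B => Sum.inl (Sum.inr b),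
        sum_amat _ _ fun b : B => Sum.inl (Sum.inr b)] at h'
      simp only [uab] at h'
      exact_mod_cast h') (fun b => by
      have h := gd (.inl (.inr b))
      rw [dg_sum_type, dg_sum_type] at h
      simp only [g3', g4'] at h
      have h' : ∑ a : A, G.amat (.inl (.inr b)) (.inl (.inl a)) =
        ∑ a : A, U.amat (.inl (.inr b)) (.inl (.inl a)) := by linarith
      rw [sum_amat _ _ fun a : A => Sum.inl (Sum.inl a),
        sum_amat _ _ fun a : A => Sum.inl (Sum.inl a)] at h'
      simp only [G.adj_comm (.inl (.inr b)), U.adj_comm (.inl (.inr b)), uab] at h'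
      exact_mod_cast h')
  obtain ⟨φ⟩ := hH (G.comap Sum.inr) (fun w => by
    have h := gd (.inr w)
    rw [dg_sum_type, dg_sum_type] at h
    simp only [G.amat_symm (.inr w) (.inl _), U.amat_symm (.inr w) (.inl _), g2', g4'] at h
    have h' : ∑ w' : W, G.amat (.inr w) (.inr w') = ∑ w' : W, U.amat (.inr w) (.inr w') := by
      linarith
    rw [sum_amat _ _ fun w : W => Sum.inr w, sum_amat _ _ fun w : W => Sum.inr w] at h'
    simp only [uww] at h'
    exact_mod_cast h')
  have hφ : ∀ w w', G.Adj (.inr (φ w)) (.inr (φ w')) ↔ H.Adj w w' := fun w w' => φ.map_rel_iff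
  have i1 := fun a a' => adj_iff_of_amat (g1' a a')
  have i2 := fun a a' => adj_iff_of_amat (g2' a a')
  have i3 := fun a a' => adj_iff_of_amat (g3' a a')
  have i4 := fun a a' => adj_iff_of_amat (g4' a a')
  refine ⟨⟨Equiv.sumCongr (Equiv.sumCongr σ τ) φ.toEquiv, ?_⟩⟩
  have c1 : ∀ a, Equiv.sumCongr (Equiv.sumCongr σ τ) φ.toEquiv (.inl (.inl a)) =
    .inl (.inl (σ a)) := fun _ => rfl
  have c2 : ∀ a, Equiv.sumCongr (Equiv.sumCongr σ τ) φ.toEquiv (.inl (.inr a)) =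
    .inl (.inr (τ a)) := fun _ => rfl
  have c3 : ∀ a, Equiv.sumCongr (Equiv.sumCongr σ τ) φ.toEquiv (.inr a) =
    .inr (φ a) := fun _ => rfl
  rintro ((a | b) | w) ((a' | b') | w')
  · rw [c1, c1, i1, uaa, uaa, σ.injective.ne_iff]
  · rw [c1, c2, hστ, uab]
  · rw [c1, c3, i2]; exact iff_of_true (uaw _ _) (uaw _ _)
  · rw [c1, c2, G.adj_comm, U.adj_comm, hστ, uab]
  · rw [c2, c2, i3]; exact iff_of_false (ubb _ _) (ubb _ _)
  · rw [c2, c3, i4]; exact iff_of_false (ubw _ _) (ubw _ _)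
  · rw [c1, c3, G.adj_comm, U.adj_comm, i2]; exact iff_of_true (uaw _ _) (uaw _ _)
  · rw [c2, c3, G.adj_comm, U.adj_comm, i4]; exact iff_of_false (ubw _ _) (ubw _ _)
  · rw [c3, c3, hφ, uww]

end

end SimpleGraph

/-! ### Closure of HCU under composition. -/

theorem IsKSPartition.cov {V : Type u} {G : SimpleGraph V} {K S : Set V} (h : IsKSPartition G K S)
    (v : V) : v ∈ K ∨ v ∈ S := by
  rw [← Set.mem_union, show K ∪ S = Set.univ from h.isCompl.sup_eq_top]
  trivial

theorem IsKSPartition.disj {V : Type u} {G : SimpleGraph V} {K S : Set V}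
    (h : IsKSPartition G K S) : ∀ v ∈ K, v ∉ S := fun _ h1 h2 =>
  Set.disjoint_left.1 h.isCompl.disjoint h1 h2

theorem IsKSPartition.clique {V : Type u} {G : SimpleGraph V} {K S : Set V}
    (h : IsKSPartition G K S) : ∀ v ∈ K, ∀ w ∈ K, v ≠ w → G.Adj v w := fun _ hv _ hw hvw =>
  h.isClique hv hw hvw

theorem IsKSPartition.stable {V : Type u} {G : SimpleGraph V} {K S : Set V}
    (h : IsKSPartition G K S) : ∀ v ∈ S, ∀ w ∈ S, ¬ G.Adj v w := fun _ hv _ hw hvw =>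
  h.isIndepSet hv hw hvw.ne hvw

-- The composition embeds in the unigraph obtained by composing the relation around `C` with a
-- unigraph containing `H`.
open SimpleGraph in
open scoped Classical in
theorem InHCU.comp {C : KSGraph.{u}} {H : FinGraph.{u}} (hC : C.graph.KSEmb C.K C.S)
    (hH : InHCU H.graph) : InHCU (C.comp H).graph := by
  obtain ⟨A, B, _, _, E, hE, f, g, hf, hg, he⟩ := hC
  obtain ⟨W, _, U, hU, ⟨e⟩⟩ := hH
  have hcov : ∀ v, v ∉ C.K → v ∈ C.S := fun v h1 => (C.isKSPartition.cov v).resolve_left h1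
  refine ⟨(A ⊕ B) ⊕ W, inferInstance, tyshkevichComp (biGraph E) (Set.range Sum.inl) U,
    isUnigraph_iff.2 (IsUni.tyshkevichComp hE (isUnigraph_iff.1 hU)), ?_⟩
  let F : C.V → A ⊕ B := fun v =>
    if h : v ∈ C.K then .inl (f ⟨v, h⟩) else .inr (g ⟨v, hcov v h⟩)
  have F1 : ∀ v (h : v ∈ C.K), F v = .inl (f ⟨v, h⟩) := fun v h => dif_pos h
  have F2 : ∀ v (h : v ∉ C.K), F v = .inr (g ⟨v, hcov v h⟩) := fun v h => dif_neg h
  have hFinj : F.Injective := by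
    intro v w hvw
    by_cases hv : v ∈ C.K <;> by_cases hw : w ∈ C.K
    · rw [F1 v hv, F1 w hw] at hvw
      exact Subtype.ext_iff.1 (hf (Sum.inl_injective hvw))
    · rw [F1 v hv, F2 w hw] at hvw; cases hvw
    · rw [F2 v hv, F1 w hw] at hvw; cases hvw
    · rw [F2 v hv, F2 w hw] at hvw
      exact Subtype.ext_iff.1 (hg (Sum.inr_injective hvw))
  have hFadj : ∀ v w, (biGraph E).Adj (F v) (F w) ↔ C.graph.Adj v w := by
    intro v w
    by_cases hv : v ∈ C.K <;> by_cases hw : w ∈ C.K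
    · rw [F1 v hv, F1 w hw]
      change f ⟨v, hv⟩ ≠ f ⟨w, hw⟩ ↔ _
      rw [hf.ne_iff]
      exact ⟨fun h => C.isKSPartition.isClique hv hw fun e => h (Subtype.ext e),
        fun h e => h.ne (Subtype.ext_iff.1 e)⟩
    · rw [F1 v hv, F2 w hw]
      exact (he ⟨v, hv⟩ ⟨w, hcov w hw⟩).symm
    · rw [F2 v hv, F1 w hw, C.graph.adj_comm]
      exact (he ⟨w, hw⟩ ⟨v, hcov v hv⟩).symm
    · rw [F2 v hv, F2 w hw]
      refine iff_of_false (fun h => h) fun h => ?_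
      exact C.isKSPartition.isIndepSet (hcov v hv) (hcov w hw) h.ne h
  have hFK : ∀ v, F v ∈ Set.range (Sum.inl : A → A ⊕ B) ↔ v ∈ C.K := by
    intro v
    by_cases hv : v ∈ C.K
    · rw [F1 v hv]; exact iff_of_true ⟨_, rfl⟩ hv
    · rw [F2 v hv]; exact iff_of_false (by rintro ⟨a, ha⟩; cases ha) hv
  refine ⟨⟨⟨Sum.map F e, Function.Injective.sumMap hFinj e.injective⟩, ?_⟩⟩
  rintro (v | v) (w | w)
  · exact hFadj v w
  · exact hFK v
  · exact hFK w
  · exact e.map_rel_iff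

/-! ### Left parts, and existence of Tyshkevich decompositions. -/

section
open SimpleGraph

/-- `K ∪ S` and its complement are the parts of a decomposition of `G`. -/
structure IsLeftPart {V : Type u} (G : SimpleGraph V) (K S : Set V) : Prop where
  disj : ∀ v ∈ K, v ∉ S
  clique : ∀ v ∈ K, ∀ w ∈ K, v ≠ w → G.Adj v w
  stable : ∀ v ∈ S, ∀ w ∈ S, ¬ G.Adj v w
  complete : ∀ v ∈ K, ∀ w, w ∉ K ∪ S → G.Adj v w
  empty : ∀ v ∈ S, ∀ w, w ∉ K ∪ S → ¬ G.Adj v w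
  nonempty : (K ∪ S).Nonempty
  nonempty_compl : (K ∪ S)ᶜ.Nonempty

theorem SimpleGraph.SetDecomp.exists_isLeftPart {V : Type u} {G : SimpleGraph V}
    (h : G.SetDecomp) : ∃ K S, IsLeftPart G K S := by
  obtain ⟨K, S, B, h1, h2, h3, h4, h5, h6, h7, h8, h9, ⟨w, hw⟩⟩ := h
  have hB : ∀ w, w ∉ K ∪ S → w ∈ B := fun w hw => by
    rw [Set.mem_union] at hw
    have := h1 w
    tauto
  exact ⟨K, S, h2, h5, h6, fun v hv w hw => h7 v hv w (hB w hw),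
    fun v hv w hw => h8 v hv w (hB w hw), h9, w, fun e => e.elim (fun e => h3 w e hw)
      fun e => h4 w e hw⟩

namespace IsLeftPart

variable {V : Type u} [Fintype V] {G : SimpleGraph V} {K S : Set V}

open scoped Classical in
/-- The split graph induced by `G` on `K ∪ S`. -/
noncomputable def left (h : IsLeftPart G K S) : KSGraph.{u} where
  V := ↥(K ∪ S)
  graph := G.comap Subtype.val
  K := Subtype.val ⁻¹' K
  S := Subtype.val ⁻¹' S
  isKSPartition :=
    { isCompl := by
        rw [isCompl_iff, Set.disjoint_left, codisjoint_iff]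
        exact ⟨fun v h1 h2 => h.disj v h1 h2, Set.eq_univ_of_forall fun v => v.2⟩
      isClique := fun v hv w hw hvw => h.clique v hv w hw fun e => hvw (Subtype.ext e)
      isIndepSet := fun v hv w hw _ e => h.stable v hv w hw e }

open scoped Classical in
variable (G K S) in
/-- The graph induced by `G` on the complement of `K ∪ S`. -/
noncomputable def right : FinGraph.{u} where
  V := ↥((K ∪ S)ᶜ : Set V)
  graph := G.comap Subtype.val

open scoped Classical in
theorem iso (h : IsLeftPart G K S) : Nonempty (G ≃g (h.left.comp (right G K S)).graph) := by
  refine ⟨SimpleGraph.Iso.symm ⟨Equiv.Set.sumCompl (K ∪ S), ?_⟩⟩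
  rintro (⟨v, hv⟩ | ⟨v, hv⟩) (⟨w, hw⟩ | ⟨w, hw⟩)
  · exact Iff.rfl
  · change G.Adj v w ↔ v ∈ K
    exact ⟨fun e => hv.resolve_right fun hS => h.empty v hS w hw e, fun e => h.complete v e w hw⟩
  · change G.Adj v w ↔ w ∈ K
    rw [G.adj_comm]
    exact ⟨fun e => hw.resolve_right fun hS => h.empty w hS v hv e, fun e => h.complete w e v hv⟩
  · exact Iff.rfl

theorem decomposable (h : IsLeftPart G K S) : Decomposable G :=
  ⟨h.left, right G K S, h.nonempty.to_subtype, h.nonempty_compl.to_subtype, h.iso⟩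

/-- A decomposition of the left part compatible with `K` and `S` gives a smaller left part. -/
theorem exists_ssubset (h : IsLeftPart G K S) (hs : h.left.graph.KSSplit h.left.K h.left.S) :
    ∃ K' S', IsLeftPart G K' S' ∧ K' ∪ S' ⊂ K ∪ S := by
  obtain ⟨P, Q, h1, h2, h3, h4, ⟨⟨v, hvKS⟩, hv⟩, ⟨w, hwKS⟩, hw⟩ := hs
  have hPK : Subtype.val '' P ⊆ K := by rintro _ ⟨x, hx, rfl⟩; exact h1 hx
  have hQS : Subtype.val '' Q ⊆ S := by rintro _ ⟨x, hx, rfl⟩; exact h2 hx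
  have hsub : Subtype.val '' P ∪ Subtype.val '' Q ⊆ K ∪ S := Set.union_subset_union hPK hQS
  have hmem : ∀ x : ↥(K ∪ S), (x : V) ∈ Subtype.val '' P ∪ Subtype.val '' Q → x ∈ P ∨ x ∈ Q := by
    rintro x (⟨y, hy, e⟩ | ⟨y, hy, e⟩)
    · exact Or.inl (Subtype.ext e ▸ hy)
    · exact Or.inr (Subtype.ext e ▸ hy)
  have hwn : w ∉ Subtype.val '' P ∪ Subtype.val '' Q := fun e =>
    (hmem ⟨w, hwKS⟩ e).elim hw.1 hw.2
  refine ⟨Subtype.val '' P, Subtype.val '' Q, ⟨fun x hx hx' => h.disj x (hPK hx) (hQS hx'),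
    fun x hx y hy => h.clique x (hPK hx) y (hPK hy),
    fun x hx y hy => h.stable x (hQS hx) y (hQS hy), ?_, ?_, ?_, ⟨w, hwn⟩⟩,
    (Set.ssubset_iff_of_subset hsub).2 ⟨w, hwKS, hwn⟩⟩
  · rintro _ ⟨x, hx, rfl⟩ y hy
    by_cases hyKS : y ∈ K ∪ S
    · exact h3 x hx ⟨y, hyKS⟩ (fun e => hy (Or.inl ⟨_, e, rfl⟩)) fun e => hy (Or.inr ⟨_, e, rfl⟩)
    · exact h.complete x (h1 hx) y hyKS
  · rintro _ ⟨x, hx, rfl⟩ y hy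
    by_cases hyKS : y ∈ K ∪ S
    · exact h4 x hx ⟨y, hyKS⟩ (fun e => hy (Or.inl ⟨_, e, rfl⟩)) fun e => hy (Or.inr ⟨_, e, rfl⟩)
    · exact h.empty x (h2 hx) y hyKS
  · exact ⟨v, hv.elim (fun e => Or.inl ⟨⟨v, hvKS⟩, e, rfl⟩) fun e =>
      Or.inr ⟨⟨v, hvKS⟩, e, rfl⟩⟩

end IsLeftPart

theorem SimpleGraph.SetDecomp.nontrivial {V : Type u} {G : SimpleGraph V} (h : G.SetDecomp) :
    Nontrivial V := by
  obtain ⟨K, S, B, -, -, h3, h4, -, -, -, -, ⟨v, hv⟩, ⟨w, hw⟩⟩ := h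
  refine ⟨v, w, ?_⟩
  rintro rfl
  exact hv.elim (fun e => h3 v e hw) fun e => h4 v e hw

theorem SimpleGraph.SetDecomp.of_iso {V W : Type u} {G : SimpleGraph V} {H : SimpleGraph W}
    (h : H.SetDecomp) (φ : G ≃g H) : G.SetDecomp := by
  obtain ⟨K, S, B, h1, h2, h3, h4, h5, h6, h7, h8, ⟨v, hv⟩, ⟨w, hw⟩⟩ := h
  refine ⟨φ ⁻¹' K, φ ⁻¹' S, φ ⁻¹' B, fun v => h1 (φ v), fun v => h2 (φ v), fun v => h3 (φ v),
    fun v => h4 (φ v), fun v hv w hw hvw => ?_, fun v hv w hw hvw => ?_,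
    fun v hv w hw => φ.map_rel_iff.1 (h7 _ hv _ hw),
    fun v hv w hw hvw => h8 _ hv _ hw (φ.map_rel_iff.2 hvw), ⟨φ.symm v, ?_⟩, φ.symm w, ?_⟩
  · exact φ.map_rel_iff.1 (h5 _ hv _ hw fun e => hvw (φ.injective e))
  · exact h6 _ hv _ hw (φ.map_rel_iff.2 hvw)
  · simpa using hv
  · simpa using hw

theorem setDecomp_comp (C : KSGraph.{u}) (H : FinGraph.{u}) (hC : Nonempty C.V)
    (hH : Nonempty H.V) : (C.comp H).graph.SetDecomp := by
  obtain ⟨c⟩ := hC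
  obtain ⟨b⟩ := hH
  have hp := C.isKSPartition
  refine ⟨Sum.inl '' C.K, Sum.inl '' C.S, Set.range Sum.inr, ?_, ?_, ?_, ?_, ?_, ?_, ?_, ?_,
    ⟨Sum.inl c, (hp.cov c).elim (fun h => Or.inl ⟨c, h, rfl⟩) fun h => Or.inr ⟨c, h, rfl⟩⟩,
    Sum.inr b, b, rfl⟩
  · rintro (v | v)
    · exact (hp.cov v).elim (fun h => Or.inl ⟨v, h, rfl⟩) fun h => Or.inr (Or.inl ⟨v, h, rfl⟩)
    · exact Or.inr (Or.inr ⟨v, rfl⟩)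
  · rintro _ ⟨v, hv, rfl⟩ ⟨w, hw, e⟩
    cases e
    exact hp.disj v hv hw
  · rintro _ ⟨v, hv, rfl⟩ ⟨w, e⟩
    cases e
  · rintro _ ⟨v, hv, rfl⟩ ⟨w, e⟩
    cases e
  · rintro _ ⟨v, hv, rfl⟩ _ ⟨w, hw, rfl⟩ hvw
    exact hp.clique v hv w hw fun e => hvw (e ▸ rfl)
  · rintro _ ⟨v, hv, rfl⟩ _ ⟨w, hw, rfl⟩ hvw
    exact hp.stable v hv w hw hvw
  · rintro _ ⟨v, hv, rfl⟩ _ ⟨w, rfl⟩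
    exact hv
  · rintro _ ⟨v, hv, rfl⟩ _ ⟨w, rfl⟩ hvw
    exact hp.disj v hvw hv

theorem decomposable_iff {V : Type u} [Fintype V] {G : SimpleGraph V} :
    Decomposable G ↔ G.SetDecomp := by
  constructor
  · rintro ⟨C, H, hC, hH, ⟨φ⟩⟩
    exact (setDecomp_comp C H hC hH).of_iso φ
  · intro h
    obtain ⟨K, S, h'⟩ := h.exists_isLeftPart
    exact h'.decomposable

theorem KSGraph.comp_congr (C : KSGraph.{u}) {H H' : FinGraph.{u}} (φ : H.graph ≃g H'.graph) :
    Nonempty ((C.comp H).graph ≃g (C.comp H').graph) := by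
  refine ⟨⟨Equiv.sumCongr (Equiv.refl C.V) φ.toEquiv, ?_⟩⟩
  rintro (v | v) (w | w)
  · exact Iff.rfl
  · exact Iff.rfl
  · exact Iff.rfl
  · exact φ.map_rel_iff

/-- A decomposable graph has a decomposition with an indecomposable left part. -/
theorem SimpleGraph.SetDecomp.exists_indecomposable {V : Type u} [Fintype V] {G : SimpleGraph V}
    (h : G.SetDecomp) : ∃ K S, ∃ h' : IsLeftPart G K S, Indecomposable h'.left.graph := by
  -- A left part that is minimal as a vertex set is indecomposable.
  obtain ⟨p, hp, hmin⟩ := (Set.toFinite {p : Set V × Set V | IsLeftPart G p.1 p.2}).exists_minimalFor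
    (fun p => p.1 ∪ p.2) _ (by
      obtain ⟨K, S, h'⟩ := h.exists_isLeftPart
      exact ⟨(K, S), h'⟩)
  refine ⟨p.1, p.2, hp, fun hd => ?_⟩
  have hsd := decomposable_iff.1 hd
  have := hsd.nontrivial
  have hk := (IsLeftPart.left hp).isKSPartition
  -- A decomposition of the left part might use another partition into clique and stable set. But if
  -- none respects the given one, that partition satisfies `KSIrr`, and then every decomposition
  -- does respect it.
  have hsplit : (IsLeftPart.left hp).graph.KSSplit (IsLeftPart.left hp).K
      (IsLeftPart.left hp).S := by
    by_contra hn
    exact hn ((KSIrr.of_not_ksSplit hk.cov hk.disj hk.clique hk.stable hn).ksSplit hsd)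
  obtain ⟨K', S', h', hss⟩ := IsLeftPart.exists_ssubset hp hsplit
  exact hss.2 (hmin (j := (K', S')) h' hss.1)

/-- Strong induction on the order: only the right part is decomposed further. -/
theorem exists_isTyshkevichDecomposition (n : ℕ) : ∀ (V : Type u) [Fintype V] (G : SimpleGraph V),
    Fintype.card V = n →
    ∃ (L : List KSGraph.{u}) (G₀ : FinGraph.{u}), IsTyshkevichDecomposition G L G₀ := by
  induction n using Nat.strong_induction_on with
  | _ n ih =>
  intro V _ G hn
  by_cases hd : Decomposable G
  · obtain ⟨K, S, h, hi⟩ := (decomposable_iff.1 hd).exists_indecomposable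
    have hleft : Nonempty h.left.V := h.nonempty.to_subtype
    obtain ⟨b⟩ : Nonempty (IsLeftPart.right G K S).V := h.nonempty_compl.to_subtype
    obtain ⟨φ⟩ := h.iso
    have hcard : Fintype.card (IsLeftPart.right G K S).V < n := by
      have h1 := Fintype.card_congr φ.toEquiv
      have h2 : Fintype.card (h.left.comp (IsLeftPart.right G K S)).V =
        Fintype.card h.left.V + Fintype.card (IsLeftPart.right G K S).V := Fintype.card_sum
      have h3 := Fintype.card_pos (α := h.left.V)
      omega
    obtain ⟨L, G₀, hL⟩ := ih _ hcard _ (IsLeftPart.right G K S).graph rfl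
    obtain ⟨ψ⟩ := hL.iso
    obtain ⟨χ⟩ := h.left.comp_congr ψ
    refine ⟨h.left :: L, G₀, ?_, fun _ => ?_, ?_, hL.indecomposable_right, ⟨φ.trans χ⟩⟩
    · rw [List.forall_mem_cons]
      exact ⟨hleft, hL.nonempty_left⟩
    · cases L with
      | nil => exact ⟨ψ b⟩
      | cons C L => exact hL.nonempty_right (List.cons_ne_nil C L)
    · rw [List.forall_mem_cons]
      exact ⟨hi, hL.indecomposable_left⟩
  · exact ⟨[], ⟨V, G⟩, by simp, by simp, by simp, hd, ⟨SimpleGraph.Iso.refl⟩⟩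

/-! ### The characterisation through components. -/

theorem KSGraph.ksEmb (C : KSGraph.{u}) (hC : Nonempty C.V) (h : InI C.graph) :
    C.graph.KSEmb C.K C.S := by
  classical
  obtain ⟨hi, W, _, U, hU, ⟨e⟩⟩ := h
  have hk := C.isKSPartition
  have nd : ¬ C.graph.SetDecomp := fun h => hi (decomposable_iff.2 h)
  rcases subsingleton_or_nontrivial C.V with hs | hs
  · refine ⟨C.K, C.S, inferInstance, inferInstance, fun k s => C.graph.Adj k s,
      BiUni.of_isEmpty _ ?_, id, id, Function.injective_id, Function.injective_id,
      fun _ _ => Iff.rfl⟩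
    by_contra hcon
    rw [not_or, not_isEmpty_iff, not_isEmpty_iff] at hcon
    obtain ⟨⟨k⟩, ⟨s⟩⟩ := hcon
    exact hk.disj k k.2 (Subsingleton.elim (s : C.V) k ▸ s.2)
  · exact (KSIrr.of_not_ksSplit hk.cov hk.disj hk.clique hk.stable fun h =>
      nd (h.setDecomp hk.disj hk.clique hk.stable)).ksEmb nd _ W U rfl (isUnigraph_iff.1 hU) e

theorem inHCU_iteratedComp (L : List KSGraph.{u}) (G₀ : FinGraph.{u})
    (hne : ∀ C ∈ L, Nonempty C.V) (hL : ∀ C ∈ L, InI C.graph) (h0 : InHCU G₀.graph) :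
    InHCU (iteratedComp L G₀).graph := by
  induction L with
  | nil => exact h0
  | cons C L ih =>
    rw [List.forall_mem_cons] at hne hL
    exact InHCU.comp (C.ksEmb hne.1 hL.1) (ih hne.2 hL.2)

theorem InHCU.of_isIndContained {V W : Type u} {G : SimpleGraph V} {H : SimpleGraph W}
    (h : InHCU H) (e : G.IsIndContained H) : InHCU G := by
  obtain ⟨W, i, U, hU, hH⟩ := h
  exact ⟨W, i, U, hU, e.trans hH⟩

theorem isIndContained_comp_left (C : KSGraph.{u}) (H : FinGraph.{u}) :
    C.graph.IsIndContained (C.comp H).graph :=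
  ⟨⟨⟨Sum.inl, Sum.inl_injective⟩, Iff.rfl⟩⟩

theorem isIndContained_comp_right (C : KSGraph.{u}) (H : FinGraph.{u}) :
    H.graph.IsIndContained (C.comp H).graph :=
  ⟨⟨⟨Sum.inr, Sum.inr_injective⟩, Iff.rfl⟩⟩

theorem isIndContained_iteratedComp (L : List KSGraph.{u}) (G₀ : FinGraph.{u}) :
    (∀ C ∈ L, C.graph.IsIndContained (iteratedComp L G₀).graph) ∧
      G₀.graph.IsIndContained (iteratedComp L G₀).graph := by
  induction L with
  | nil => exact ⟨by simp, SimpleGraph.IsIndContained.refl _⟩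
  | cons C L ih =>
    rw [List.forall_mem_cons]
    have hr := isIndContained_comp_right C (iteratedComp L G₀)
    exact ⟨⟨isIndContained_comp_left C _, fun D hD => (ih.1 D hD).trans hr⟩, ih.2.trans hr⟩

end

theorem mainTheorem1 {V : Type u} [Fintype V] (G : SimpleGraph V) :
    (∃ (L : List KSGraph.{u}) (G₀ : FinGraph.{u}), IsTyshkevichDecomposition G L G₀) ∧
    ∀ (L : List KSGraph.{u}) (G₀ : FinGraph.{u}), IsTyshkevichDecomposition G L G₀ →
      (InHCU G ↔ (∀ C ∈ L, InI C.graph) ∧ InI G₀.graph) := by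
  refine ⟨exists_isTyshkevichDecomposition _ V G rfl, fun L G₀ h => ?_⟩
  obtain ⟨φ⟩ := h.iso
  obtain ⟨c1, c2⟩ := isIndContained_iteratedComp L G₀
  constructor
  · intro hG
    have hI : InHCU (iteratedComp L G₀).graph := hG.of_isIndContained ⟨φ.symm.toEmbedding⟩
    exact ⟨fun C hC => ⟨h.indecomposable_left C hC, hI.of_isIndContained (c1 C hC)⟩,
      h.indecomposable_right, hI.of_isIndContained c2⟩
  · rintro ⟨h1, -, h2⟩
    exact (inHCU_iteratedComp L G₀ h.nonempty_left h1 h2).of_isIndContained ⟨φ.toEmbedding⟩
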